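/- Fix $\alpha\in(0,\tfrac14)$. Let $\omega\in C^2(\mathbb R^2)$ be $2$-periodic in each variable and double-odd, i.e. $\omega(-x_1,x_2)=-\omega(x_1,x_2)=\omega(x_1,-x_2)$ (for instance $\omega=\omega(\cdot,t)$, the vorticity of a smooth double-odd solution of the 2D Euler equation on the torus $[-1,1)^2$ at a time $t$). For $x=(x_1,x_2)$ write $\tilde x=(-x_1,x_2)$, $\bar x=(x_1,-x_2)$, and let $$G_1(x,y)=\frac{y_1(y_2-x_2)}{|y-x|^2|y-\tilde x|^2}+\frac{y_1(y_2+x_2)}{|y+x|^2|y-\bar x|^2},\qquad G_2(x,y)=\frac{y_2(y_1+x_1)}{|y+x|^2|y-\tilde x|^2}+\frac{y_2(y_1-x_1)}{|y-x|^2|y-\bar x|^2},$$ $$Q_i(x)=\frac2\pi\int_{[0,1]^2}G_i(x,y)\,\omega(y)\,dy+\lim_{R\to\infty}\frac2\pi\int_{[0,R]^2\setminus[0,1]^2}G_i(x,y)\,\omega(y)\,dy\qquad(i=1,2),$$ so that the velocity field $u=\nabla^\perp(-\Delta)^{-1}\omega$ is $u_1=-x_1Q_1$, $u_2=x_2Q_2$.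 The off-diagonal coefficients of the system $\frac{d}{dt}\nabla\omega=\begin{pmatrix}a&c\\ b&-a\end{pmatrix}\nabla\omega$ for the vorticity gradient along particle trajectories are $$b(x)=x_1\,\partial_{x_2}Q_1(x),\qquad c(x)=-x_2\,\partial_{x_1}Q_2(x).$$ Let $D=(0,\delta_1)\times(0,\delta_2)$ and $\widehat D=(0,\delta_1+\delta_3)\times(0,\delta_2)$, where $0<\delta_1<\delta_2<\delta_1+\delta_3$, $\delta_2\le\delta_3$ and $\widehat D\subset[0,1]^2$. For $x\in D$ let $d(x)=\delta_2-x_2$ be the distance to the top of the box, and let $$M_{\widehat D}=\sup_{y\in\widehat D}\max\left\{|y_1^\alpha\,\partial_{x_1}\omega(y)|,\ |y_2^\alpha\,\partial_{x_2}\omega(y)|\right\}.$$ Then, for every $x\in D$, the integrals and limits that define $Q_1(x),Q_2(x)$ converge, $Q_1,Q_2$ are differentiable at $x$, and, for all $\gamma,\gamma_1,\gamma_2\in(0,1)$ with $\gamma_1+\gamma_2\le1$ and $i=1,2$, $$|c(x)|\le C(\alpha)\,M_{\widehat D}\,x_2^{1-\alpha}+C(\alpha,\gamma_1,\gamma_2)\,\|\omega\|_\infty\,x_2^{1-\gamma_1-\gamma_2}\,x_1^{\gamma_2}\,d(x)^{-1+\gamma_1},$$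 $$|b(x)|\le C(\alpha)\,M_{\widehat D}\,x_1^{1-\alpha}(1+|\log d(x)|)+C(\alpha,\gamma)\,\|\omega\|_\infty\,x_1^{1-\gamma}\,d(x)^{-1+\gamma},$$ $$\left|x_i\,\partial_{x_i}Q_i(x)\right|\le C(\alpha)\,M_{\widehat D}\,x_i^{1-\alpha}(1+|\log d(x)|)+C(\alpha,\gamma)\,\|\omega\|_\infty\,x_i^{1-\gamma}\,d(x)^{-1+\gamma}.$$ The constants depend only on the parameters indicated; in particular they do not depend on $\omega$, $x$, $\delta_1,\delta_2,\delta_3$. -/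

import Mathlib

open Set Filter Topology MeasureTheory

namespace EulerBox

noncomputable section

/-- Partial derivative in the first variable. -/
def partial₁ (f : ℝ × ℝ → ℝ) (x : ℝ × ℝ) : ℝ := deriv (fun s => f (s, x.2)) x.1

/-- Partial derivative in the second variable. -/
def partial₂ (f : ℝ × ℝ → ℝ) (x : ℝ × ℝ) : ℝ := deriv (fun s => f (x.1, s)) x.2

/-- The vorticity is `C²` on the torus `[-1,1)²` (that is, `2`-periodic in each variable on the
plane) and double-odd. -/
structure IsVorticity (ω : ℝ × ℝ → ℝ) : Prop where
  contDiff : ContDiff ℝ 2 ω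
  periodic₁ : ∀ a b : ℝ, ω (a + 2, b) = ω (a, b)
  periodic₂ : ∀ a b : ℝ, ω (a, b + 2) = ω (a, b)
  odd₁ : ∀ a b : ℝ, ω (-a, b) = -ω (a, b)
  odd₂ : ∀ a b : ℝ, ω (a, -b) = -ω (a, b)

/-- `‖ω‖_∞`. -/
def supNorm (ω : ℝ × ℝ → ℝ) : ℝ := ⨆ y : ℝ × ℝ, |ω y|

/-- Square of the Euclidean norm of the plane. -/
def sqNorm (z : ℝ × ℝ) : ℝ := z.1 ^ 2 + z.2 ^ 2

/-- `x̃ = (-x₁, x₂)`. -/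
def tilde (x : ℝ × ℝ) : ℝ × ℝ := (-x.1, x.2)

/-- `x̄ = (x₁, -x₂)`. -/
def bar (x : ℝ × ℝ) : ℝ × ℝ := (x.1, -x.2)

def G₁₁ (x y : ℝ × ℝ) : ℝ :=
  y.1 * (y.2 - x.2) / (sqNorm (y - x) * sqNorm (y - tilde x))

def G₁₂ (x y : ℝ × ℝ) : ℝ :=
  y.1 * (y.2 + x.2) / (sqNorm (y + x) * sqNorm (y - bar x))

def G₂₁ (x y : ℝ × ℝ) : ℝ :=
  y.2 * (y.1 + x.1) / (sqNorm (y + x) * sqNorm (y - tilde x))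

def G₂₂ (x y : ℝ × ℝ) : ℝ :=
  y.2 * (y.1 - x.1) / (sqNorm (y - x) * sqNorm (y - bar x))

/-- The kernel of `Q₁`. -/
def G₁ (x y : ℝ × ℝ) : ℝ := G₁₁ x y + G₁₂ x y

/-- The kernel of `Q₂`. -/
def G₂ (x y : ℝ × ℝ) : ℝ := G₂₁ x y + G₂₂ x y

/-- The constant for which `u₁ = -x₁ Q₁` and `u₂ = x₂ Q₂`, where `u` is the velocity
`(1/2π) ∫ (y-x)^⊥ / |y-x|² ω(y) dy`: folding the four quadrants onto the first one produces a
factor `4`. -/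
def c₀ : ℝ := 2 / Real.pi

/-- The square `[0, R]²`. -/
def square (R : ℝ) : Set (ℝ × ℝ) := Icc 0 R ×ˢ Icc 0 R

/-- The integral over the part of `[0, R]²` outside `[0, 1]²`. -/
def outer (K : ℝ × ℝ → ℝ × ℝ → ℝ) (ω : ℝ × ℝ → ℝ) (x : ℝ × ℝ) (R : ℝ) : ℝ :=
  c₀ * ∫ y in square R \ square 1, K x y * ω y

/-- `c₀ ∫_{[0,1]²} K(x,y) ω(y) dy` plus the remainder, the integral over the rest of the first
quadrant, taken as the limit over growing squares. -/
def potential (K : ℝ × ℝ → ℝ × ℝ → ℝ) (ω : ℝ × ℝ → ℝ) (x : ℝ × ℝ) : ℝ :=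
  c₀ * (∫ y in square 1, K x y * ω y) + limUnder atTop (outer K ω x)

/-- All integrals in the definition of `potential K ω x` converge, and so does the limit. -/
def PotentialExists (K : ℝ × ℝ → ℝ × ℝ → ℝ) (ω : ℝ × ℝ → ℝ) (x : ℝ × ℝ) : Prop :=
  (∀ R : ℝ, IntegrableOn (fun y => K x y * ω y) (square R)) ∧
    ∃ l : ℝ, Tendsto (outer K ω x) atTop (𝓝 l)

def Q₁ (ω : ℝ × ℝ → ℝ) : ℝ × ℝ → ℝ := potential G₁ ω

def Q₂ (ω : ℝ × ℝ → ℝ) : ℝ × ℝ → ℝ := potential G₂ ω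

/-- The lower left entry `b = x₁ ∂_{x₂} Q₁` of the matrix of the gradient system. -/
def coeffB (ω : ℝ × ℝ → ℝ) (x : ℝ × ℝ) : ℝ := x.1 * partial₂ (Q₁ ω) x

/-- The upper right entry `c = -x₂ ∂_{x₁} Q₂` of the matrix of the gradient system. -/
def coeffC (ω : ℝ × ℝ → ℝ) (x : ℝ × ℝ) : ℝ := -x.2 * partial₁ (Q₂ ω) x

/-- The box `D = (0, δ₁) × (0, δ₂)`. -/
def boxD (δ₁ δ₂ : ℝ) : Set (ℝ × ℝ) := Ioo 0 δ₁ ×ˢ Ioo 0 δ₂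

/-- The box `D̂ = (0, δ₁ + δ₃) × (0, δ₂)`. -/
def boxDhat (δ₁ δ₂ δ₃ : ℝ) : Set (ℝ × ℝ) := Ioo 0 (δ₁ + δ₃) ×ˢ Ioo 0 δ₂

/-- Admissible box sizes. -/
structure AdmissibleBox (δ₁ δ₂ δ₃ : ℝ) : Prop where
  pos : 0 < δ₁
  lt : δ₁ < δ₂
  lt_add : δ₂ < δ₁ + δ₃
  le : δ₂ ≤ δ₃
  subset : boxDhat δ₁ δ₂ δ₃ ⊆ Icc 0 1 ×ˢ Icc 0 1

/-- The weighted supremum of the gradient of `ω` over the set `S`. -/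
def weightedGrad (α : ℝ) (ω : ℝ × ℝ → ℝ) (S : Set (ℝ × ℝ)) : ℝ :=
  sSup ((fun y : ℝ × ℝ => max |y.1 ^ α * partial₁ ω y| |y.2 ^ α * partial₂ ω y|) '' S)

end

end EulerBox

namespace EulerBox

noncomputable section

/-! Write r = ‖y - x‖ in the sup norm. The reflection of x in the axis y₁ = 0 is at distance at
least max(r, x₁) from y, so the x-gradient of G₁ is O(1 / (r² max(r, x₁))). Hence x₁∇G₁ has the
critical, non-integrable size r⁻² for r < x₁, and decays like x₁ r⁻³ beyond.

The critical singularity is removed by subtracting from ω the multiple ω(x) of a smooth bump centred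
at x, of radius min(x₁, x₂)/2. What remains (`reduced`) vanishes at x, and its singular integral may
be differentiated under the integral sign (`SingularKernel.hasFDerivAt_integral`). The potential of
the bump is a sum of four Biot–Savart fields divided by 4x₁; by scaling, x₁ times its gradient is
bounded by an absolute constant (`exists_cutoffAt_bound`).

The weighted gradient bound makes ω Hölder continuous in D̂ with exponent p = 1 - α and constant H.
As ω vanishes on the axes, |ω(x)| ≤ H min(x₁, x₂)^p too, so the reduced density is at most 5H r^p
for r < d(x), a region that lies in D̂. There the integrand is at most a multiple of H r^(p-2) for r
< x₁ and of H x₁ r^(p-3) for r ≥ x₁, and both integrate to a multiple of H x₁^p. No logarithm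
arises: the factor 1 + |log d(x)| of the theorem is a weakening.

For r ≥ d(x) only ‖ω‖_∞ is available. One interpolates x₁/max(r, x₁) ≤ (x₁/r)^a and, for ∂_{x₂}G₁,
the additional gain min(1, x₂/r) ≤ (x₂/r)^b that comes from the cancellation between x and its
reflection in y₂ = 0. Integration gives ‖ω‖_∞ x₁^a x₂^b d^(-a-b) (`abs_setIntegral_le`), and the γ's
of the theorem are choices of a and b.

The limit that defines Q₁ exists because G₁(x, ·) differs at infinity by O(r⁻³) from an explicit
smooth kernel, which is integrated by parts in y₂; the primitive of ω is bounded since ω has mean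
zero over each period. Exchanging the coordinates turns Q₂ into Q₁. -/

/-! ### Powers of the sup norm integrated over balls and their complements. -/

lemma finrank_plane : Module.finrank ℝ (ℝ × ℝ) = 2 := by simp

lemma volume_real_unit_ball : (volume : Measure (ℝ × ℝ)).real (Metric.ball 0 1) = 4 := by
  have : Metric.ball (0 : ℝ × ℝ) 1 = Metric.ball (0 : ℝ) 1 ×ˢ Metric.ball (0 : ℝ) 1 := by
    rw [ball_prod_same]; rfl
  rw [this, Measure.volume_eq_prod, measureReal_prod_prod]
  simp [Measure.real, Real.volume_ball]
  norm_num

/-- Integration in polar coordinates for the sup norm of the plane. -/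
lemma integral_radial (f : ℝ → ℝ) :
    ∫ z : ℝ × ℝ, f ‖z‖ = 8 * ∫ r in Ioi (0 : ℝ), r * f r := by
  rw [integral_fun_norm_addHaar volume f, volume_real_unit_ball, finrank_plane]
  simp only [nsmul_eq_mul, smul_eq_mul]
  norm_num
  rw [← mul_assoc]; norm_num

lemma integrable_radial {f : ℝ → ℝ} (h : IntegrableOn (fun r => r * f r) (Ioi 0)) :
    Integrable (fun z : ℝ × ℝ => f ‖z‖) := by
  rw [integrable_fun_norm_addHaar volume, finrank_plane]
  simpa using h

lemma rpow_near_aux {p R : ℝ} :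
    (fun r : ℝ => r * (Iio R).indicator (fun r => r ^ p) r)
      =ᵐ[volume.restrict (Ioi 0)] (Iio R).indicator (fun r => r ^ (p + 1)) := by
  filter_upwards [self_mem_ae_restrict measurableSet_Ioi] with r hr
  by_cases h : r ∈ Iio R
  · simp only [indicator_of_mem h]
    rw [Real.rpow_add_one (ne_of_gt hr)]; ring
  · simp [indicator_of_notMem h]

lemma rpow_far_aux {p R : ℝ} :
    (fun r : ℝ => r * (Ici R).indicator (fun r => r ^ p) r)
      =ᵐ[volume.restrict (Ioi 0)] (Ici R).indicator (fun r => r ^ (p + 1)) := by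
  filter_upwards [self_mem_ae_restrict measurableSet_Ioi] with r hr
  by_cases h : r ∈ Ici R
  · simp only [indicator_of_mem h]
    rw [Real.rpow_add_one (ne_of_gt hr)]; ring
  · simp [indicator_of_notMem h]

lemma ball_indicator (p R : ℝ) (x : ℝ × ℝ) :
    (Metric.ball x R).indicator (fun y => ‖y - x‖ ^ p) =
      fun y => (fun z : ℝ × ℝ => (Iio R).indicator (fun r => r ^ p) ‖z‖) (y - x) := by
  ext y
  simp [indicator, dist_eq_norm]

lemma compl_ball_indicator (p R : ℝ) (x : ℝ × ℝ) :
    (Metric.ball x R)ᶜ.indicator (fun y => ‖y - x‖ ^ p) =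
      fun y => (fun z : ℝ × ℝ => (Ici R).indicator (fun r => r ^ p) ‖z‖) (y - x) := by
  ext y
  simp [indicator, dist_eq_norm]

lemma integrableOn_rpow_ball {p R : ℝ} (hp : -2 < p) (hR : 0 < R) (x : ℝ × ℝ) :
    IntegrableOn (fun y => ‖y - x‖ ^ p) (Metric.ball x R) := by
  rw [← integrable_indicator_iff measurableSet_ball, ball_indicator]
  refine Integrable.comp_sub_right (μ := volume) (integrable_radial ?_) x
  rw [IntegrableOn, integrable_congr rpow_near_aux, integrable_indicator_iff measurableSet_Iio,
    IntegrableOn, Measure.restrict_restrict measurableSet_Iio, inter_comm, Ioi_inter_Iio,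
    ← IntegrableOn, intervalIntegral.integrableOn_Ioo_rpow_iff hR]
  linarith

lemma integral_rpow_ball {p R : ℝ} (hp : -2 < p) (hR : 0 < R) (x : ℝ × ℝ) :
    ∫ y in Metric.ball x R, ‖y - x‖ ^ p = 8 * (R ^ (p + 2) / (p + 2)) := by
  rw [← integral_indicator measurableSet_ball, ball_indicator,
    integral_sub_right_eq_self
      (fun z : ℝ × ℝ => (Iio R).indicator (fun r => r ^ p) ‖z‖) x, integral_radial,
    integral_congr_ae rpow_near_aux, integral_indicator measurableSet_Iio,
    Measure.restrict_restrict measurableSet_Iio, inter_comm, Ioi_inter_Iio,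
    ← integral_Ioc_eq_integral_Ioo, ← intervalIntegral.integral_of_le hR.le,
    integral_rpow (Or.inl (by linarith)), Real.zero_rpow (by linarith)]
  ring_nf

lemma integrableOn_rpow_compl_ball {p R : ℝ} (hp : p < -2) (hR : 0 < R) (x : ℝ × ℝ) :
    IntegrableOn (fun y => ‖y - x‖ ^ p) (Metric.ball x R)ᶜ := by
  rw [← integrable_indicator_iff measurableSet_ball.compl, compl_ball_indicator]
  refine Integrable.comp_sub_right (μ := volume) (integrable_radial ?_) x
  rw [IntegrableOn, integrable_congr rpow_far_aux, integrable_indicator_iff measurableSet_Ici,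
    IntegrableOn, Measure.restrict_restrict measurableSet_Ici,
    inter_eq_left.2 (Ici_subset_Ioi.2 hR), ← IntegrableOn,
    integrableOn_Ici_iff_integrableOn_Ioi]
  exact integrableOn_Ioi_rpow_of_lt (by linarith) hR

lemma integral_rpow_compl_ball {p R : ℝ} (hp : p < -2) (hR : 0 < R) (x : ℝ × ℝ) :
    ∫ y in (Metric.ball x R)ᶜ, ‖y - x‖ ^ p = 8 * (R ^ (p + 2) / (-p - 2)) := by
  rw [← integral_indicator measurableSet_ball.compl, compl_ball_indicator,
    integral_sub_right_eq_self
      (fun z : ℝ × ℝ => (Ici R).indicator (fun r => r ^ p) ‖z‖) x, integral_radial,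
    integral_congr_ae rpow_far_aux, integral_indicator measurableSet_Ici,
    Measure.restrict_restrict measurableSet_Ici,
    inter_eq_left.2 (Ici_subset_Ioi.2 hR), integral_Ici_eq_integral_Ioi,
    integral_Ioi_rpow_of_lt (by linarith) hR]
  have h1 : p + 1 + 1 = p + 2 := by ring
  have h2 : -p - 2 = -(p + 2) := by ring
  rw [h1, h2, div_neg, neg_div]

/-! ### The kernel `G₁` and its derivatives. -/

/-- The kernel `G₁₁` as a function of `s = x₁`, `t = y₁`, `b = y₂ - x₂`. -/
def blk (s t b : ℝ) : ℝ := t * b / (((t - s) ^ 2 + b ^ 2) * ((t + s) ^ 2 + b ^ 2))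

/-- The derivative of `blk` in `s`. -/
def blkS (s t b : ℝ) : ℝ :=
  4 * s * t * b * ((t - s) * (t + s) - b ^ 2) /
    (((t - s) ^ 2 + b ^ 2) * ((t + s) ^ 2 + b ^ 2)) ^ 2

/-- The derivative of `blk` in `b`. -/
def blkB (s t b : ℝ) : ℝ :=
  t * (((t - s) ^ 2 + b ^ 2) * ((t + s) ^ 2 + b ^ 2) -
      2 * b ^ 2 * (((t - s) ^ 2 + b ^ 2) + ((t + s) ^ 2 + b ^ 2))) /
    (((t - s) ^ 2 + b ^ 2) * ((t + s) ^ 2 + b ^ 2)) ^ 2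

lemma G₁_eq_blk (x y : ℝ × ℝ) :
    G₁ x y = blk x.1 y.1 (y.2 - x.2) + blk x.1 y.1 (y.2 + x.2) := by
  simp only [G₁, G₁₁, G₁₂, blk, sqNorm, tilde, bar, Prod.fst_sub, Prod.snd_sub, Prod.fst_add,
    Prod.snd_add, sub_neg_eq_add]
  ring

/-- The partial derivative of `G₁` in `x₁`. -/
def g₁ (x y : ℝ × ℝ) : ℝ := blkS x.1 y.1 (y.2 - x.2) + blkS x.1 y.1 (y.2 + x.2)

/-- The partial derivative of `G₁` in `x₂`. -/
def g₂ (x y : ℝ × ℝ) : ℝ := -blkB x.1 y.1 (y.2 - x.2) + blkB x.1 y.1 (y.2 + x.2)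

/-- The total derivative of `G₁` in `x`. -/
def DG₁ (x y : ℝ × ℝ) : ℝ × ℝ →L[ℝ] ℝ :=
  g₁ x y • ContinuousLinearMap.fst ℝ ℝ ℝ + g₂ x y • ContinuousLinearMap.snd ℝ ℝ ℝ

lemma hasFDerivAt_blk (t : ℝ) (q : ℝ × ℝ) (hp : (t - q.1) ^ 2 + q.2 ^ 2 ≠ 0)
    (hP : (t + q.1) ^ 2 + q.2 ^ 2 ≠ 0) :
    HasFDerivAt (fun q : ℝ × ℝ => blk q.1 t q.2)
      (blkS q.1 t q.2 • ContinuousLinearMap.fst ℝ ℝ ℝ +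
        blkB q.1 t q.2 • ContinuousLinearMap.snd ℝ ℝ ℝ) q := by
  have h1 : HasFDerivAt (fun q : ℝ × ℝ => q.1) (ContinuousLinearMap.fst ℝ ℝ ℝ) q := hasFDerivAt_fst
  have h2 : HasFDerivAt (fun q : ℝ × ℝ => q.2) (ContinuousLinearMap.snd ℝ ℝ ℝ) q := hasFDerivAt_snd
  have hD := (((h1.const_sub t).pow 2).add (h2.pow 2)).mul (((h1.const_add t).pow 2).add (h2.pow 2))
  have hI := (hasDerivAt_inv (mul_ne_zero hp hP)).comp_hasFDerivAt q hD
  have := (h2.const_mul t).mul hI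
  refine HasFDerivAt.congr_fderiv (HasFDerivAt.congr_of_eventuallyEq this ?_) ?_
  · exact Eventually.of_forall fun z => by simp [blk, div_eq_mul_inv]
  · ext
    · simp [blkS]
      field_simp
      ring
    · simp [blkB]
      field_simp
      ring

lemma hasFDerivAt_G₁ (x y : ℝ × ℝ) (h1 : (y.1 - x.1) ^ 2 + (y.2 - x.2) ^ 2 ≠ 0)
    (h2 : (y.1 + x.1) ^ 2 + (y.2 - x.2) ^ 2 ≠ 0) (h3 : (y.1 - x.1) ^ 2 + (y.2 + x.2) ^ 2 ≠ 0)
    (h4 : (y.1 + x.1) ^ 2 + (y.2 + x.2) ^ 2 ≠ 0) :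
    HasFDerivAt (fun x => G₁ x y) (DG₁ x y) x := by
  have hf : HasFDerivAt (fun q : ℝ × ℝ => q.1) (ContinuousLinearMap.fst ℝ ℝ ℝ) x := hasFDerivAt_fst
  have hs : HasFDerivAt (fun q : ℝ × ℝ => q.2) (ContinuousLinearMap.snd ℝ ℝ ℝ) x := hasFDerivAt_snd
  have ha := (hasFDerivAt_blk y.1 (x.1, y.2 - x.2) h1 h2).comp x (hf.prodMk (hs.const_sub y.2))
  have hb := (hasFDerivAt_blk y.1 (x.1, y.2 + x.2) h3 h4).comp x (hf.prodMk (hs.const_add y.2))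
  refine HasFDerivAt.congr_fderiv (HasFDerivAt.congr_of_eventuallyEq (ha.add hb) ?_) ?_
  · exact Eventually.of_forall fun z => by simp [G₁_eq_blk]
  · ext <;> simp [DG₁, g₁, g₂]

/-! ### Pointwise bounds for the half kernels. -/

section bounds

variable {s t b e f : ℝ}

/-- Here e and f stand for the Euclidean distances of y to the pole and to its reflection in the
axis y₁ = 0. Each factor of the numerator is paid for by one distance: |b| ≤ e and t ≤ f. -/
lemma abs_blk_le (hs : 0 ≤ s) (ht : 0 ≤ t) (he : 0 < e) (hf : 0 < f)
    (h1 : (t - s) ^ 2 + b ^ 2 = e ^ 2) (h2 : (t + s) ^ 2 + b ^ 2 = f ^ 2) :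
    |blk s t b| ≤ 1 / (e * f) := by
  have hb : |b| ≤ e := abs_le_of_sq_le_sq (by nlinarith [sq_nonneg (t - s)]) he.le
  have hA : t ≤ f := by
    have : t + s ≤ f := abs_le_of_sq_le_sq' (by nlinarith [sq_nonneg b]) hf.le |>.2
    linarith
  rw [blk, h1, h2, abs_div, abs_mul, abs_of_nonneg ht, abs_of_pos (by positivity : 0 < e ^ 2 * f ^ 2),
    div_le_div_iff₀ (by positivity) (by positivity)]
  have : t * |b| ≤ f * e := mul_le_mul hA hb (abs_nonneg _) hf.le
  nlinarith [mul_le_mul_of_nonneg_right this (by positivity : 0 ≤ e * f)]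

/-- With w = t + ib one has ef = |w² - s²|, and the last factor of the numerator is the real part of
w² - s²; the square of its imaginary part is the 4b²t² that is dropped. So that factor and tb are
each at most ef. -/
lemma abs_blkS_le (hs : 0 ≤ s) (ht : 0 ≤ t) (he : 0 < e) (hf : 0 < f)
    (h1 : (t - s) ^ 2 + b ^ 2 = e ^ 2) (h2 : (t + s) ^ 2 + b ^ 2 = f ^ 2) :
    |blkS s t b| ≤ 4 * s / (e ^ 2 * f ^ 2) := by
  have hb : |b| ≤ e := abs_le_of_sq_le_sq (by nlinarith [sq_nonneg (t - s)]) he.le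
  have hA : t ≤ f := by
    have : t + s ≤ f := abs_le_of_sq_le_sq' (by nlinarith [sq_nonneg b]) hf.le |>.2
    linarith
  have hc : |(t - s) * (t + s) - b ^ 2| ≤ e * f := by
    refine abs_le_of_sq_le_sq ?_ (by positivity)
    have : (e * f) ^ 2 = ((t - s) ^ 2 + b ^ 2) * ((t + s) ^ 2 + b ^ 2) := by rw [h1, h2]; ring
    rw [this]
    nlinarith [sq_nonneg (b * t)]
  rw [blkS, h1, h2, abs_div, abs_of_pos (by positivity : 0 < (e ^ 2 * f ^ 2) ^ 2),
    div_le_div_iff₀ (by positivity) (by positivity)]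
  have hn : |4 * s * t * b * ((t - s) * (t + s) - b ^ 2)| ≤ 4 * s * (f * e) * (e * f) := by
    rw [abs_mul, show 4 * s * t * b = 4 * s * (t * b) by ring, abs_mul (4 * s),
      abs_of_nonneg (by positivity : 0 ≤ 4 * s), abs_mul t, abs_of_nonneg ht]
    gcongr
  calc _ ≤ 4 * s * (f * e) * (e * f) * (e ^ 2 * f ^ 2) := by gcongr
    _ = _ := by ring

lemma abs_blkB_le (ht : 0 ≤ t) (he : 0 < e) (hf : 0 < f)
    (h1 : (t - s) ^ 2 + b ^ 2 = e ^ 2) (h2 : (t + s) ^ 2 + b ^ 2 = f ^ 2) :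
    |blkB s t b| ≤ 5 * t / (e ^ 2 * f ^ 2) := by
  have hb : b ^ 2 ≤ e ^ 2 := by nlinarith [sq_nonneg (t - s)]
  have hb' : b ^ 2 ≤ f ^ 2 := by nlinarith [sq_nonneg (t + s)]
  rw [blkB, h1, h2, abs_div, abs_of_pos (by positivity : 0 < (e ^ 2 * f ^ 2) ^ 2),
    div_le_div_iff₀ (by positivity) (by positivity)]
  have hn : |t * (e ^ 2 * f ^ 2 - 2 * b ^ 2 * (e ^ 2 + f ^ 2))| ≤ t * (5 * (e ^ 2 * f ^ 2)) := by
    rw [abs_mul, abs_of_nonneg ht]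
    gcongr
    have h3 := mul_le_mul_of_nonneg_right hb (sq_nonneg f)
    have h4 := mul_le_mul_of_nonneg_right hb' (sq_nonneg e)
    have h5 : 0 ≤ b ^ 2 * e ^ 2 := by positivity
    have h6 : 0 ≤ b ^ 2 * f ^ 2 := by positivity
    rw [abs_le]; constructor <;> nlinarith
  calc _ ≤ t * (5 * (e ^ 2 * f ^ 2)) * (e ^ 2 * f ^ 2) := by gcongr
    _ = _ := by ring

/-- Eliminating b² leaves b only inside 1/e² and 1/f², both of which decrease when b = w - z is
replaced by w + z. The comparison of the two values of b rests on this form. -/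
lemma blkB_eq (he : 0 < e) (hf : 0 < f)
    (h1 : (t - s) ^ 2 + b ^ 2 = e ^ 2) (h2 : (t + s) ^ 2 + b ^ 2 = f ^ 2) :
    blkB s t b = t * (1 / e ^ 2 * (1 / f ^ 2) *
      (-3 + 2 * (t - s) ^ 2 * (1 / e ^ 2) + 2 * (t + s) ^ 2 * (1 / f ^ 2))) := by
  rw [blkB, h1, h2]
  have h3 : (t - s) ^ 2 = e ^ 2 - b ^ 2 := by linarith
  have h4 : (t + s) ^ 2 = f ^ 2 - b ^ 2 := by linarith
  rw [h3, h4]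
  field_simp
  ring

/-- Since e'² - e² = 4zw and w ≤ e', reflecting the pole changes 1/e² by a relative amount O(z/r)
only. -/
lemma inv_sq_sub_le {c e e' r z w : ℝ} (hz : 0 ≤ z) (hw : 0 ≤ w) (hr : 0 < r) (hre : r ≤ e)
    (h : c ^ 2 + (w - z) ^ 2 = e ^ 2) (h' : c ^ 2 + (w + z) ^ 2 = e' ^ 2) (he' : e ≤ e') :
    0 ≤ 1 / e ^ 2 - 1 / e' ^ 2 ∧ 1 / e ^ 2 - 1 / e' ^ 2 ≤ 4 * z / r * (1 / e ^ 2) := by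
  have he : 0 < e := hr.trans_le hre
  have he0 : 0 < e' := he.trans_le he'
  have hwe : w ≤ e' := by
    have : w + z ≤ e' := abs_le_of_sq_le_sq' (by nlinarith [sq_nonneg c]) he0.le |>.2
    linarith
  have h3 : 1 / e ^ 2 - 1 / e' ^ 2 = 4 * z * w / (e ^ 2 * e' ^ 2) := by
    have : 4 * z * w = e' ^ 2 - e ^ 2 := by linarith
    rw [this]; field_simp
  rw [h3]
  refine ⟨by positivity, ?_⟩
  rw [show 4 * z / r * (1 / e ^ 2) = 4 * z / (r * e ^ 2) by field_simp,
    div_le_div_iff₀ (by positivity) (by positivity)]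
  have : w * r ≤ e' * e' := mul_le_mul hwe (hre.trans he') hr.le he0.le
  nlinarith [mul_le_mul_of_nonneg_left this (by positivity : 0 ≤ 4 * z * e ^ 2)]

lemma abs_blkB_sub_le {e' f' r z w : ℝ} (ht : 0 ≤ t) (hz : 0 ≤ z) (hw : 0 ≤ w)
    (hr : 0 < r) (hre : r ≤ e) (hrf : r ≤ f) (he' : e ≤ e') (hf' : f ≤ f')
    (h1 : (t - s) ^ 2 + (w - z) ^ 2 = e ^ 2) (h2 : (t + s) ^ 2 + (w - z) ^ 2 = f ^ 2)
    (h3 : (t - s) ^ 2 + (w + z) ^ 2 = e' ^ 2) (h4 : (t + s) ^ 2 + (w + z) ^ 2 = f' ^ 2) :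
    |blkB s t (w - z) - blkB s t (w + z)| ≤ 40 * t * (z / r) / (e ^ 2 * f ^ 2) := by
  have he : 0 < e := hr.trans_le hre
  have hf : 0 < f := hr.trans_le hrf
  have he0 : 0 < e' := he.trans_le he'
  have hf0 : 0 < f' := hf.trans_le hf'
  rw [blkB_eq he hf h1 h2, blkB_eq he0 hf0 h3 h4]
  obtain ⟨hu0, hu⟩ := inv_sq_sub_le hz hw hr hre h1 h3 he'
  obtain ⟨hv0, hv⟩ := inv_sq_sub_le hz hw hr hrf h2 h4 hf'
  have hau : (t - s) ^ 2 * (1 / e ^ 2) ≤ 1 := by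
    rw [mul_one_div, div_le_one (by positivity)]; nlinarith [sq_nonneg (w - z)]
  have hav : (t + s) ^ 2 * (1 / f ^ 2) ≤ 1 := by
    rw [mul_one_div, div_le_one (by positivity)]; nlinarith [sq_nonneg (w - z)]
  have hup : 0 < 1 / e ^ 2 := by positivity
  have hvp : 0 < 1 / f ^ 2 := by positivity
  have hup' : 0 < 1 / e' ^ 2 := by positivity
  have hvp' : 0 < 1 / f' ^ 2 := by positivity
  have hgoal : 40 * t * (z / r) / (e ^ 2 * f ^ 2) = t * (40 * (z / r) * (1 / e ^ 2 * (1 / f ^ 2))) := by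
    field_simp
  rw [hgoal]
  rw [show 4 * z / r = 4 * (z / r) by ring] at hu hv
  have hk : 0 ≤ z / r := by positivity
  generalize z / r = k at *
  generalize 1 / e ^ 2 = u at *
  generalize 1 / f ^ 2 = v at *
  generalize 1 / e' ^ 2 = u' at *
  generalize 1 / f' ^ 2 = v' at *
  have ha0 := sq_nonneg (t - s)
  have hA0 := sq_nonneg (t + s)
  generalize (t - s) ^ 2 = a at *
  generalize (t + s) ^ 2 = A at *
  rw [← mul_sub, abs_mul, abs_of_nonneg ht]
  gcongr
  -- Discrete product rule. The bracket lies in [-3, 1] because au and Av are at most 1, so the two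
  -- terms contribute 8·3 and 2·(4 + 4), which add up to 40.
  have hid : u * v * (-3 + 2 * a * u + 2 * A * v) - u' * v' * (-3 + 2 * a * u' + 2 * A * v') =
      (u * v - u' * v') * (-3 + 2 * (a * u) + 2 * (A * v)) +
        u' * v' * (2 * (a * (u - u') + A * (v - v'))) := by ring
  rw [hid]
  have hd0 : 0 ≤ u * v - u' * v' := by nlinarith
  have hd : u * v - u' * v' ≤ 8 * k * (u * v) := by nlinarith
  have hau0 : 0 ≤ a * u := by positivity
  have hav0 : 0 ≤ A * v := by positivity
  have e1 : |(u * v - u' * v') * (-3 + 2 * (a * u) + 2 * (A * v))| ≤ 8 * k * (u * v) * 3 := by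
    rw [abs_mul, abs_of_nonneg hd0]
    gcongr
    rw [abs_le]; constructor <;> linarith
  have h5 : a * (u - u') ≤ 4 * k := by nlinarith
  have h6 : A * (v - v') ≤ 4 * k := by nlinarith
  have h5' : 0 ≤ a * (u - u') := by positivity
  have h6' : 0 ≤ A * (v - v') := by positivity
  have e2 : |u' * v' * (2 * (a * (u - u') + A * (v - v')))| ≤ (u * v) * (2 * (4 * k + 4 * k)) := by
    rw [abs_of_nonneg (by positivity)]
    gcongr <;> linarith
  calc _ ≤ _ := abs_add_le _ _
    _ ≤ 8 * k * (u * v) * 3 + (u * v) * (2 * (4 * k + 4 * k)) := add_le_add e1 e2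
    _ = _ := by ring

end bounds

/-! ### Bounds for `G₁` and its gradient in terms of the sup norm distance. -/

/-- The closed first quadrant. -/
def IsQuad (x : ℝ × ℝ) : Prop := 0 ≤ x.1 ∧ 0 ≤ x.2

/-- The distances of `y` to `x` and to its mirror images, and their order. -/
lemma exists_dist {x y : ℝ × ℝ} (hx : IsQuad x) (hy : IsQuad y) (hxy : y ≠ x) :
    ∃ e f e' f' : ℝ, 0 < ‖y - x‖ ∧ ‖y - x‖ ≤ e ∧ max ‖y - x‖ x.1 ≤ f ∧ e ≤ e' ∧ f ≤ f' ∧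
      y.1 ≤ f ∧ x.1 ≤ f ∧
      (y.1 - x.1) ^ 2 + (y.2 - x.2) ^ 2 = e ^ 2 ∧ (y.1 + x.1) ^ 2 + (y.2 - x.2) ^ 2 = f ^ 2 ∧
      (y.1 - x.1) ^ 2 + (y.2 + x.2) ^ 2 = e' ^ 2 ∧ (y.1 + x.1) ^ 2 + (y.2 + x.2) ^ 2 = f' ^ 2 := by
  obtain ⟨hx1, hx2⟩ := hx
  obtain ⟨hy1, hy2⟩ := hy
  have hr : 0 < ‖y - x‖ := norm_pos_iff.2 (sub_ne_zero.2 hxy)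
  have hre : ‖y - x‖ ≤ √((y.1 - x.1) ^ 2 + (y.2 - x.2) ^ 2) := by
    rw [Prod.norm_def, max_le_iff]
    constructor
    · exact Real.abs_le_sqrt (by simp; positivity)
    · exact Real.abs_le_sqrt (by simp; positivity)
  have hef : √((y.1 - x.1) ^ 2 + (y.2 - x.2) ^ 2) ≤ √((y.1 + x.1) ^ 2 + (y.2 - x.2) ^ 2) :=
    Real.sqrt_le_sqrt (by nlinarith [mul_nonneg hx1 hy1])
  have hA : y.1 + x.1 ≤ √((y.1 + x.1) ^ 2 + (y.2 - x.2) ^ 2) :=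
    Real.le_sqrt_of_sq_le (by nlinarith [sq_nonneg (y.2 - x.2)])
  refine ⟨_, _, √((y.1 - x.1) ^ 2 + (y.2 + x.2) ^ 2), √((y.1 + x.1) ^ 2 + (y.2 + x.2) ^ 2), hr, hre,
    max_le (hre.trans hef) (by linarith),
    Real.sqrt_le_sqrt ?_, Real.sqrt_le_sqrt ?_, by linarith, by linarith,
    (Real.sq_sqrt ?_).symm, (Real.sq_sqrt ?_).symm, (Real.sq_sqrt ?_).symm,
    (Real.sq_sqrt ?_).symm⟩
  · nlinarith [mul_nonneg hx2 hy2]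
  · nlinarith [mul_nonneg hx2 hy2]
  all_goals positivity

lemma hasFDerivAt_G₁_of_ne {x y : ℝ × ℝ} (hx : IsQuad x) (hy : IsQuad y) (hxy : y ≠ x) :
    HasFDerivAt (fun x => G₁ x y) (DG₁ x y) x := by
  obtain ⟨e, f, e', f', hr, hre, hrf, hee, hff, hy1, hx1, h1, h2, h3, h4⟩ := exists_dist hx hy hxy
  have he : 0 < e := hr.trans_le hre
  have hf : 0 < f := hr.trans_le ((le_max_left _ _).trans hrf)
  have he' : 0 < e' := he.trans_le hee
  have hf' : 0 < f' := hf.trans_le hff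
  apply hasFDerivAt_G₁
  · rw [h1]; positivity
  · rw [h2]; positivity
  · rw [h3]; positivity
  · rw [h4]; positivity

lemma abs_G₁_le {x y : ℝ × ℝ} (hx : IsQuad x) (hy : IsQuad y) (hxy : y ≠ x) :
    |G₁ x y| ≤ 2 / (‖y - x‖ * max ‖y - x‖ x.1) := by
  obtain ⟨e, f, e', f', hr, hre, hrf, hee, hff, hy1, hx1, h1, h2, h3, h4⟩ := exists_dist hx hy hxy
  have hm : 0 < max ‖y - x‖ x.1 := hr.trans_le (le_max_left _ _)
  generalize max ‖y - x‖ x.1 = m at *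
  generalize ‖y - x‖ = r at *
  have he : 0 < e := hr.trans_le hre
  have hf : 0 < f := hm.trans_le hrf
  have he' : 0 < e' := he.trans_le hee
  have hf' : 0 < f' := hf.trans_le hff
  rw [G₁_eq_blk]
  calc _ ≤ 1 / (e * f) + 1 / (e' * f') := (abs_add_le _ _).trans
        (add_le_add (abs_blk_le hx.1 hy.1 he hf h1 h2) (abs_blk_le hx.1 hy.1 he' hf' h3 h4))
    _ ≤ 1 / (r * m) + 1 / (r * m) := by
        gcongr
        · exact hre.trans hee
        · exact hrf.trans hff
    _ = _ := by ring

lemma abs_g₁_le {x y : ℝ × ℝ} (hx : IsQuad x) (hy : IsQuad y) (hxy : y ≠ x) :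
    |g₁ x y| ≤ 10 / (‖y - x‖ ^ 2 * max ‖y - x‖ x.1) := by
  obtain ⟨e, f, e', f', hr, hre, hrf, hee, hff, hy1, hx1, h1, h2, h3, h4⟩ := exists_dist hx hy hxy
  have hm : 0 < max ‖y - x‖ x.1 := hr.trans_le (le_max_left _ _)
  generalize max ‖y - x‖ x.1 = m at *
  generalize ‖y - x‖ = r at *
  have he : 0 < e := hr.trans_le hre
  have hf : 0 < f := hm.trans_le hrf
  have he' : 0 < e' := he.trans_le hee
  have hf' : 0 < f' := hf.trans_le hff
  -- The factor x₁ ≤ f cancels one power of the distance to the reflected pole; the other power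
  -- supplies the maximum of r and x₁.
  have key : ∀ {E F : ℝ}, e ≤ E → f ≤ F → 4 * x.1 / (E ^ 2 * F ^ 2) ≤ 5 / (r ^ 2 * m) := by
    intro E F hE hF
    have hE0 := he.trans_le hE
    have hF0 := hf.trans_le hF
    have hx0 := hx.1
    calc 4 * x.1 / (E ^ 2 * F ^ 2) ≤ 5 * F / (E ^ 2 * F ^ 2) := by gcongr <;> linarith
      _ = 5 / (E ^ 2 * F) := by field_simp
      _ ≤ 5 / (r ^ 2 * m) := by
        gcongr
        · exact hre.trans hE
        · exact hrf.trans hF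
  calc _ ≤ _ := (abs_add_le _ _).trans
        (add_le_add (abs_blkS_le hx.1 hy.1 he hf h1 h2) (abs_blkS_le hx.1 hy.1 he' hf' h3 h4))
    _ ≤ 5 / (r ^ 2 * m) + 5 / (r ^ 2 * m) := add_le_add (key le_rfl le_rfl) (key hee hff)
    _ = _ := by ring

lemma abs_g₂_le {x y : ℝ × ℝ} (hx : IsQuad x) (hy : IsQuad y) (hxy : y ≠ x) :
    |g₂ x y| ≤ 10 / (‖y - x‖ ^ 2 * max ‖y - x‖ x.1) := by
  obtain ⟨e, f, e', f', hr, hre, hrf, hee, hff, hy1, hx1, h1, h2, h3, h4⟩ := exists_dist hx hy hxy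
  have hm : 0 < max ‖y - x‖ x.1 := hr.trans_le (le_max_left _ _)
  generalize max ‖y - x‖ x.1 = m at *
  generalize ‖y - x‖ = r at *
  have he : 0 < e := hr.trans_le hre
  have hf : 0 < f := hm.trans_le hrf
  have he' : 0 < e' := he.trans_le hee
  have hf' : 0 < f' := hf.trans_le hff
  have key : ∀ {E F : ℝ}, e ≤ E → f ≤ F → 5 * y.1 / (E ^ 2 * F ^ 2) ≤ 5 / (r ^ 2 * m) := by
    intro E F hE hF
    have hE0 := he.trans_le hE
    have hF0 := hf.trans_le hF
    calc 5 * y.1 / (E ^ 2 * F ^ 2) ≤ 5 * F / (E ^ 2 * F ^ 2) := by gcongr; linarith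
      _ = 5 / (E ^ 2 * F) := by field_simp
      _ ≤ 5 / (r ^ 2 * m) := by
        gcongr
        · exact hre.trans hE
        · exact hrf.trans hF
  calc _ ≤ |blkB x.1 y.1 (y.2 - x.2)| + |blkB x.1 y.1 (y.2 + x.2)| := by
        rw [g₂, ← abs_neg (blkB x.1 y.1 (y.2 - x.2))]; exact abs_add_le _ _
    _ ≤ _ := (add_le_add (abs_blkB_le hy.1 he hf h1 h2) (abs_blkB_le hy.1 he' hf' h3 h4))
    _ ≤ 5 / (r ^ 2 * m) + 5 / (r ^ 2 * m) := add_le_add (key le_rfl le_rfl) (key hee hff)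
    _ = _ := by ring

/-- The improved decay of `g₂` that comes from the oddness in the second variable. -/
lemma abs_g₂_le' {x y : ℝ × ℝ} (hx : IsQuad x) (hy : IsQuad y) (hxy : y ≠ x) :
    |g₂ x y| ≤ 40 * x.2 / (‖y - x‖ ^ 3 * max ‖y - x‖ x.1) := by
  obtain ⟨e, f, e', f', hr, hre, hrf, hee, hff, hy1, hx1, h1, h2, h3, h4⟩ := exists_dist hx hy hxy
  have hm : 0 < max ‖y - x‖ x.1 := hr.trans_le (le_max_left _ _)
  have hrf' := (le_max_left _ _).trans hrf
  generalize max ‖y - x‖ x.1 = m at *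
  generalize ‖y - x‖ = r at *
  have he : 0 < e := hr.trans_le hre
  have hf : 0 < f := hm.trans_le hrf
  have hx2 := hx.2
  calc _ = |blkB x.1 y.1 (y.2 - x.2) - blkB x.1 y.1 (y.2 + x.2)| := by
        rw [g₂, abs_sub_comm]; ring_nf
    _ ≤ 40 * y.1 * (x.2 / r) / (e ^ 2 * f ^ 2) :=
        abs_blkB_sub_le hy.1 hx.2 hy.2 hr hre hrf' hee hff h1 h2 h3 h4
    _ ≤ 40 * f * (x.2 / r) / (e ^ 2 * f ^ 2) := by gcongr
    _ = 40 * x.2 / (r * e ^ 2 * f) := by field_simp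
    _ ≤ 40 * x.2 / (r * r ^ 2 * m) := by gcongr
    _ = _ := by ring

lemma norm_DG₁_le {x y : ℝ × ℝ} (hx : IsQuad x) (hy : IsQuad y) (hxy : y ≠ x) :
    ‖DG₁ x y‖ ≤ 20 / (‖y - x‖ ^ 2 * max ‖y - x‖ x.1) := by
  calc ‖DG₁ x y‖ ≤ ‖g₁ x y • ContinuousLinearMap.fst ℝ ℝ ℝ‖ +
        ‖g₂ x y • ContinuousLinearMap.snd ℝ ℝ ℝ‖ := norm_add_le _ _
    _ ≤ |g₁ x y| * 1 + |g₂ x y| * 1 := by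
        rw [norm_smul, norm_smul, Real.norm_eq_abs, Real.norm_eq_abs]
        gcongr
        · exact ContinuousLinearMap.norm_fst_le ..
        · exact ContinuousLinearMap.norm_snd_le ..
    _ ≤ 10 / (‖y - x‖ ^ 2 * max ‖y - x‖ x.1) + 10 / (‖y - x‖ ^ 2 * max ‖y - x‖ x.1) := by
        rw [mul_one, mul_one]
        exact add_le_add (abs_g₁_le hx hy hxy) (abs_g₂_le hx hy hxy)
    _ = _ := by ring

lemma measurable_G₁ (x : ℝ × ℝ) : Measurable (G₁ x) := by
  unfold G₁ G₁₁ G₁₂ sqNorm tilde bar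
  fun_prop

lemma measurable_g₁ (x : ℝ × ℝ) : Measurable (g₁ x) := by
  unfold g₁ blkS
  fun_prop

lemma measurable_g₂ (x : ℝ × ℝ) : Measurable (g₂ x) := by
  unfold g₂ blkB
  fun_prop

lemma measurable_DG₁ (x : ℝ × ℝ) : Measurable (DG₁ x) :=
  ((measurable_g₁ x).smul_const _).add ((measurable_g₂ x).smul_const _)

lemma ae_ne (x : ℝ × ℝ) (S : Set (ℝ × ℝ)) : ∀ᵐ y ∂(volume.restrict S), y ≠ x := by
  refine ae_restrict_of_ae ?_
  simp [ae_iff]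

/-! ### Differentiation of singular integrals with respect to the pole. -/

/-- This weight is the dominating function of the differentiation argument: it behaves like r⁻¹ at
the pole and like r⁻³ at infinity, on the integrable side of r⁻² in both cases. -/
lemma integrable_radial_weight (x : ℝ × ℝ) :
    Integrable (fun y : ℝ × ℝ => 1 / (‖y - x‖ * (1 + ‖y - x‖) ^ 2)) := by
  have hm : Measurable (fun y : ℝ × ℝ => 1 / (‖y - x‖ * (1 + ‖y - x‖) ^ 2)) := by fun_prop
  rw [← integrableOn_univ, ← union_compl_self (Metric.ball x 1)]
  refine IntegrableOn.union ?_ ?_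
  · refine (integrableOn_rpow_ball (p := -1) (by norm_num) one_pos x).mono' hm.aestronglyMeasurable ?_
    filter_upwards [ae_ne x _] with y hy
    have hr : 0 < ‖y - x‖ := norm_pos_iff.2 (sub_ne_zero.2 hy)
    rw [Real.norm_of_nonneg (by positivity), Real.rpow_neg_one, ← one_div]
    gcongr
    nlinarith [sq_nonneg ‖y - x‖]
  · refine (integrableOn_rpow_compl_ball (p := -3) (by norm_num) one_pos x).mono'
      hm.aestronglyMeasurable ?_
    filter_upwards [ae_ne x _] with y hy
    have hr : 0 < ‖y - x‖ := norm_pos_iff.2 (sub_ne_zero.2 hy)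
    rw [Real.norm_of_nonneg (by positivity), Real.rpow_neg hr.le, ← one_div]
    gcongr
    norm_cast
    nlinarith [sq_nonneg ‖y - x‖]

/-- The two bounds on f combine to 2L r/(1 + r), which softens the critical singularity r⁻² and
improves nothing at infinity, where nothing is needed. -/
lemma div_mul_abs_le {x₀ : ℝ × ℝ} {f : ℝ × ℝ → ℝ} {L : ℝ} {y : ℝ × ℝ} (hne : y ≠ x₀)
    (hL : |f y| ≤ L) (hL' : |f y| ≤ L * ‖y - x₀‖) {B : ℝ} (hB : 0 ≤ B) :
    B / (‖y - x₀‖ ^ 2 * (1 + ‖y - x₀‖)) * |f y| ≤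
      2 * B * L * (1 / (‖y - x₀‖ * (1 + ‖y - x₀‖) ^ 2)) := by
  have hr : 0 < ‖y - x₀‖ := norm_pos_iff.2 (sub_ne_zero.2 hne)
  generalize ‖y - x₀‖ = r at *
  have h1 : |f y| ≤ 2 * L * (r / (1 + r)) := by
    rw [← mul_div_assoc, le_div_iff₀ (by positivity)]
    have := abs_nonneg (f y)
    nlinarith
  calc _ ≤ B / (r ^ 2 * (1 + r)) * (2 * L * (r / (1 + r))) := by gcongr
    _ = _ := by field_simp

/-- A kernel on `S` with the singularity of a Biot–Savart kernel, differentiable in the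
parameter near `x₀`. -/
structure SingularKernel (S : Set (ℝ × ℝ)) (G : ℝ × ℝ → ℝ × ℝ → ℝ)
    (G' : ℝ × ℝ → ℝ × ℝ → (ℝ × ℝ →L[ℝ] ℝ)) (x₀ : ℝ × ℝ) (ε C : ℝ) : Prop where
  measurableSet : MeasurableSet S
  eps_pos : 0 < ε
  const_nonneg : 0 ≤ C
  hasFDerivAt : ∀ x ∈ Metric.ball x₀ ε, ∀ y ∈ S, y ≠ x → HasFDerivAt (fun x => G x y) (G' x y) x
  abs_le : ∀ x ∈ Metric.ball x₀ ε, ∀ y ∈ S, y ≠ x → |G x y| ≤ C / ‖y - x‖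
  norm_le : ∀ x ∈ Metric.ball x₀ ε, ∀ y ∈ S, y ≠ x →
    ‖G' x y‖ ≤ C / (‖y - x‖ ^ 2 * (1 + ‖y - x‖))
  measurable : ∀ x, Measurable (G x)
  measurable' : Measurable (G' x₀)

namespace SingularKernel

variable {S : Set (ℝ × ℝ)} {G : ℝ × ℝ → ℝ × ℝ → ℝ}
  {G' : ℝ × ℝ → ℝ × ℝ → (ℝ × ℝ →L[ℝ] ℝ)} {x₀ : ℝ × ℝ} {ε C : ℝ}

/-- Mean value inequality on the closed ball about x₀ with radius ‖x - x₀‖: all its points keep at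
least half the distance of x₀ to y, which costs the factor 4·2 = 8. -/
lemma abs_sub_le (K : SingularKernel S G G' x₀ ε C) {x y : ℝ × ℝ} (hx : x ∈ Metric.ball x₀ ε)
    (hy : y ∈ S) (hne : y ≠ x₀) (hxy : 2 * ‖x - x₀‖ ≤ ‖y - x₀‖) :
    |G x y - G x₀ y| ≤ 8 * C / (‖y - x₀‖ ^ 2 * (1 + ‖y - x₀‖)) * ‖x - x₀‖ := by
  have hr : 0 < ‖y - x₀‖ := norm_pos_iff.2 (sub_ne_zero.2 hne)
  have hC := K.const_nonneg
  have hfar : ∀ z ∈ Metric.closedBall x₀ ‖x - x₀‖, ‖y - x₀‖ / 2 ≤ ‖y - z‖ := by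
    intro z hz
    rw [mem_closedBall_iff_norm] at hz
    have := norm_sub_le_norm_sub_add_norm_sub y z x₀
    linarith
  have hsub : ∀ z ∈ Metric.closedBall x₀ ‖x - x₀‖, z ∈ Metric.ball x₀ ε := by
    intro z hz
    rw [mem_closedBall_iff_norm] at hz
    rw [mem_ball_iff_norm] at hx ⊢
    exact hz.trans_lt hx
  have hne' : ∀ z ∈ Metric.closedBall x₀ ‖x - x₀‖, y ≠ z := by
    intro z hz h
    have := hfar z hz
    rw [h] at this
    rw [sub_self, norm_zero] at this
    rw [h] at hr
    linarith
  refine (convex_closedBall x₀ ‖x - x₀‖).norm_image_sub_le_of_norm_hasFDerivWithin_le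
    (f := fun x => G x y) (f' := fun z => G' z y)
    (fun z hz => (K.hasFDerivAt z (hsub z hz) y hy (hne' z hz)).hasFDerivWithinAt) (fun z hz => ?_)
    (Metric.mem_closedBall_self (norm_nonneg _)) (by rw [mem_closedBall_iff_norm])
  refine (K.norm_le z (hsub z hz) y hy (hne' z hz)).trans ?_
  have h1 := hfar z hz
  generalize ‖y - x₀‖ = r at *
  generalize ‖y - z‖ = q at *
  calc C / (q ^ 2 * (1 + q)) ≤ C / ((r / 2) ^ 2 * ((1 + r) / 2)) := by gcongr; linarith
    _ = _ := by field_simp; norm_num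

/-- Near the poles both kernels are O(1/r). Far away only their difference decays fast enough, like
r⁻³; the bound assumed for a single kernel is not integrable at infinity. Boundedness of f suffices.
-/
lemma integrableOn_sub_mul (K : SingularKernel S G G' x₀ ε C) {x : ℝ × ℝ}
    (hx : x ∈ Metric.ball x₀ ε) {f : ℝ × ℝ → ℝ} (hf : Measurable f) {L : ℝ}
    (hL : ∀ y ∈ S, |f y| ≤ L) : IntegrableOn (fun y => (G x y - G x₀ y) * f y) S := by
  rcases eq_or_ne x x₀ with rfl | hne
  · simp
  have hη : 0 < ‖x - x₀‖ := norm_pos_iff.2 (sub_ne_zero.2 hne)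
  have hC := K.const_nonneg
  have hm : Measurable (fun y => (G x y - G x₀ y) * f y) :=
    ((K.measurable x).sub (K.measurable x₀)).mul hf
  have hx0 : x₀ ∈ Metric.ball x₀ ε := Metric.mem_ball_self K.eps_pos
  rw [← inter_union_compl S (Metric.ball x₀ (2 * ‖x - x₀‖))]
  refine IntegrableOn.union ?_ ?_
  · have i1 : IntegrableOn (fun y => ‖y - x‖ ^ (-1 : ℝ)) (Metric.ball x₀ (2 * ‖x - x₀‖)) := by
      refine (integrableOn_rpow_ball (p := -1) (R := 3 * ‖x - x₀‖) (by norm_num) (by positivity)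
        x).mono_set ?_
      refine Metric.ball_subset_ball' ?_
      rw [dist_comm, dist_eq_norm]; linarith
    have i2 := integrableOn_rpow_ball (p := -1) (R := 2 * ‖x - x₀‖) (by norm_num) (by positivity) x₀
    refine (IntegrableOn.mono_set ((i1.add i2).const_mul (C * L)) inter_subset_right).mono'
      hm.aestronglyMeasurable ?_
    filter_upwards [ae_ne x _, ae_ne x₀ _,
      self_mem_ae_restrict (K.measurableSet.inter measurableSet_ball)] with y h1 h2 h3
    simp only [Pi.add_apply, Real.rpow_neg_one]
    rw [norm_mul, Real.norm_eq_abs, Real.norm_eq_abs]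
    have hL0 : 0 ≤ L := (abs_nonneg _).trans (hL y h3.1)
    calc |G x y - G x₀ y| * |f y| ≤ (C / ‖y - x‖ + C / ‖y - x₀‖) * L := by
          gcongr
          · exact (abs_sub _ _).trans (add_le_add (K.abs_le x hx y h3.1 h1) (K.abs_le x₀ hx0 y h3.1 h2))
          · exact hL y h3.1
      _ = _ := by ring
  · have i3 := integrableOn_rpow_compl_ball (p := -3) (R := 2 * ‖x - x₀‖) (by norm_num)
      (by positivity) x₀
    refine (IntegrableOn.mono_set (i3.const_mul (8 * C * ‖x - x₀‖ * L)) inter_subset_right).mono'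
      hm.aestronglyMeasurable ?_
    filter_upwards [ae_ne x₀ _,
      self_mem_ae_restrict (K.measurableSet.inter measurableSet_ball.compl)] with y h2 h3
    have hr : 0 < ‖y - x₀‖ := norm_pos_iff.2 (sub_ne_zero.2 h2)
    have hL0 : 0 ≤ L := (abs_nonneg _).trans (hL y h3.1)
    rw [norm_mul, Real.norm_eq_abs, Real.norm_eq_abs, Real.rpow_neg hr.le]
    have hfar : 2 * ‖x - x₀‖ ≤ ‖y - x₀‖ := by
      have := h3.2
      rwa [mem_compl_iff, mem_ball_iff_norm, not_lt] at this
    calc |G x y - G x₀ y| * |f y| ≤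
        8 * C / (‖y - x₀‖ ^ 2 * (1 + ‖y - x₀‖)) * ‖x - x₀‖ * L := by
          gcongr
          · exact K.abs_sub_le hx h3.1 h2 hfar
          · exact hL y h3.1
      _ ≤ 8 * C / (‖y - x₀‖ ^ 2 * ‖y - x₀‖) * ‖x - x₀‖ * L := by gcongr; linarith
      _ = 8 * C * ‖x - x₀‖ * L * (‖y - x₀‖ ^ 3)⁻¹ := by field_simp
      _ = _ := by norm_cast

variable {f : ℝ × ℝ → ℝ} {L : ℝ}

lemma integrableOn_smul (K : SingularKernel S G G' x₀ ε C) (hf : Measurable f)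
    (hL : ∀ y ∈ S, |f y| ≤ L) (hL' : ∀ y ∈ S, |f y| ≤ L * ‖y - x₀‖) :
    IntegrableOn (fun y => f y • G' x₀ y) S := by
  refine ((integrable_radial_weight x₀).const_mul (2 * C * L)).integrableOn.mono'
    (hf.smul K.measurable').aestronglyMeasurable ?_
  filter_upwards [ae_ne x₀ _, self_mem_ae_restrict K.measurableSet] with y h2 h3
  rw [norm_smul, mul_comm, Real.norm_eq_abs]
  refine le_trans ?_ (div_mul_abs_le h2 (hL y h3) (hL' y h3) K.const_nonneg)
  gcongr
  exact K.norm_le x₀ (Metric.mem_ball_self K.eps_pos) y h3 h2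

/-- The linearization error of the kernel. -/
def err (_ : SingularKernel S G G' x₀ ε C) (f : ℝ × ℝ → ℝ) (x y : ℝ × ℝ) : ℝ :=
  (G x y - G x₀ y) * f y - f y * G' x₀ y (x - x₀)

/-- At the scale η = ‖x - x₀‖ nothing cancels and the terms of the error are bounded one by one. The
density supplies a factor η and the integral of 1/r over a ball of radius R is 8R, so the total is
O(η²) = o(η), with 96 = 2·24 + 3·16. -/
lemma setIntegral_near_le (K : SingularKernel S G G' x₀ ε C) (hL0 : 0 ≤ L)
    (hL' : ∀ y ∈ S, |f y| ≤ L * ‖y - x₀‖) {x : ℝ × ℝ} (hx : x ∈ Metric.ball x₀ ε) (hne : x ≠ x₀) :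
    ∫ y in S ∩ Metric.ball x₀ (2 * ‖x - x₀‖), ‖K.err f x y‖ ≤ 96 * C * L * ‖x - x₀‖ ^ 2 := by
  have hη : 0 < ‖x - x₀‖ := norm_pos_iff.2 (sub_ne_zero.2 hne)
  have hC := K.const_nonneg
  have hx0 : x₀ ∈ Metric.ball x₀ ε := Metric.mem_ball_self K.eps_pos
  have hsub : Metric.ball x₀ (2 * ‖x - x₀‖) ⊆ Metric.ball x (3 * ‖x - x₀‖) := by
    refine Metric.ball_subset_ball' ?_
    rw [dist_comm, dist_eq_norm]; linarith
  have i1 := integrableOn_rpow_ball (p := -1) (R := 3 * ‖x - x₀‖) (by norm_num) (by positivity) x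
  have i2 := integrableOn_rpow_ball (p := -1) (R := 2 * ‖x - x₀‖) (by norm_num) (by positivity) x₀
  have hi := ((i1.mono_set hsub).const_mul (2 * C * L * ‖x - x₀‖)).add
    (i2.const_mul (3 * C * L * ‖x - x₀‖))
  calc ∫ y in S ∩ Metric.ball x₀ (2 * ‖x - x₀‖), ‖K.err f x y‖
      ≤ ∫ y in S ∩ Metric.ball x₀ (2 * ‖x - x₀‖), (2 * C * L * ‖x - x₀‖ * ‖y - x‖ ^ (-1 : ℝ) +
          3 * C * L * ‖x - x₀‖ * ‖y - x₀‖ ^ (-1 : ℝ)) := by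
        refine integral_mono_of_nonneg (Eventually.of_forall fun y => norm_nonneg _)
          (IntegrableOn.mono_set hi inter_subset_right) ?_
        filter_upwards [ae_ne x _, ae_ne x₀ _,
          self_mem_ae_restrict (K.measurableSet.inter measurableSet_ball)] with y h1 h2 h3
        have hr : 0 < ‖y - x₀‖ := norm_pos_iff.2 (sub_ne_zero.2 h2)
        have hq : 0 < ‖y - x‖ := norm_pos_iff.2 (sub_ne_zero.2 h1)
        have hrη : ‖y - x₀‖ ≤ 2 * ‖x - x₀‖ := (mem_ball_iff_norm.1 h3.2).le
        have e1 := K.abs_le x hx y h3.1 h1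
        have e2 := K.abs_le x₀ hx0 y h3.1 h2
        have e3 : ‖G' x₀ y (x - x₀)‖ ≤ C / (‖y - x₀‖ ^ 2 * 1) * ‖x - x₀‖ := by
          refine (ContinuousLinearMap.le_opNorm _ _).trans ?_
          gcongr
          refine (K.norm_le x₀ hx0 y h3.1 h2).trans ?_
          gcongr
          linarith
        have e4 := hL' y h3.1
        simp only [Real.rpow_neg_one]
        rw [Real.norm_eq_abs] at e3 ⊢
        calc |K.err f x y| ≤ (|G x y| + |G x₀ y| + |G' x₀ y (x - x₀)|) * |f y| := by
              rw [err, show (G x y - G x₀ y) * f y - f y * G' x₀ y (x - x₀) =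
                (G x y - G x₀ y - G' x₀ y (x - x₀)) * f y by ring, abs_mul]
              gcongr
              exact (abs_sub _ _).trans (add_le_add (abs_sub _ _) le_rfl)
          _ ≤ (C / ‖y - x‖ + C / ‖y - x₀‖ + C / (‖y - x₀‖ ^ 2 * 1) * ‖x - x₀‖) *
              (L * ‖y - x₀‖) := by gcongr
          _ = C / ‖y - x‖ * (L * ‖y - x₀‖) + C * L * (‖y - x₀‖ * ‖y - x₀‖⁻¹)
              + C * L * ‖x - x₀‖ * ‖y - x₀‖⁻¹ := by field_simp
          _ ≤ C / ‖y - x‖ * (L * (2 * ‖x - x₀‖)) + C * L * (2 * ‖x - x₀‖ * ‖y - x₀‖⁻¹)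
              + C * L * ‖x - x₀‖ * ‖y - x₀‖⁻¹ := by gcongr
          _ = _ := by ring
    _ ≤ ∫ y in Metric.ball x₀ (2 * ‖x - x₀‖), (2 * C * L * ‖x - x₀‖ * ‖y - x‖ ^ (-1 : ℝ) +
          3 * C * L * ‖x - x₀‖ * ‖y - x₀‖ ^ (-1 : ℝ)) :=
        setIntegral_mono_set hi (Eventually.of_forall fun y => by
          simp only [Pi.zero_apply]; positivity)
          inter_subset_right.eventuallyLE
    _ = 2 * C * L * ‖x - x₀‖ * (∫ y in Metric.ball x₀ (2 * ‖x - x₀‖), ‖y - x‖ ^ (-1 : ℝ)) +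
          3 * C * L * ‖x - x₀‖ * ∫ y in Metric.ball x₀ (2 * ‖x - x₀‖), ‖y - x₀‖ ^ (-1 : ℝ) := by
        rw [integral_add ((i1.mono_set hsub).const_mul _) (i2.const_mul _), integral_const_mul,
          integral_const_mul]
    _ ≤ 2 * C * L * ‖x - x₀‖ * (∫ y in Metric.ball x (3 * ‖x - x₀‖), ‖y - x‖ ^ (-1 : ℝ)) +
          3 * C * L * ‖x - x₀‖ * ∫ y in Metric.ball x₀ (2 * ‖x - x₀‖), ‖y - x₀‖ ^ (-1 : ℝ) := by
        refine add_le_add (mul_le_mul_of_nonneg_left ?_ (by positivity)) le_rfl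
        refine setIntegral_mono_set i1 (Eventually.of_forall fun y => ?_) hsub.eventuallyLE
        simp only [Pi.zero_apply]; positivity
    _ = _ := by
        rw [integral_rpow_ball (by norm_num) (by positivity),
          integral_rpow_ball (by norm_num) (by positivity)]
        norm_num
        ring

/-- Dominated convergence: pointwise the quotient tends to 0 by differentiability of the kernel. The
constant 9C is 8C from the mean value inequality plus C from the linear term. -/
lemma tendsto_setIntegral_far (K : SingularKernel S G G' x₀ ε C) (hf : Measurable f)
    (hL : ∀ y ∈ S, |f y| ≤ L) (hL' : ∀ y ∈ S, |f y| ≤ L * ‖y - x₀‖) :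
    Tendsto (fun x => ∫ y in S, (Metric.ball x₀ (2 * ‖x - x₀‖))ᶜ.indicator
      (fun y => ‖x - x₀‖⁻¹ * ‖K.err f x y‖) y) (𝓝 x₀) (𝓝 0) := by
  have hC := K.const_nonneg
  have hx0 : x₀ ∈ Metric.ball x₀ ε := Metric.mem_ball_self K.eps_pos
  rw [show (0 : ℝ) = ∫ y in S, (fun _ => (0 : ℝ)) y by simp]
  refine tendsto_integral_filter_of_dominated_convergence
    (fun y => 2 * (9 * C) * L * (1 / (‖y - x₀‖ * (1 + ‖y - x₀‖) ^ 2))) ?_ ?_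
    ((integrable_radial_weight x₀).const_mul _).integrableOn ?_
  · refine Eventually.of_forall fun x => Measurable.aestronglyMeasurable ?_
    refine Measurable.indicator ?_ measurableSet_ball.compl
    refine Measurable.const_mul (Measurable.norm ?_) _
    exact (((K.measurable x).sub (K.measurable x₀)).mul hf).sub
      (hf.mul (K.measurable'.apply_continuousLinearMap _))
  · filter_upwards [Metric.ball_mem_nhds x₀ K.eps_pos] with x hx
    filter_upwards [ae_ne x₀ _, self_mem_ae_restrict K.measurableSet] with y h2 h3
    have hr : 0 < ‖y - x₀‖ := norm_pos_iff.2 (sub_ne_zero.2 h2)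
    have hL0 : 0 ≤ L := (abs_nonneg _).trans (hL y h3)
    by_cases hfar : y ∈ (Metric.ball x₀ (2 * ‖x - x₀‖))ᶜ
    · rw [indicator_of_mem hfar]
      rw [mem_compl_iff, mem_ball_iff_norm, not_lt] at hfar
      rcases eq_or_ne x x₀ with rfl | hne
      · simp; positivity
      have hη : 0 < ‖x - x₀‖ := norm_pos_iff.2 (sub_ne_zero.2 hne)
      refine le_trans ?_ (div_mul_abs_le h2 (hL y h3) (hL' y h3) (by positivity))
      rw [norm_mul, norm_inv, norm_norm, norm_norm, inv_mul_le_iff₀ hη]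
      have e1 := K.abs_sub_le hx h3 h2 hfar
      have e3 : ‖G' x₀ y (x - x₀)‖ ≤ C / (‖y - x₀‖ ^ 2 * (1 + ‖y - x₀‖)) * ‖x - x₀‖ := by
        refine (ContinuousLinearMap.le_opNorm _ _).trans ?_
        gcongr
        exact K.norm_le x₀ hx0 y h3 h2
      rw [Real.norm_eq_abs] at e3
      calc ‖K.err f x y‖ ≤ (|G x y - G x₀ y| + |G' x₀ y (x - x₀)|) * |f y| := by
            rw [err, show (G x y - G x₀ y) * f y - f y * G' x₀ y (x - x₀) =
              (G x y - G x₀ y - G' x₀ y (x - x₀)) * f y by ring, norm_mul]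
            exact mul_le_mul_of_nonneg_right (abs_sub _ _) (abs_nonneg _)
        _ ≤ (8 * C / (‖y - x₀‖ ^ 2 * (1 + ‖y - x₀‖)) * ‖x - x₀‖ +
            C / (‖y - x₀‖ ^ 2 * (1 + ‖y - x₀‖)) * ‖x - x₀‖) * |f y| := by gcongr
        _ = _ := by ring
    · rw [indicator_of_notMem hfar, norm_zero]; positivity
  · filter_upwards [ae_ne x₀ _, self_mem_ae_restrict K.measurableSet] with y h2 h3
    have h := (hasFDerivAt_iff_tendsto.1 (K.hasFDerivAt x₀ hx0 y h3 h2)).mul_const |f y|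
    rw [zero_mul] at h
    refine squeeze_zero (fun x => ?_) (fun x => ?_) h
    · exact indicator_nonneg (fun y _ => by positivity) _
    · refine (indicator_le_self' (fun y _ => by positivity) y).trans (le_of_eq ?_)
      rw [err, show (G x y - G x₀ y) * f y - f y * G' x₀ y (x - x₀) =
              (G x y - G x₀ y - G' x₀ y (x - x₀)) * f y by ring, norm_mul]
      simp only [Real.norm_eq_abs]
      ring

/-- Differentiation of a singular integral at a point where the density vanishes. -/
theorem hasFDerivAt_integral (K : SingularKernel S G G' x₀ ε C) (hf : Measurable f)
    (hL : ∀ y ∈ S, |f y| ≤ L) (hL' : ∀ y ∈ S, |f y| ≤ L * ‖y - x₀‖) (hL0 : 0 ≤ L) :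
    HasFDerivAt (fun x => ∫ y in S, (G x y - G x₀ y) * f y) (∫ y in S, f y • G' x₀ y) x₀ := by
  rw [hasFDerivAt_iff_tendsto]
  have hlim : Tendsto (fun x : ℝ × ℝ => 96 * C * L * ‖x - x₀‖ +
      ∫ y in S, (Metric.ball x₀ (2 * ‖x - x₀‖))ᶜ.indicator
        (fun y => ‖x - x₀‖⁻¹ * ‖K.err f x y‖) y) (𝓝 x₀) (𝓝 0) := by
    have h1 : Tendsto (fun x : ℝ × ℝ => 96 * C * L * ‖x - x₀‖) (𝓝 x₀) (𝓝 0) := by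
      have : Continuous (fun x : ℝ × ℝ => 96 * C * L * ‖x - x₀‖) := by fun_prop
      simpa using this.tendsto x₀
    simpa using h1.add (K.tendsto_setIntegral_far hf hL hL')
  refine squeeze_zero' (Eventually.of_forall fun x => by positivity) ?_ hlim
  filter_upwards [Metric.ball_mem_nhds x₀ K.eps_pos] with x hx
  rcases eq_or_ne x x₀ with rfl | hne
  · simp
  have hη : 0 < ‖x - x₀‖ := norm_pos_iff.2 (sub_ne_zero.2 hne)
  have i1 := K.integrableOn_sub_mul hx hf hL
  have i2 := K.integrableOn_smul hf hL hL'
  have i2' : IntegrableOn (fun y => f y * G' x₀ y (x - x₀)) S :=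
    i2.apply_continuousLinearMap (x - x₀)
  have hE : IntegrableOn (fun y => K.err f x y) S := i1.sub i2'
  have heq : (∫ y in S, (G x y - G x₀ y) * f y) - (∫ y in S, (G x₀ y - G x₀ y) * f y) -
      (∫ y in S, f y • G' x₀ y) (x - x₀) = ∫ y in S, K.err f x y := by
    rw [ContinuousLinearMap.integral_apply i2]
    simp only [sub_self, zero_mul, integral_zero, sub_zero, _root_.smul_apply,
      smul_eq_mul]
    exact (integral_sub i1 i2').symm
  rw [heq]
  have hsplit : ∫ y in S, ‖K.err f x y‖ =
      (∫ y in S ∩ Metric.ball x₀ (2 * ‖x - x₀‖), ‖K.err f x y‖) +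
        ∫ y in S, (Metric.ball x₀ (2 * ‖x - x₀‖))ᶜ.indicator (fun y => ‖K.err f x y‖) y := by
    rw [← integral_inter_add_sdiff measurableSet_ball hE.norm,
      setIntegral_indicator measurableSet_ball.compl]
    rfl
  calc ‖x - x₀‖⁻¹ * ‖∫ y in S, K.err f x y‖ ≤ ‖x - x₀‖⁻¹ * ∫ y in S, ‖K.err f x y‖ := by
        gcongr; exact norm_integral_le_integral_norm _
    _ ≤ ‖x - x₀‖⁻¹ * (96 * C * L * ‖x - x₀‖ ^ 2 +
        ∫ y in S, (Metric.ball x₀ (2 * ‖x - x₀‖))ᶜ.indicator (fun y => ‖K.err f x y‖) y) := by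
        rw [hsplit]
        gcongr
        exact K.setIntegral_near_le hL0 hL' hx hne
    _ = _ := by
        rw [mul_add, ← integral_const_mul]
        congr 1
        · field_simp
        · congr 1
          ext y
          rw [indicator_const_mul]

end SingularKernel

/-! ### The potential of a rescaled cut-off function. -/

/-- The open first quadrant. -/
def quad : Set (ℝ × ℝ) := Ioi 0 ×ˢ Ioi 0

lemma measurableSet_quad : MeasurableSet quad := measurableSet_Ioi.prod measurableSet_Ioi

/-- The first component of the Biot–Savart kernel, up to a constant. -/
def bs (z : ℝ × ℝ) : ℝ := z.2 / sqNorm z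

lemma norm_sq_le_sqNorm (z : ℝ × ℝ) : ‖z‖ ^ 2 ≤ sqNorm z := by
  rw [Prod.norm_def, sqNorm]
  rcases max_cases ‖z.1‖ ‖z.2‖ with h | h <;> rw [h.1, Real.norm_eq_abs, sq_abs] <;> nlinarith [sq_nonneg z.1, sq_nonneg z.2]

lemma abs_bs_le (z : ℝ × ℝ) : |bs z| ≤ ‖z‖ ^ (-1 : ℝ) := by
  rcases eq_or_ne z 0 with rfl | hz
  · simp [bs]
  have h0 : 0 < ‖z‖ := norm_pos_iff.2 hz
  have h1 := norm_sq_le_sqNorm z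
  have h2 : |z.2| ≤ ‖z‖ := norm_snd_le z
  have h3 : 0 < sqNorm z := lt_of_lt_of_le (by positivity) h1
  rw [bs, abs_div, abs_of_pos h3, Real.rpow_neg_one, ← one_div, div_le_div_iff₀ h3 h0]
  nlinarith

lemma measurable_bs : Measurable bs := by
  unfold bs sqNorm; fun_prop

/-- Homogeneity of degree -1 is what makes the gradient bound for the bump independent of its
radius. -/
lemma bs_smul {c : ℝ} (hc : c ≠ 0) (z : ℝ × ℝ) : bs (c • z) = c⁻¹ * bs z := by
  simp only [bs, sqNorm, Prod.smul_fst, Prod.smul_snd, smul_eq_mul]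
  rw [show (c * z.1) ^ 2 + (c * z.2) ^ 2 = c * (c * (z.1 ^ 2 + z.2 ^ 2)) by ring,
    mul_div_mul_left _ _ hc, div_mul_eq_div_div, div_right_comm]
  field_simp

lemma blk_eq {s t b : ℝ} (hs : s ≠ 0) :
    blk s t b = (4 * s)⁻¹ * (b / ((t - s) ^ 2 + b ^ 2) - b / ((t + s) ^ 2 + b ^ 2)) := by
  rcases eq_or_ne b 0 with rfl | hb
  · simp [blk]
  have h1 : (t - s) ^ 2 + b ^ 2 ≠ 0 := by positivity
  have h2 : (t + s) ^ 2 + b ^ 2 ≠ 0 := by positivity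
  rw [blk]
  field_simp
  ring

/-- Partial fractions split the kernel into Biot–Savart kernels with poles at x and its three mirror
images. The price 1/(4x₁) is harmless for densities concentrated at scale ρ ≤ x₁. -/
lemma G₁_eq_bs {x : ℝ × ℝ} (hx : x.1 ≠ 0) (y : ℝ × ℝ) :
    G₁ x y = (4 * x.1)⁻¹ * (bs (y - x) - bs (y - tilde x) + bs (y - bar x) - bs (y - -x)) := by
  rw [G₁_eq_blk, blk_eq hx, blk_eq hx]
  simp [bs, sqNorm, tilde, bar]
  ring

/-- A smooth cut-off function. -/
def cutoff : ContDiffBump (0 : ℝ × ℝ) := ⟨1 / 2, 1, by norm_num, by norm_num⟩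

/-- The field induced by `cutoff`. -/
def cutoffField (s : ℝ × ℝ) : ℝ := ∫ w, cutoff w * bs (w - s)

lemma locallyIntegrable_bs : LocallyIntegrable (fun z => bs (-z)) := by
  rw [locallyIntegrable_iff]
  intro K hK
  obtain ⟨R, hR, hKR⟩ := hK.isBounded.subset_ball_lt 0 0
  refine ((integrableOn_rpow_ball (p := -1) (by norm_num) hR 0).mono_set hKR).mono'
    (measurable_bs.comp measurable_neg).aestronglyMeasurable ?_
  refine Eventually.of_forall fun z => ?_
  simpa using abs_bs_le (-z)

/-- A majorant of the Biot–Savart kernel with pole `s` on the ball of radius `2`. -/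
def bsMajorant (M : ℝ) (s w : ℝ × ℝ) : ℝ :=
  (Metric.ball s 1).indicator (fun w => M * ‖w - s‖ ^ (-1 : ℝ)) w +
    (Metric.ball (0 : ℝ × ℝ) 2).indicator (fun _ => M) w

lemma integrable_bsMajorant₁ (M : ℝ) (s : ℝ × ℝ) :
    Integrable ((Metric.ball s 1).indicator fun w => M * ‖w - s‖ ^ (-1 : ℝ)) :=
  (integrable_indicator_iff measurableSet_ball).2
    ((integrableOn_rpow_ball (by norm_num) one_pos s).const_mul M)

lemma integrable_bsMajorant₂ (M : ℝ) :
    Integrable ((Metric.ball (0 : ℝ × ℝ) 2).indicator fun _ => M) :=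
  (integrable_indicator_iff measurableSet_ball).2 (integrableOn_const (measure_ball_lt_top.ne))

lemma integrable_bsMajorant (M : ℝ) (s : ℝ × ℝ) : Integrable (bsMajorant M s) :=
  (integrable_bsMajorant₁ M s).add (integrable_bsMajorant₂ M)

/-- 24 = 8 + 16: the integral of 1/r over the unit ball, plus the area of the sup norm ball of
radius 2. -/
lemma integral_bsMajorant (M : ℝ) (s : ℝ × ℝ) : ∫ w, bsMajorant M s w = 24 * M := by
  unfold bsMajorant
  rw [integral_add (integrable_bsMajorant₁ M s) (integrable_bsMajorant₂ M),
    integral_indicator measurableSet_ball,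
    integral_indicator measurableSet_ball, integral_const_mul,
    integral_rpow_ball (by norm_num) one_pos, setIntegral_const]
  have : (volume : Measure (ℝ × ℝ)).real (Metric.ball 0 2) = 16 := by
    rw [measureReal_def, Measure.addHaar_ball _ _ (by norm_num), finrank_plane,
      ENNReal.toReal_mul, ← measureReal_def, volume_real_unit_ball]
    norm_num
  rw [this]
  norm_num
  ring

lemma mul_bs_le_bsMajorant {h : ℝ × ℝ → ℝ} {M : ℝ} (hM : ∀ w, |h w| ≤ M)
    (hsupp : ∀ w, w ∉ Metric.ball (0 : ℝ × ℝ) 2 → h w = 0) (s w : ℝ × ℝ) :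
    |h w| * |bs (w - s)| ≤ bsMajorant M s w := by
  have hM0 : 0 ≤ M := (abs_nonneg _).trans (hM 0)
  have hb := abs_bs_le (w - s)
  have p1 : 0 ≤ (Metric.ball s 1).indicator (fun w => M * ‖w - s‖ ^ (-1 : ℝ)) w :=
    indicator_nonneg (fun w _ => by positivity) w
  have p2 : 0 ≤ (Metric.ball (0 : ℝ × ℝ) 2).indicator (fun _ => M) w :=
    indicator_nonneg (fun w _ => hM0) w
  unfold bsMajorant
  by_cases h2 : w ∈ Metric.ball (0 : ℝ × ℝ) 2
  · by_cases h1 : w ∈ Metric.ball s 1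
    · rw [indicator_of_mem h1]
      have : |h w| * |bs (w - s)| ≤ M * ‖w - s‖ ^ (-1 : ℝ) :=
        mul_le_mul (hM w) hb (abs_nonneg _) hM0
      linarith
    · rw [indicator_of_mem h2]
      rw [mem_ball_iff_norm, not_lt] at h1
      have hb1 : |bs (w - s)| ≤ 1 := by
        refine hb.trans ?_
        rw [Real.rpow_neg_one]
        exact inv_le_one_of_one_le₀ h1
      have : |h w| * |bs (w - s)| ≤ M * 1 := mul_le_mul (hM w) hb1 (abs_nonneg _) hM0
      linarith
  · rw [hsupp w h2]
    simp only [abs_zero, zero_mul]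
    positivity

lemma integral_bs_le {h : ℝ × ℝ → ℝ} {M : ℝ} (hM : ∀ w, |h w| ≤ M)
    (hsupp : ∀ w, w ∉ Metric.ball (0 : ℝ × ℝ) 2 → h w = 0) (s : ℝ × ℝ) :
    ∫ w, |h w| * |bs (w - s)| ≤ 24 * M := by
  rw [← integral_bsMajorant M s]
  exact integral_mono_of_nonneg (Eventually.of_forall fun w => by positivity)
    (integrable_bsMajorant M s) (Eventually.of_forall fun w => mul_bs_le_bsMajorant hM hsupp s w)

lemma cutoff_eq_zero {w : ℝ × ℝ} (hw : w ∉ Metric.ball (0 : ℝ × ℝ) 1) : cutoff w = 0 :=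
  cutoff.zero_of_le_dist (by simpa [cutoff] using hw)

-- The field is the convolution of the bump with a locally integrable kernel, so the derivative
-- falls on the bump. One majorant then controls both the field and its gradient, uniformly in s.
open scoped Convolution in
set_option maxSynthPendingDepth 3 in
lemma exists_cutoffField_bound : ∃ B : ℝ, 0 ≤ B ∧ ∀ s, |cutoffField s| ≤ B ∧
    ∃ W' : ℝ × ℝ →L[ℝ] ℝ, HasFDerivAt cutoffField W' s ∧ ‖W'‖ ≤ B := by
  have hc1 : ContDiff ℝ 1 cutoff := cutoff.contDiff
  have hcs : HasCompactSupport (cutoff : ℝ × ℝ → ℝ) := cutoff.hasCompactSupport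
  obtain ⟨M, hM⟩ := (hcs.fderiv (𝕜 := ℝ)).exists_bound_of_continuous (hc1.continuous_fderiv one_ne_zero)
  have hM0 : 0 ≤ M := (norm_nonneg _).trans (hM 0)
  refine ⟨24 * max M 1, by positivity, fun s => ⟨?_, ?_⟩⟩
  · refine abs_integral_le_integral_abs.trans ?_
    simp only [abs_mul]
    refine integral_bs_le (h := cutoff) (fun w => ?_) (fun w hw => ?_) s
    · rw [abs_of_nonneg cutoff.nonneg]
      exact cutoff.le_one.trans (le_max_right _ _)
    · exact cutoff_eq_zero fun h => hw (Metric.ball_subset_ball (by norm_num) h)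
  · have hd := hcs.hasFDerivAt_convolution_left (ContinuousLinearMap.mul ℝ ℝ) hc1
      locallyIntegrable_bs s
    have heq : cutoffField = (cutoff ⋆[ContinuousLinearMap.mul ℝ ℝ, volume] fun z => bs (-z)) := by
      ext s
      simp [cutoffField, convolution_def]
    rw [← heq] at hd
    refine ⟨_, hd, ?_⟩
    rw [convolution_def]
    refine (norm_integral_le_integral_norm _).trans ?_
    rw [← integral_bsMajorant (max M 1) s]
    refine integral_mono_of_nonneg (Eventually.of_forall fun w => norm_nonneg _)
      (integrable_bsMajorant _ _) (Eventually.of_forall fun w => ?_)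
    refine le_trans ?_ (mul_bs_le_bsMajorant (h := fun w => ‖fderiv ℝ cutoff w‖)
      (fun w => ?_) (fun w hw => ?_) s w)
    · refine (ContinuousLinearMap.le_opNorm₂ _ _ _).trans ?_
      rw [abs_norm, neg_sub, Real.norm_eq_abs]
      have : ‖(ContinuousLinearMap.mul ℝ ℝ).precompL (ℝ × ℝ)‖ ≤ 1 :=
        (ContinuousLinearMap.norm_precompL_le _ _).trans (by simp)
      gcongr
      exact mul_le_of_le_one_left (norm_nonneg _) this
    · rw [abs_norm]; exact (hM w).trans (le_max_left _ _)
    · have : w ∉ tsupport (fderiv ℝ cutoff) := by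
        intro h
        have := tsupport_fderiv_subset ℝ h
        rw [cutoff.tsupport_eq] at this
        refine hw (Metric.closedBall_subset_ball ?_ this)
        simp [cutoff]
      rw [image_eq_zero_of_notMem_tsupport this, norm_zero]

/-- The cut-off function rescaled to the ball of radius `ρ` about `x₀`. -/
def cutoffAt (x₀ : ℝ × ℝ) (ρ : ℝ) (y : ℝ × ℝ) : ℝ := cutoff (ρ⁻¹ • (y - x₀))

lemma cutoffAt_nonneg (x₀ : ℝ × ℝ) (ρ : ℝ) (y : ℝ × ℝ) : 0 ≤ cutoffAt x₀ ρ y := cutoff.nonneg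

lemma cutoffAt_le_one (x₀ : ℝ × ℝ) (ρ : ℝ) (y : ℝ × ℝ) : cutoffAt x₀ ρ y ≤ 1 := cutoff.le_one

lemma measurable_cutoffAt (x₀ : ℝ × ℝ) (ρ : ℝ) : Measurable (cutoffAt x₀ ρ) := by
  have : Continuous (cutoff : ℝ × ℝ → ℝ) := cutoff.continuous
  unfold cutoffAt
  fun_prop

lemma cutoffAt_eq_zero {x₀ y : ℝ × ℝ} {ρ : ℝ} (hρ : 0 < ρ) (hy : ρ ≤ ‖y - x₀‖) :
    cutoffAt x₀ ρ y = 0 := by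
  refine cutoff_eq_zero ?_
  rw [mem_ball_zero_iff, not_lt, norm_smul, norm_inv, Real.norm_of_nonneg hρ.le]
  rwa [le_inv_mul_iff₀ hρ, mul_one]

lemma cutoffAt_eq_one {x₀ y : ℝ × ℝ} {ρ : ℝ} (hρ : 0 < ρ) (hy : ‖y - x₀‖ ≤ ρ / 2) :
    cutoffAt x₀ ρ y = 1 := by
  refine cutoff.one_of_mem_closedBall ?_
  rw [mem_closedBall_zero_iff, norm_smul, norm_inv, Real.norm_of_nonneg hρ.le,
    inv_mul_le_iff₀ hρ]
  simpa [cutoff, div_eq_mul_inv] using hy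

/-- The change of variables gives ρ² and the homogeneity of the kernel ρ⁻¹. The remaining ρ cancels
the ρ⁻¹ that appears on differentiation. -/
lemma integral_cutoffAt_mul_bs (x₀ x : ℝ × ℝ) {ρ : ℝ} (hρ : 0 < ρ) :
    ∫ y, cutoffAt x₀ ρ y * bs (y - x) = ρ * cutoffField (ρ⁻¹ • (x - x₀)) := by
  have h1 : ∫ y, cutoffAt x₀ ρ y * bs (y - x) =
      ∫ u, cutoff (ρ⁻¹ • u) * bs (u - (x - x₀)) := by
    rw [← integral_sub_right_eq_self (fun u => cutoff (ρ⁻¹ • u) * bs (u - (x - x₀))) x₀]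
    simp [cutoffAt]
  have h2 := Measure.integral_comp_smul (volume : Measure (ℝ × ℝ))
    (fun u => cutoff (ρ⁻¹ • u) * bs (u - (x - x₀))) ρ
  rw [finrank_plane, abs_of_pos (by positivity), smul_eq_mul] at h2
  rw [h1, cutoffField]
  have h3 : ∀ w, cutoff (ρ⁻¹ • ρ • w) * bs (ρ • w - (x - x₀)) =
      ρ⁻¹ * (cutoff w * bs (w - ρ⁻¹ • (x - x₀))) := by
    intro w
    rw [inv_smul_smul₀ hρ.ne', show ρ • w - (x - x₀) = ρ • (w - ρ⁻¹ • (x - x₀)) by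
      rw [smul_sub, smul_inv_smul₀ hρ.ne'], bs_smul hρ.ne']
    ring
  simp only [h3] at h2
  rw [integral_const_mul] at h2
  field_simp at h2 ⊢
  exact h2.symm

lemma integrable_cutoffAt_mul_bs (x₀ x : ℝ × ℝ) {ρ : ℝ} (hρ : 0 < ρ) :
    Integrable fun y => cutoffAt x₀ ρ y * bs (y - x) := by
  have hb : 0 < ρ + ‖x - x₀‖ := by positivity
  have hi : Integrable ((Metric.ball x (ρ + ‖x - x₀‖)).indicator fun y => ‖y - x‖ ^ (-1 : ℝ)) :=
    (integrable_indicator_iff measurableSet_ball).2 (integrableOn_rpow_ball (by norm_num) hb x)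
  refine hi.mono' ((measurable_cutoffAt x₀ ρ).mul
    (measurable_bs.comp (measurable_id.sub_const x))).aestronglyMeasurable ?_
  refine Eventually.of_forall fun y => ?_
  by_cases hy : y ∈ Metric.ball x (ρ + ‖x - x₀‖)
  · rw [indicator_of_mem hy, norm_mul, Real.norm_of_nonneg (cutoffAt_nonneg _ _ _)]
    exact (mul_le_of_le_one_left (norm_nonneg _) (cutoffAt_le_one _ _ _)).trans (abs_bs_le _)
  · rw [indicator_of_notMem hy, cutoffAt_eq_zero hρ]
    · simp
    · rw [mem_ball_iff_norm, not_lt] at hy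
      have := norm_sub_le_norm_sub_add_norm_sub y x₀ x
      rw [norm_sub_rev x₀ x] at this
      linarith

lemma mem_quad_of_cutoffAt_ne_zero {x₀ y : ℝ × ℝ} {ρ : ℝ} (hρ : 0 < ρ) (h1 : ρ ≤ x₀.1)
    (h2 : ρ ≤ x₀.2) (hy : cutoffAt x₀ ρ y ≠ 0) : y ∈ quad := by
  have h : ‖y - x₀‖ < ρ := by
    by_contra h
    exact hy (cutoffAt_eq_zero hρ (not_lt.1 h))
  have e1 := (norm_fst_le (y - x₀)).trans_lt h
  have e2 := (norm_snd_le (y - x₀)).trans_lt h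
  rw [Real.norm_eq_abs, abs_lt] at e1 e2
  simp only [Prod.fst_sub, Prod.snd_sub] at e1 e2
  exact ⟨show 0 < y.1 by linarith, show 0 < y.2 by linarith⟩

lemma G₁_mul_cutoffAt {x₀ x : ℝ × ℝ} {ρ : ℝ} (hx : x.1 ≠ 0) (y : ℝ × ℝ) :
    G₁ x y * cutoffAt x₀ ρ y = (4 * x.1)⁻¹ * (cutoffAt x₀ ρ y * bs (y - x) -
      cutoffAt x₀ ρ y * bs (y - tilde x) + cutoffAt x₀ ρ y * bs (y - bar x) -
      cutoffAt x₀ ρ y * bs (y - -x)) := by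
  rw [G₁_eq_bs hx]; ring

lemma integrable_G₁_mul_cutoffAt {x₀ x : ℝ × ℝ} {ρ : ℝ} (hρ : 0 < ρ) (hx : x.1 ≠ 0) :
    Integrable fun y => G₁ x y * cutoffAt x₀ ρ y := by
  simp only [G₁_mul_cutoffAt hx]
  exact ((((integrable_cutoffAt_mul_bs x₀ x hρ).sub (integrable_cutoffAt_mul_bs x₀ _ hρ)).add
    (integrable_cutoffAt_mul_bs x₀ _ hρ)).sub (integrable_cutoffAt_mul_bs x₀ _ hρ)).const_mul _

lemma setIntegral_G₁_mul_cutoffAt {x₀ x : ℝ × ℝ} {ρ : ℝ} (hρ : 0 < ρ) (h1 : ρ ≤ x₀.1)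
    (h2 : ρ ≤ x₀.2) (hx : x.1 ≠ 0) :
    ∫ y in quad, G₁ x y * cutoffAt x₀ ρ y = (4 * x.1)⁻¹ * (ρ * cutoffField (ρ⁻¹ • (x - x₀)) -
      ρ * cutoffField (ρ⁻¹ • (tilde x - x₀)) + ρ * cutoffField (ρ⁻¹ • (bar x - x₀)) -
      ρ * cutoffField (ρ⁻¹ • (-x - x₀))) := by
  rw [setIntegral_eq_integral_of_forall_compl_eq_zero]
  · simp only [G₁_mul_cutoffAt hx]
    rw [integral_const_mul, integral_sub, integral_add, integral_sub]
    · simp only [integral_cutoffAt_mul_bs _ _ hρ]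
    · exact integrable_cutoffAt_mul_bs _ _ hρ
    · exact integrable_cutoffAt_mul_bs _ _ hρ
    · exact (integrable_cutoffAt_mul_bs _ _ hρ).sub (integrable_cutoffAt_mul_bs _ _ hρ)
    · exact integrable_cutoffAt_mul_bs _ _ hρ
    · exact ((integrable_cutoffAt_mul_bs _ _ hρ).sub (integrable_cutoffAt_mul_bs _ _ hρ)).add
        (integrable_cutoffAt_mul_bs _ _ hρ)
    · exact integrable_cutoffAt_mul_bs _ _ hρ
  · intro y hy
    by_contra h
    exact hy (mem_quad_of_cutoffAt_ne_zero hρ h1 h2 (right_ne_zero_of_mul h))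

/-- The field induced by a rescaled cut-off function, composed with a linear map. -/
lemma exists_hasFDerivAt_scaled {B : ℝ} (hB : ∀ s, |cutoffField s| ≤ B ∧
    ∃ W' : ℝ × ℝ →L[ℝ] ℝ, HasFDerivAt cutoffField W' s ∧ ‖W'‖ ≤ B) {ρ : ℝ} (hρ : 0 < ρ)
    (x₀ x : ℝ × ℝ) (T : ℝ × ℝ →L[ℝ] ℝ × ℝ) (hT : ‖T‖ ≤ 1) :
    |ρ * cutoffField (ρ⁻¹ • (T x - x₀))| ≤ ρ * B ∧ ∃ V' : ℝ × ℝ →L[ℝ] ℝ,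
      HasFDerivAt (fun x => ρ * cutoffField (ρ⁻¹ • (T x - x₀))) V' x ∧ ‖V'‖ ≤ B := by
  constructor
  · rw [abs_mul, abs_of_pos hρ]
    exact mul_le_mul_of_nonneg_left (hB _).1 hρ.le
  · obtain ⟨W', hW, hWB⟩ := (hB (ρ⁻¹ • (T x - x₀))).2
    have hi : HasFDerivAt (fun x => ρ⁻¹ • (T x - x₀)) (ρ⁻¹ • T) x :=
      (T.hasFDerivAt.sub_const x₀).const_smul ρ⁻¹
    refine ⟨W'.comp T, ?_, ?_⟩
    · refine ((hW.comp x hi).const_mul ρ).congr_fderiv ?_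
      ext <;> simp [hρ.ne']
    · calc _ ≤ ‖W'‖ * ‖T‖ := ContinuousLinearMap.opNorm_comp_le _ _
        _ ≤ B * 1 := mul_le_mul hWB hT (norm_nonneg _) ((norm_nonneg _).trans hWB)
        _ = B := mul_one B

/-- The expression is x₁ times the product rule for (1/(4x₁)) times a combination of four fields,
with values s and derivatives v. The derivative of 1/x₁ is compensated by the factor ρ ≤ x₁ in the
values. -/
lemma abs_scaled_quotient_le {B x ρ v₁ v₂ v₃ v₄ s₁ s₂ s₃ s₄ k : ℝ} (hx : 0 < x) (hρ : ρ ≤ x)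
    (hB : 0 ≤ B) (hv₁ : |v₁| ≤ B) (hv₂ : |v₂| ≤ B) (hv₃ : |v₃| ≤ B) (hv₄ : |v₄| ≤ B)
    (hs₁ : |s₁| ≤ ρ * B) (hs₂ : |s₂| ≤ ρ * B) (hs₃ : |s₃| ≤ ρ * B) (hs₄ : |s₄| ≤ ρ * B)
    (hk : |k| ≤ 1) :
    |x * ((4 * x)⁻¹ * (v₁ - v₂ + v₃ - v₄) +
      (s₁ - s₂ + s₃ - s₄) * (-(((4 * x) ^ 2)⁻¹ * 4) * k))| ≤ 2 * B := by
  have h4 : ∀ {a b c d R : ℝ}, |a| ≤ R → |b| ≤ R → |c| ≤ R → |d| ≤ R →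
      |a - b + c - d| ≤ 4 * R := by
    intro a b c d R ha hb hc hd
    rw [abs_le] at *
    constructor <;> linarith
  have hv := h4 hv₁ hv₂ hv₃ hv₄
  have hs := h4 hs₁ hs₂ hs₃ hs₄
  generalize v₁ - v₂ + v₃ - v₄ = v at *
  generalize s₁ - s₂ + s₃ - s₄ = s at *
  have h5 : x * ((4 * x)⁻¹ * v + s * (-(((4 * x) ^ 2)⁻¹ * 4) * k)) = v / 4 - s * k / (4 * x) := by
    field_simp
    ring
  have h6 : |s * k / (4 * x)| ≤ B := by
    rw [abs_div, abs_of_pos (by positivity : 0 < 4 * x), div_le_iff₀ (by positivity), abs_mul]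
    nlinarith [mul_le_mul hs hk (abs_nonneg _) ((abs_nonneg _).trans hs),
      mul_le_mul_of_nonneg_right hρ hB]
  rw [h5]
  rw [abs_le] at *
  constructor <;> linarith

/-- The scale-invariant bound for the potential of a rescaled cut-off function. -/
lemma exists_cutoffAt_bound : ∃ B : ℝ, 0 ≤ B ∧ ∀ (x₀ : ℝ × ℝ) (ρ : ℝ), 0 < ρ → ρ ≤ x₀.1 →
    ρ ≤ x₀.2 → ∃ F' : ℝ × ℝ →L[ℝ] ℝ,
      HasFDerivAt (fun x => ∫ y in quad, G₁ x y * cutoffAt x₀ ρ y) F' x₀ ∧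
      |x₀.1 * F' (1, 0)| ≤ B ∧ |x₀.1 * F' (0, 1)| ≤ B := by
  obtain ⟨B, hB0, hB⟩ := exists_cutoffField_bound
  refine ⟨2 * B, by positivity, fun x₀ ρ hρ h1 h2 => ?_⟩
  have hx : 0 < x₀.1 := hρ.trans_le h1
  let F := ContinuousLinearMap.fst ℝ ℝ ℝ
  let S := ContinuousLinearMap.snd ℝ ℝ ℝ
  have hn : ∀ T : ℝ × ℝ →L[ℝ] ℝ × ℝ, (∀ z, ‖T z‖ = ‖z‖) → ‖T‖ ≤ 1 := fun T hT =>
    T.opNorm_le_bound zero_le_one fun z => by rw [hT, one_mul]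
  obtain ⟨b1, V1, d1, n1⟩ := exists_hasFDerivAt_scaled hB hρ x₀ x₀ (ContinuousLinearMap.id ℝ _)
    (hn _ fun z => rfl)
  obtain ⟨b2, V2, d2, n2⟩ := exists_hasFDerivAt_scaled hB hρ x₀ x₀ ((-F).prod S)
    (hn _ fun z => by simp [F, S, Prod.norm_def])
  obtain ⟨b3, V3, d3, n3⟩ := exists_hasFDerivAt_scaled hB hρ x₀ x₀ (F.prod (-S))
    (hn _ fun z => by simp [F, S, Prod.norm_def])
  obtain ⟨b4, V4, d4, n4⟩ := exists_hasFDerivAt_scaled hB hρ x₀ x₀ (-ContinuousLinearMap.id ℝ _)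
    (hn _ fun z => by simp)
  have hI : HasFDerivAt (fun x : ℝ × ℝ => (4 * x.1)⁻¹) (-(((4 * x₀.1) ^ 2)⁻¹ * 4) • F) x₀ := by
    have hl : HasFDerivAt (fun x : ℝ × ℝ => 4 * x.1) ((4 : ℝ) • F) x₀ :=
      (hasFDerivAt_fst (𝕜 := ℝ)).const_mul 4
    refine ((hasDerivAt_inv (by positivity : 4 * x₀.1 ≠ 0)).comp_hasFDerivAt x₀ hl).congr_fderiv ?_
    ext <;> simp [mul_assoc]
  have hV := ((d1.sub d2).add d3).sub d4
  refine ⟨_, (hI.mul hV).congr_of_eventuallyEq ?_, ?_, ?_⟩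
  · have : ∀ᶠ x : ℝ × ℝ in 𝓝 x₀, x.1 ≠ 0 :=
      continuousAt_fst.eventually_ne hx.ne'
    filter_upwards [this] with x hx
    rw [setIntegral_G₁_mul_cutoffAt hρ h1 h2 hx]
    rfl
  all_goals
    have happ : ∀ (V : ℝ × ℝ →L[ℝ] ℝ) (e : ℝ × ℝ), ‖e‖ ≤ 1 → ‖V‖ ≤ B → |V e| ≤ B :=
      fun V e he hV => (V.le_opNorm_of_le he).trans (by rwa [mul_one])
  · have he : ‖((1, 0) : ℝ × ℝ)‖ ≤ 1 := by simp [Prod.norm_def]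
    exact abs_scaled_quotient_le hx h1 hB0 (happ V1 _ he n1) (happ V2 _ he n2) (happ V3 _ he n3)
      (happ V4 _ he n4) b1 b2 b3 b4 (by simp [F] : |F (1, 0)| ≤ 1)
  · have he : ‖((0, 1) : ℝ × ℝ)‖ ≤ 1 := by simp [Prod.norm_def]
    exact abs_scaled_quotient_le hx h1 hB0 (happ V1 _ he n1) (happ V2 _ he n2) (happ V3 _ he n3)
      (happ V4 _ he n4) b1 b2 b3 b4 (by simp [F] : |F (0, 1)| ≤ 1)

/-! ### Integrals over growing squares, and boundedness of the vorticity. -/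

lemma square_ae_eq (R : ℝ) : square R =ᵐ[volume] (square R ∩ quad : Set (ℝ × ℝ)) := by
  have h : square R ∩ quad = Ioc 0 R ×ˢ Ioc 0 R := by
    ext y
    simp only [square, quad, mem_inter_iff, mem_prod, mem_Icc, mem_Ioi, mem_Ioc]
    constructor
    · rintro ⟨⟨⟨_, h1⟩, ⟨_, h2⟩⟩, h3, h4⟩; exact ⟨⟨h3, h1⟩, h4, h2⟩
    · rintro ⟨⟨h3, h1⟩, h4, h2⟩; exact ⟨⟨⟨h3.le, h1⟩, ⟨h4.le, h2⟩⟩, h3, h4⟩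
  rw [h, Measure.volume_eq_prod]
  exact Measure.set_prod_ae_eq Ioc_ae_eq_Icc.symm Ioc_ae_eq_Icc.symm

lemma measurableSet_square (R : ℝ) : MeasurableSet (square R) :=
  measurableSet_Icc.prod measurableSet_Icc

lemma isCompact_square (R : ℝ) : IsCompact (square R) := isCompact_Icc.prod isCompact_Icc

lemma integrableOn_square_of_quad {f : ℝ × ℝ → ℝ} (hf : IntegrableOn f quad) (R : ℝ) :
    IntegrableOn f (square R) :=
  IntegrableOn.congr_set_ae (hf.mono_set inter_subset_right) (square_ae_eq R)

lemma tendsto_setIntegral_square {f : ℝ × ℝ → ℝ} (hf : IntegrableOn f quad) :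
    Tendsto (fun R => ∫ y in square R, f y) atTop (𝓝 (∫ y in quad, f y)) := by
  have hc : AECover (volume.restrict quad) atTop square :=
    { ae_eventually_mem := by
        filter_upwards [self_mem_ae_restrict measurableSet_quad] with y hy
        filter_upwards [eventually_ge_atTop y.1, eventually_ge_atTop y.2] with R h1 h2
        exact ⟨⟨le_of_lt hy.1, h1⟩, le_of_lt hy.2, h2⟩
      measurableSet := measurableSet_square }
  refine (hc.integral_tendsto_of_countably_generated hf).congr fun R => ?_
  rw [Measure.restrict_restrict (measurableSet_square R)]
  exact (setIntegral_congr_set (square_ae_eq R)).symm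

namespace IsVorticity

variable {ω : ℝ × ℝ → ℝ}

lemma continuous (h : IsVorticity ω) : Continuous ω := h.contDiff.continuous

/-- Periodicity reduces the plane to a compact square. Boundedness is needed for the real-valued
supremum in `supNorm` to be an upper bound. -/
lemma bddAbove (h : IsVorticity ω) : BddAbove (range fun y => |ω y|) := by
  obtain ⟨B, hB⟩ := (isCompact_square 2).bddAbove_image h.continuous.abs.continuousOn
  refine ⟨B, ?_⟩
  rintro _ ⟨⟨a, b⟩, rfl⟩
  have p1 : ∀ b, Function.Periodic (fun a => ω (a, b)) 2 := fun b a => h.periodic₁ a b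
  have p2 : ∀ a, Function.Periodic (fun b => ω (a, b)) 2 := fun a b => h.periodic₂ a b
  obtain ⟨a', ha', e1⟩ := (p1 b).exists_mem_Ico₀ two_pos a
  obtain ⟨b', hb', e2⟩ := (p2 a').exists_mem_Ico₀ two_pos b
  refine hB ⟨(a', b'), ⟨Ico_subset_Icc_self ha', Ico_subset_Icc_self hb'⟩, ?_⟩
  simp only at e1 e2 ⊢
  rw [e1, e2]

lemma abs_le (h : IsVorticity ω) (y : ℝ × ℝ) : |ω y| ≤ supNorm ω := le_ciSup h.bddAbove y

lemma supNorm_nonneg (h : IsVorticity ω) : 0 ≤ supNorm ω := (abs_nonneg _).trans (h.abs_le 0)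

end IsVorticity

/-! ### Convergence at infinity of the integral that defines `Q₁`. -/

/-- The primitive of `ω` in the second variable. -/
def primitive (ω : ℝ × ℝ → ℝ) (y : ℝ × ℝ) : ℝ := ∫ t in (0 : ℝ)..y.2, ω (y.1, t)

lemma IsVorticity.continuous_slice {ω : ℝ × ℝ → ℝ} (h : IsVorticity ω) (a : ℝ) :
    Continuous fun t => ω (a, t) := h.continuous.comp (by fun_prop)

lemma IsVorticity.integral_period {ω : ℝ × ℝ → ℝ} (h : IsVorticity ω) (a s : ℝ) :
    ∫ t in s..(s + 2), ω (a, t) = 0 := by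
  have hp : Function.Periodic (fun t => ω (a, t)) 2 := fun b => h.periodic₂ a b
  rw [hp.intervalIntegral_add_eq s (-1)]
  have h1 : ∫ t in (-1 : ℝ)..1, ω (a, -t) = ∫ t in (-1 : ℝ)..1, ω (a, t) := by
    rw [intervalIntegral.integral_comp_neg (fun t => ω (a, t)), neg_neg]
  simp only [h.odd₂, intervalIntegral.integral_neg] at h1
  norm_num
  linarith

/-- By oddness ω has mean zero over a period in y₂, so its primitive is again 2-periodic in y₂ and
only heights in [0, 2) matter. -/
lemma IsVorticity.abs_primitive_le {ω : ℝ × ℝ → ℝ} (h : IsVorticity ω) (y : ℝ × ℝ) :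
    |primitive ω y| ≤ 2 * supNorm ω := by
  obtain ⟨a, b⟩ := y
  have hi : ∀ s t : ℝ, IntervalIntegrable (fun t => ω (a, t)) volume s t :=
    fun s t => (h.continuous_slice a).intervalIntegrable _ _
  have hp : Function.Periodic (fun b => primitive ω (a, b)) 2 := by
    intro b
    simp only [primitive]
    rw [← intervalIntegral.integral_add_adjacent_intervals (hi 0 b) (hi b (b + 2)),
      h.integral_period, add_zero]
  obtain ⟨b', hb', e⟩ := hp.exists_mem_Ico₀ two_pos b
  change primitive ω (a, b) = primitive ω (a, b') at e
  rw [e, primitive]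
  have := intervalIntegral.norm_integral_le_of_norm_le_const (a := 0) (b := b') (C := supNorm ω)
    (f := fun t => ω (a, t)) (fun t _ => h.abs_le _)
  rw [Real.norm_eq_abs, sub_zero, abs_of_nonneg hb'.1] at this
  nlinarith [hb'.2, h.supNorm_nonneg]

lemma IsVorticity.continuous_primitive {ω : ℝ × ℝ → ℝ} (h : IsVorticity ω) :
    Continuous (primitive ω) := by
  unfold primitive
  refine intervalIntegral.continuous_parametric_intervalIntegral_of_continuous ?_ continuous_snd
  exact h.continuous.comp (by fun_prop : Continuous fun p : (ℝ × ℝ) × ℝ => (p.1.1, p.2))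

lemma IsVorticity.hasDerivAt_primitive {ω : ℝ × ℝ → ℝ} (h : IsVorticity ω) (a b : ℝ) :
    HasDerivAt (fun b => primitive ω (a, b)) (ω (a, b)) b :=
  ((h.continuous_slice a).integral_hasStrictDerivAt 0 b).hasDerivAt

/-- A smooth kernel with the behaviour of `G₁` at infinity. -/
def asymKernel (y : ℝ × ℝ) : ℝ := 2 * y.1 * y.2 / (1 + y.1 ^ 2 + y.2 ^ 2) ^ 2

/-- The derivative of `asymKernel` in the second variable. -/
def asymKernel' (y : ℝ × ℝ) : ℝ :=
  2 * y.1 * (1 + y.1 ^ 2 - 3 * y.2 ^ 2) / (1 + y.1 ^ 2 + y.2 ^ 2) ^ 3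

lemma asym_pos (a b : ℝ) : 0 < 1 + a ^ 2 + b ^ 2 := by positivity

lemma continuous_asymKernel : Continuous asymKernel := by
  unfold asymKernel
  exact Continuous.div (by fun_prop) (by fun_prop) fun y => (pow_pos (asym_pos _ _) _).ne'

lemma continuous_asymKernel' : Continuous asymKernel' := by
  unfold asymKernel'
  exact Continuous.div (by fun_prop) (by fun_prop) fun y => (pow_pos (asym_pos _ _) _).ne'

lemma hasDerivAt_asymKernel (a b : ℝ) :
    HasDerivAt (fun b => asymKernel (a, b)) (asymKernel' (a, b)) b := by
  have hp := asym_pos a b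
  have hn : HasDerivAt (fun b : ℝ => 2 * a * b) (2 * a) b := by
    simpa using (hasDerivAt_id b).const_mul (2 * a)
  have hd : HasDerivAt (fun b : ℝ => (1 + a ^ 2 + b ^ 2) ^ 2)
      (2 * (1 + a ^ 2 + b ^ 2) * (2 * b)) b := by
    have : HasDerivAt (fun b : ℝ => 1 + a ^ 2 + b ^ 2) (2 * b) b := by
      simpa using ((hasDerivAt_id b).pow 2).const_add (1 + a ^ 2)
    simpa using! this.pow 2
  refine (hn.div hd (pow_pos hp 2).ne').congr_deriv ?_
  simp only [asymKernel']
  field_simp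
  ring

lemma abs_asymKernel'_le (y : ℝ × ℝ) : |asymKernel' y| ≤ 24 * (1 + ‖y‖) ^ (-3 : ℝ) := by
  have hp := asym_pos y.1 y.2
  have hq : (1 + ‖y‖) ^ 2 ≤ 2 * (1 + y.1 ^ 2 + y.2 ^ 2) := by
    have := norm_sq_le_sqNorm y
    rw [sqNorm] at this
    nlinarith [sq_nonneg (1 - ‖y‖)]
  have h1 : |y.1| ≤ ‖y‖ := norm_fst_le y
  have hr := norm_nonneg y
  have e1 : |asymKernel' y| ≤ 6 * |y.1| / (1 + y.1 ^ 2 + y.2 ^ 2) ^ 2 := by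
    rw [asymKernel', abs_div, abs_mul, abs_mul, abs_of_pos (pow_pos hp 3), abs_two,
      div_le_div_iff₀ (pow_pos hp 3) (pow_pos hp 2)]
    have : |1 + y.1 ^ 2 - 3 * y.2 ^ 2| ≤ 3 * (1 + y.1 ^ 2 + y.2 ^ 2) := by
      rw [abs_le]; constructor <;> nlinarith [sq_nonneg y.1, sq_nonneg y.2]
    calc _ ≤ 2 * |y.1| * (3 * (1 + y.1 ^ 2 + y.2 ^ 2)) * (1 + y.1 ^ 2 + y.2 ^ 2) ^ 2 := by gcongr
      _ = _ := by ring
  refine e1.trans ?_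
  rw [Real.rpow_neg (by positivity)]
  norm_cast
  rw [← div_eq_mul_inv, div_le_div_iff₀ (by positivity) (by positivity)]
  calc 6 * |y.1| * (1 + ‖y‖) ^ 3 ≤ 6 * (1 + ‖y‖) * (1 + ‖y‖) ^ 3 := by gcongr; linarith
    _ = 6 * ((1 + ‖y‖) ^ 2) ^ 2 := by ring
    _ ≤ 6 * (2 * (1 + y.1 ^ 2 + y.2 ^ 2)) ^ 2 := by gcongr
    _ = _ := by ring

lemma integrable_decay : Integrable (fun y : ℝ × ℝ => (1 + ‖y‖) ^ (-3 : ℝ)) :=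
  integrable_one_add_norm (by rw [finrank_plane]; norm_num)

lemma IsVorticity.integrable_asymKernel' {ω : ℝ × ℝ → ℝ} (h : IsVorticity ω) :
    Integrable fun y => asymKernel' y * primitive ω y := by
  refine (integrable_decay.const_mul (24 * (2 * supNorm ω))).mono'
    (continuous_asymKernel'.mul h.continuous_primitive).aestronglyMeasurable
    (Eventually.of_forall fun y => ?_)
  rw [norm_mul, Real.norm_eq_abs, Real.norm_eq_abs]
  calc _ ≤ 24 * (1 + ‖y‖) ^ (-3 : ℝ) * (2 * supNorm ω) :=
        mul_le_mul (abs_asymKernel'_le y) (h.abs_primitive_le y) (abs_nonneg _) (by positivity)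
    _ = _ := by ring

lemma setIntegral_square {f : ℝ × ℝ → ℝ} (hf : Continuous f) {R : ℝ} (hR : 0 ≤ R) :
    ∫ y in square R, f y = ∫ a in (0 : ℝ)..R, ∫ b in (0 : ℝ)..R, f (a, b) := by
  rw [square, Measure.volume_eq_prod, setIntegral_prod _
    (hf.continuousOn.integrableOn_compact (isCompact_square R)),
    intervalIntegral.integral_of_le hR, ← integral_Icc_eq_integral_Ioc]
  simp only [intervalIntegral.integral_of_le hR, ← integral_Icc_eq_integral_Ioc]

/-- Integration by parts in y₂ trades the critical decay r⁻² for the integrable r⁻³. The lower edge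
contributes nothing because the primitive starts at 0. -/
lemma IsVorticity.setIntegral_asymKernel {ω : ℝ × ℝ → ℝ} (h : IsVorticity ω) {R : ℝ}
    (hR : 0 ≤ R) : ∫ y in square R, asymKernel y * ω y =
      (∫ a in (0 : ℝ)..R, asymKernel (a, R) * primitive ω (a, R)) -
        ∫ y in square R, asymKernel' y * primitive ω y := by
  rw [setIntegral_square (f := fun y => asymKernel y * ω y)
      (continuous_asymKernel.mul h.continuous) hR,
    setIntegral_square (f := fun y => asymKernel' y * primitive ω y)
      (continuous_asymKernel'.mul h.continuous_primitive) hR,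
    ← intervalIntegral.integral_sub]
  · refine intervalIntegral.integral_congr fun a _ => ?_
    rw [intervalIntegral.integral_mul_deriv_eq_deriv_mul
      (u := fun b => asymKernel (a, b)) (v := fun b => primitive ω (a, b))
      (u' := fun b => asymKernel' (a, b)) (v' := fun b => ω (a, b))
      (fun b _ => hasDerivAt_asymKernel a b) (fun b _ => h.hasDerivAt_primitive a b)]
    · simp [primitive]
    · exact (continuous_asymKernel'.comp (by fun_prop)).intervalIntegrable _ _
    · exact (h.continuous_slice a).intervalIntegrable _ _
  · refine Continuous.intervalIntegrable ?_ _ _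
    have : Continuous fun y => asymKernel y * primitive ω y :=
      continuous_asymKernel.mul h.continuous_primitive
    exact this.comp (by fun_prop : Continuous fun a : ℝ => (a, R))
  · refine Continuous.intervalIntegrable ?_ _ _
    refine intervalIntegral.continuous_parametric_intervalIntegral_of_continuous' ?_ _ _
    exact continuous_asymKernel'.mul h.continuous_primitive

/-- On the upper edge the kernel is at most 2/R², while the edge has length R. -/
lemma IsVorticity.tendsto_boundary {ω : ℝ × ℝ → ℝ} (h : IsVorticity ω) :
    Tendsto (fun R : ℝ => ∫ a in (0 : ℝ)..R, asymKernel (a, R) * primitive ω (a, R)) atTop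
      (𝓝 0) := by
  have hlim : Tendsto (fun R : ℝ => 4 * supNorm ω * R⁻¹) atTop (𝓝 0) := by
    simpa using tendsto_inv_atTop_zero.const_mul (4 * supNorm ω)
  refine squeeze_zero_norm' ?_ hlim
  filter_upwards [eventually_gt_atTop 0] with R hR
  have h0 := h.supNorm_nonneg
  have := intervalIntegral.norm_integral_le_of_norm_le_const (a := 0) (b := R)
    (C := 2 / R ^ 2 * (2 * supNorm ω))
    (f := fun a => asymKernel (a, R) * primitive ω (a, R)) ?_
  · refine this.trans (le_of_eq ?_)
    rw [sub_zero, abs_of_pos hR]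
    field_simp
    ring
  · intro a ha
    rw [uIoc_of_le hR.le] at ha
    rw [norm_mul, Real.norm_eq_abs, Real.norm_eq_abs]
    refine mul_le_mul ?_ (h.abs_primitive_le _) (abs_nonneg _) (by positivity)
    have ha0 := ha.1
    rw [asymKernel, abs_of_nonneg (by positivity)]
    simp only
    rw [div_le_div_iff₀ (pow_pos (asym_pos _ _) 2) (by positivity)]
    have h1 : R ^ 2 ≤ 1 + a ^ 2 + R ^ 2 := by nlinarith
    calc 2 * a * R * R ^ 2 ≤ 2 * R * R * R ^ 2 := by gcongr; exact ha.2
      _ = 2 * (R ^ 2) ^ 2 := by ring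
      _ ≤ _ := by gcongr

lemma IsVorticity.tendsto_asymKernel {ω : ℝ × ℝ → ℝ} (h : IsVorticity ω) :
    ∃ l, Tendsto (fun R => ∫ y in square R, asymKernel y * ω y) atTop (𝓝 l) := by
  refine ⟨_, (h.tendsto_boundary.sub
    (tendsto_setIntegral_square h.integrable_asymKernel'.integrableOn)).congr' ?_⟩
  filter_upwards [eventually_ge_atTop 0] with R hR
  exact (h.setIntegral_asymKernel hR).symm

lemma isQuad_of_mem {x : ℝ × ℝ} (hx : x ∈ quad) : IsQuad x := ⟨le_of_lt hx.1, le_of_lt hx.2⟩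

lemma abs_G₁_sub_zero_le {x y : ℝ × ℝ} (hx : IsQuad x) (hy : IsQuad y) (hy0 : y ≠ 0)
    (hxy : 2 * ‖x‖ ≤ ‖y‖) : |G₁ x y - G₁ 0 y| ≤ 160 / ‖y‖ ^ 3 * ‖x‖ := by
  have hr : 0 < ‖y‖ := norm_pos_iff.2 hy0
  have hfar : ∀ z ∈ Metric.closedBall (0 : ℝ × ℝ) ‖x‖, ‖y‖ / 2 ≤ ‖y - z‖ := by
    intro z hz
    rw [mem_closedBall_zero_iff] at hz
    have := norm_sub_norm_le y z
    linarith
  have hne : ∀ z ∈ Metric.closedBall (0 : ℝ × ℝ) ‖x‖, y ≠ z := by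
    intro z hz h
    have := hfar z hz
    rw [← h, sub_self, norm_zero] at this
    linarith
  -- The gradient bound is known only for poles in the closed quadrant, so the mean value inequality
  -- is used on a quarter of the ball, which contains both 0 and x.
  have hconv : Convex ℝ ((Ici 0 ×ˢ Ici 0 : Set (ℝ × ℝ)) ∩ Metric.closedBall 0 ‖x‖) :=
    ((convex_Ici 0).prod (convex_Ici 0)).inter (convex_closedBall _ _)
  have := hconv.norm_image_sub_le_of_norm_hasFDerivWithin_le (f := fun x => G₁ x y)
    (f' := fun z => DG₁ z y) (C := 160 / ‖y‖ ^ 3) (x := 0) (y := x)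
    (fun z hz => (hasFDerivAt_G₁_of_ne ⟨hz.1.1, hz.1.2⟩ hy (hne z hz.2)).hasFDerivWithinAt)
    (fun z hz => ?_) ⟨⟨le_refl (0 : ℝ), le_refl (0 : ℝ)⟩, by simp⟩
    ⟨⟨hx.1, hx.2⟩, by simp⟩
  · simpa using this
  · refine (norm_DG₁_le ⟨hz.1.1, hz.1.2⟩ hy (hne z hz.2)).trans ?_
    have h1 := hfar z hz.2
    calc 20 / (‖y - z‖ ^ 2 * max ‖y - z‖ z.1) ≤ 20 / ((‖y‖ / 2) ^ 2 * (‖y‖ / 2)) := by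
          gcongr
          exact h1.trans (le_max_left _ _)
      _ = _ := by field_simp; norm_num

lemma abs_G₁_zero_sub_asymKernel_le {y : ℝ × ℝ} (hy : IsQuad y) (hy0 : y ≠ 0) :
    |G₁ 0 y - asymKernel y| ≤ 2 / ‖y‖ ^ 4 := by
  have hr : 0 < ‖y‖ := norm_pos_iff.2 hy0
  have hs := norm_sq_le_sqNorm y
  have hs0 : 0 < sqNorm y := lt_of_lt_of_le (by positivity) hs
  have e : G₁ 0 y - asymKernel y =
      2 * y.1 * y.2 * (2 * sqNorm y + 1) / (sqNorm y ^ 2 * (1 + sqNorm y) ^ 2) := by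
    have h1 : G₁ 0 y = 2 * y.1 * y.2 / sqNorm y ^ 2 := by
      simp [G₁, G₁₁, G₁₂, tilde, bar, sqNorm]; ring
    have h2 : asymKernel y = 2 * y.1 * y.2 / (1 + sqNorm y) ^ 2 := by
      simp [asymKernel, sqNorm]; ring
    rw [h1, h2]
    field_simp
    ring
  have hy1 := hy.1
  have hy2 := hy.2
  have h12 : 2 * y.1 * y.2 ≤ sqNorm y := by rw [sqNorm]; nlinarith [sq_nonneg (y.1 - y.2)]
  rw [e, abs_of_nonneg (by positivity)]
  calc 2 * y.1 * y.2 * (2 * sqNorm y + 1) / (sqNorm y ^ 2 * (1 + sqNorm y) ^ 2)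
      ≤ sqNorm y * (2 * (1 + sqNorm y)) / (sqNorm y ^ 2 * (1 + sqNorm y) ^ 2) := by
        gcongr; linarith
    _ = 2 / (sqNorm y * (1 + sqNorm y)) := by field_simp
    _ ≤ 2 / (‖y‖ ^ 2 * ‖y‖ ^ 2) := by gcongr; linarith
    _ = _ := by ring

lemma abs_G₁_le_inv {x y : ℝ × ℝ} (hx : x ∈ quad) (hy : IsQuad y) (hxy : y ≠ x) :
    |G₁ x y| ≤ 2 / x.1 * ‖y - x‖ ^ (-1 : ℝ) := by
  have hx1 : 0 < x.1 := hx.1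
  have hr : 0 < ‖y - x‖ := norm_pos_iff.2 (sub_ne_zero.2 hxy)
  refine (abs_G₁_le (isQuad_of_mem hx) hy hxy).trans ?_
  rw [Real.rpow_neg_one]
  calc 2 / (‖y - x‖ * max ‖y - x‖ x.1) ≤ 2 / (‖y - x‖ * x.1) := by gcongr; exact le_max_right _ _
    _ = _ := by field_simp

lemma integrableOn_G₁_mul {x : ℝ × ℝ} (hx : x ∈ quad) {f : ℝ × ℝ → ℝ} (hf : Measurable f) {L : ℝ}
    (hL : ∀ y, |f y| ≤ L) (R : ℝ) :
    IntegrableOn (fun y => G₁ x y * f y) (quad ∩ Metric.ball x R) := by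
  rcases le_or_gt R 0 with hR | hR
  · simp [Metric.ball_eq_empty.2 hR]
  have hx1 : 0 < x.1 := hx.1
  refine (IntegrableOn.mono_set ((integrableOn_rpow_ball (p := -1) (by norm_num) hR x).const_mul
    (2 / x.1 * L)) inter_subset_right).mono' ((measurable_G₁ x).mul hf).aestronglyMeasurable ?_
  filter_upwards [ae_ne x _, self_mem_ae_restrict (measurableSet_quad.inter measurableSet_ball)]
    with y h1 h2
  rw [norm_mul, Real.norm_eq_abs, Real.norm_eq_abs]
  calc |G₁ x y| * |f y| ≤ 2 / x.1 * ‖y - x‖ ^ (-1 : ℝ) * L :=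
        mul_le_mul (abs_G₁_le_inv hx (isQuad_of_mem h2.1) h1) (hL y) (abs_nonneg _) (by positivity)
    _ = _ := by ring

lemma square_subset_ball (x : ℝ × ℝ) (R : ℝ) : square R ⊆ Metric.ball x (|R| + ‖x‖ + 1) := by
  intro y hy
  rw [mem_ball_iff_norm]
  have h1 : ‖y‖ ≤ |R| := by
    rw [Prod.norm_def, max_le_iff, Real.norm_eq_abs, Real.norm_eq_abs, abs_of_nonneg hy.1.1,
      abs_of_nonneg hy.2.1]
    exact ⟨hy.1.2.trans (le_abs_self R), hy.2.2.trans (le_abs_self R)⟩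
  have := norm_sub_le y x
  linarith

lemma integrableOn_G₁_square {x : ℝ × ℝ} (hx : x ∈ quad) {f : ℝ × ℝ → ℝ} (hf : Measurable f)
    {L : ℝ} (hL : ∀ y, |f y| ≤ L) (R : ℝ) :
    IntegrableOn (fun y => G₁ x y * f y) (square R) := by
  refine IntegrableOn.congr_set_ae ?_ (square_ae_eq R)
  refine (integrableOn_G₁_mul hx hf hL (|R| + ‖x‖ + 1)).mono_set fun y hy => ?_
  exact ⟨hy.2, square_subset_ball x R hy.1⟩

lemma integrableOn_G₁_sub_asymKernel {x : ℝ × ℝ} (hx : x ∈ quad) {f : ℝ × ℝ → ℝ}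
    (hf : Measurable f) {L : ℝ} (hL : ∀ y, |f y| ≤ L) :
    IntegrableOn (fun y => (G₁ x y - asymKernel y) * f y) quad := by
  -- Outside this ball ‖y‖ is at least 2‖x‖, 1 and ‖y - x‖/2, so the expansions in 1/‖y‖ apply and
  -- may be restated in ‖y - x‖.
  set R := 3 * ‖x‖ + 1 with hR
  have hR0 : 0 < R := by positivity
  have hm : Measurable fun y => (G₁ x y - asymKernel y) * f y :=
    ((measurable_G₁ x).sub continuous_asymKernel.measurable).mul hf
  rw [← inter_union_compl quad (Metric.ball x R)]
  refine IntegrableOn.union ?_ ?_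
  · have h1 := integrableOn_G₁_mul hx hf hL R
    have h2 : IntegrableOn (fun y => asymKernel y * f y) (quad ∩ Metric.ball x R) := by
      refine IntegrableOn.mono_set ?_ (inter_subset_right.trans Metric.ball_subset_closedBall)
      have hc : IntegrableOn asymKernel (Metric.closedBall x R) :=
        continuous_asymKernel.continuousOn.integrableOn_compact (isCompact_closedBall _ _)
      exact Integrable.mul_bdd (c := L) hc hf.aestronglyMeasurable (Eventually.of_forall hL)
    refine (h1.sub h2).congr (Eventually.of_forall fun y => ?_)
    simp only [Pi.sub_apply]; ring
  · have hi := (integrableOn_rpow_compl_ball (p := -3) (by norm_num) hR0 x).const_mul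
      ((160 * ‖x‖ + 2) * 8 * L)
    refine (IntegrableOn.mono_set hi inter_subset_right).mono' hm.aestronglyMeasurable ?_
    filter_upwards [self_mem_ae_restrict (measurableSet_quad.inter measurableSet_ball.compl)]
      with y hy
    have hq := isQuad_of_mem hy.1
    have hyR : R ≤ ‖y - x‖ := by
      have := hy.2
      rwa [mem_compl_iff, mem_ball_iff_norm, not_lt] at this
    have htri := norm_sub_le y x
    have hyx : 2 * ‖x‖ ≤ ‖y‖ := by linarith
    have hy1 : 1 ≤ ‖y‖ := by linarith [norm_nonneg x]
    have hy2 : ‖y - x‖ / 2 ≤ ‖y‖ := by linarith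
    have hyx0 : 0 < ‖y - x‖ := hR0.trans_le hyR
    have hy0 : y ≠ 0 := norm_pos_iff.1 (by linarith)
    have hL0 : 0 ≤ L := (abs_nonneg _).trans (hL y)
    rw [norm_mul, Real.norm_eq_abs, Real.norm_eq_abs, Real.rpow_neg (norm_nonneg _)]
    calc |G₁ x y - asymKernel y| * |f y| ≤ (160 / ‖y‖ ^ 3 * ‖x‖ + 2 / ‖y‖ ^ 3) * L := by
          gcongr
          · calc _ ≤ |G₁ x y - G₁ 0 y| + |G₁ 0 y - asymKernel y| := abs_sub_le _ _ _
              _ ≤ 160 / ‖y‖ ^ 3 * ‖x‖ + 2 / ‖y‖ ^ 4 := add_le_add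
                (abs_G₁_sub_zero_le (isQuad_of_mem hx) hq hy0 hyx)
                (abs_G₁_zero_sub_asymKernel_le hq hy0)
              _ ≤ _ := by gcongr; norm_num
          · exact hL y
      _ = (160 * ‖x‖ + 2) * L / ‖y‖ ^ 3 := by ring
      _ ≤ (160 * ‖x‖ + 2) * L / (‖y - x‖ / 2) ^ 3 := by gcongr
      _ = (160 * ‖x‖ + 2) * 8 * L * (‖y - x‖ ^ 3)⁻¹ := by field_simp; ring
      _ = _ := by norm_cast

lemma outer_eq {K : ℝ × ℝ → ℝ × ℝ → ℝ} {ω : ℝ × ℝ → ℝ} {x : ℝ × ℝ} {R : ℝ} (hR : 1 ≤ R)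
    (hi : IntegrableOn (fun y => K x y * ω y) (square R)) :
    outer K ω x R = c₀ * (∫ y in square R, K x y * ω y) - c₀ * ∫ y in square 1, K x y * ω y := by
  rw [outer, setIntegral_sdiff (measurableSet_square 1) hi, mul_sub]
  exact prod_mono (Icc_subset_Icc_right hR) (Icc_subset_Icc_right hR)

lemma IsVorticity.potential_G₁ {ω : ℝ × ℝ → ℝ} (h : IsVorticity ω) {x : ℝ × ℝ} (hx : x ∈ quad) :
    PotentialExists G₁ ω x ∧
      Tendsto (fun R => c₀ * ∫ y in square R, G₁ x y * ω y) atTop (𝓝 (Q₁ ω x)) := by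
  have hint : ∀ R, IntegrableOn (fun y => G₁ x y * ω y) (square R) :=
    integrableOn_G₁_square hx h.continuous.measurable h.abs_le
  obtain ⟨l, hl⟩ := h.tendsto_asymKernel
  have hd := integrableOn_G₁_sub_asymKernel hx h.continuous.measurable h.abs_le
  have hsum := ((tendsto_setIntegral_square hd).add hl).const_mul c₀
  have hlim : Tendsto (fun R => c₀ * ∫ y in square R, G₁ x y * ω y) atTop
      (𝓝 (c₀ * ((∫ y in quad, (G₁ x y - asymKernel y) * ω y) + l))) := by
    refine hsum.congr fun R => ?_
    rw [← integral_add (g := fun y => asymKernel y * ω y) (integrableOn_square_of_quad hd R)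
      ((continuous_asymKernel.mul h.continuous).continuousOn.integrableOn_compact
        (isCompact_square R))]
    congr 1
    refine integral_congr_ae (Eventually.of_forall fun y => ?_)
    simp only; ring
  have hout : Tendsto (outer G₁ ω x) atTop
      (𝓝 (c₀ * ((∫ y in quad, (G₁ x y - asymKernel y) * ω y) + l) -
        c₀ * ∫ y in square 1, G₁ x y * ω y)) := by
    refine (hlim.sub_const _).congr' ?_
    filter_upwards [eventually_ge_atTop 1] with R hR
    exact (outer_eq hR (hint R)).symm
  refine ⟨⟨hint, _, hout⟩, ?_⟩
  rw [Q₁, potential, hout.limUnder_eq, add_sub_cancel]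
  exact hlim

/-- The limit over squares disappears from increments of `Q₁`, which become absolutely convergent
integrals over the quadrant; differentiation can then ignore it. -/
lemma IsVorticity.Q₁_sub {ω : ℝ × ℝ → ℝ} (h : IsVorticity ω) {x x₀ : ℝ × ℝ} (hx : x ∈ quad)
    (hx₀ : x₀ ∈ quad) (hi : IntegrableOn (fun y => (G₁ x y - G₁ x₀ y) * ω y) quad) :
    Q₁ ω x = Q₁ ω x₀ + c₀ * ∫ y in quad, (G₁ x y - G₁ x₀ y) * ω y := by
  have h1 := (h.potential_G₁ hx).2
  have h2 := (h.potential_G₁ hx₀).2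
  have h3 := (tendsto_setIntegral_square hi).const_mul c₀
  refine tendsto_nhds_unique h1 ((h2.add h3).congr fun R => ?_)
  rw [← mul_add, ← integral_add ((h.potential_G₁ hx₀).1.1 R) (integrableOn_square_of_quad hi R)]
  congr 1
  refine integral_congr_ae (Eventually.of_forall fun y => ?_)
  simp only; ring

/-! ### Differentiability of `Q₁`. -/

lemma ball_subset_quad {x₀ : ℝ × ℝ} {x : ℝ × ℝ}
    (hx : x ∈ Metric.ball x₀ (min x₀.1 x₀.2 / 2)) : x₀.1 / 2 < x.1 ∧ x₀.2 / 2 < x.2 := by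
  rw [mem_ball_iff_norm] at hx
  have e1 := (norm_fst_le (x - x₀)).trans_lt hx
  have e2 := (norm_snd_le (x - x₀)).trans_lt hx
  rw [Real.norm_eq_abs, abs_lt] at e1 e2
  simp only [Prod.fst_sub, Prod.snd_sub] at e1 e2
  have := min_le_left x₀.1 x₀.2
  have := min_le_right x₀.1 x₀.2
  constructor <;> linarith

lemma singularKernel_G₁ {x₀ : ℝ × ℝ} (hx₀ : x₀ ∈ quad) :
    SingularKernel quad G₁ DG₁ x₀ (min x₀.1 x₀.2 / 2) (20 * (1 + 2 / x₀.1)) := by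
  have h1 : 0 < x₀.1 := hx₀.1
  have h2 : 0 < x₀.2 := hx₀.2
  have hq : ∀ x ∈ Metric.ball x₀ (min x₀.1 x₀.2 / 2), x ∈ quad := fun x hx =>
    ⟨lt_trans (by positivity) (ball_subset_quad hx).1, lt_trans (by positivity) (ball_subset_quad hx).2⟩
  refine ⟨measurableSet_quad, by positivity, by positivity, fun x hx y hy hxy => ?_,
    fun x hx y hy hxy => ?_, fun x hx y hy hxy => ?_, measurable_G₁, measurable_DG₁ x₀⟩
  · exact hasFDerivAt_G₁_of_ne (isQuad_of_mem (hq x hx)) (isQuad_of_mem hy) hxy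
  · refine (abs_G₁_le_inv (hq x hx) (isQuad_of_mem hy) hxy).trans ?_
    rw [Real.rpow_neg_one, ← div_eq_mul_inv]
    gcongr
    calc 2 / x.1 ≤ 2 / (x₀.1 / 2) := by
          gcongr; exact (ball_subset_quad hx).1.le
      _ = 2 * (2 / x₀.1) := by field_simp
      _ ≤ _ := by
        have : 0 < 2 / x₀.1 := by positivity
        linarith
  · refine (norm_DG₁_le (isQuad_of_mem (hq x hx)) (isQuad_of_mem hy) hxy).trans ?_
    have hr : 0 < ‖y - x‖ := norm_pos_iff.2 (sub_ne_zero.2 hxy)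
    have hm : 0 < max ‖y - x‖ x.1 := hr.trans_le (le_max_left _ _)
    rw [div_le_div_iff₀ (by positivity) (by positivity)]
    -- On the chosen ball x₁ exceeds half the first coordinate of x₀, so the maximum cannot
    -- degenerate and absorbs the constant 1.
    have key : 1 + ‖y - x‖ ≤ (1 + 2 / x₀.1) * max ‖y - x‖ x.1 := by
      have e1 : 1 ≤ 2 / x₀.1 * max ‖y - x‖ x.1 := by
        rw [div_mul_eq_mul_div, le_div_iff₀ h1]
        have := le_max_right ‖y - x‖ x.1
        have := (ball_subset_quad hx).1
        linarith
      have := le_max_left ‖y - x‖ x.1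
      linarith
    nlinarith [mul_le_mul_of_nonneg_left key (by positivity : 0 ≤ 20 * ‖y - x‖ ^ 2)]

/-- The density from which a multiple of a cut-off function is subtracted so that it vanishes
at `x₀`. -/
def reduced (ω : ℝ × ℝ → ℝ) (x₀ y : ℝ × ℝ) : ℝ :=
  ω y - ω x₀ * cutoffAt x₀ (min x₀.1 x₀.2 / 2) y

namespace IsVorticity

variable {ω : ℝ × ℝ → ℝ}

lemma measurable_reduced (h : IsVorticity ω) (x₀ : ℝ × ℝ) : Measurable (reduced ω x₀) :=
  h.continuous.measurable.sub ((measurable_cutoffAt _ _).const_mul _)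

lemma abs_reduced_le (h : IsVorticity ω) (x₀ y : ℝ × ℝ) : |reduced ω x₀ y| ≤ 2 * supNorm ω := by
  have h1 := h.abs_le y
  have h2 : |ω x₀ * cutoffAt x₀ (min x₀.1 x₀.2 / 2) y| ≤ supNorm ω * 1 := by
    rw [abs_mul, abs_of_nonneg (cutoffAt_nonneg _ _ _)]
    exact mul_le_mul (h.abs_le x₀) (cutoffAt_le_one _ _ _) (cutoffAt_nonneg _ _ _) h.supNorm_nonneg
  exact (abs_sub _ _).trans (by linarith)

/-- Near x₀ the cut-off equals 1 and differentiability of ω gives the linear bound; elsewhere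
boundedness does. L may depend on ω and x₀, since it serves only to justify differentiation and
enters no final constant. -/
lemma exists_reduced_lipschitz (h : IsVorticity ω) {x₀ : ℝ × ℝ} (hx₀ : x₀ ∈ quad) :
    ∃ L, 0 ≤ L ∧ (∀ y, |reduced ω x₀ y| ≤ L) ∧ ∀ y, |reduced ω x₀ y| ≤ L * ‖y - x₀‖ := by
  have h1 : 0 < x₀.1 := hx₀.1
  have h2 : 0 < x₀.2 := hx₀.2
  have hd : DifferentiableAt ℝ ω x₀ := h.contDiff.differentiable (by norm_num) x₀
  obtain ⟨c, hc⟩ := hd.isBigO_sub.bound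
  obtain ⟨δ, hδ, hball⟩ := Metric.eventually_nhds_iff_ball.1 hc
  set ρ := min x₀.1 x₀.2 / 2 with hρ
  have hρ0 : 0 < ρ := by positivity
  set η := min δ (ρ / 2) with hη
  have hη0 : 0 < η := by positivity
  have hN := h.supNorm_nonneg
  refine ⟨max (2 * supNorm ω) (max c (2 * supNorm ω / η)), le_max_of_le_left (by positivity),
    fun y => (h.abs_reduced_le x₀ y).trans (le_max_left _ _), fun y => ?_⟩
  by_cases hy : ‖y - x₀‖ < η
  · have e : reduced ω x₀ y = ω y - ω x₀ := by
      rw [reduced, cutoffAt_eq_one hρ0 (hy.le.trans (min_le_right _ _)), mul_one]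
    rw [e]
    refine (hball y (mem_ball_iff_norm.2 (hy.trans_le (min_le_left _ _)))).trans ?_
    gcongr
    exact (le_max_left _ _).trans (le_max_right _ _)
  · rw [not_lt] at hy
    calc |reduced ω x₀ y| ≤ 2 * supNorm ω := h.abs_reduced_le x₀ y
      _ = 2 * supNorm ω / η * η := by field_simp
      _ ≤ _ := by
        gcongr
        exact (le_max_right _ _).trans (le_max_right _ _)

/-- Split ω into the reduced density plus ω(x₀) times the bump. The first part vanishes at x₀ and is
differentiated under the integral, the second through its explicit potential. -/
lemma hasFDerivAt_Q₁ (h : IsVorticity ω) {x₀ : ℝ × ℝ} (hx₀ : x₀ ∈ quad) {F' : ℝ × ℝ →L[ℝ] ℝ}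
    (hF : HasFDerivAt
      (fun x => ∫ y in quad, G₁ x y * cutoffAt x₀ (min x₀.1 x₀.2 / 2) y) F' x₀) :
    IntegrableOn (fun y => reduced ω x₀ y • DG₁ x₀ y) quad ∧
    HasFDerivAt (Q₁ ω)
      (c₀ • ((∫ y in quad, reduced ω x₀ y • DG₁ x₀ y) + ω x₀ • F')) x₀ := by
  obtain ⟨L, hL0, hL, hL'⟩ := h.exists_reduced_lipschitz hx₀
  have h1 : 0 < x₀.1 := hx₀.1
  have h2 : 0 < x₀.2 := hx₀.2
  have K := singularKernel_G₁ hx₀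
  have hm := h.measurable_reduced x₀
  refine ⟨K.integrableOn_smul hm (fun y _ => hL y) (fun y _ => hL' y), ?_⟩
  have hd := K.hasFDerivAt_integral hm (fun y _ => hL y) (fun y _ => hL' y) hL0
  have hs := ((hd.add ((hF.sub_const
    (∫ y in quad, G₁ x₀ y * cutoffAt x₀ (min x₀.1 x₀.2 / 2) y)).const_smul (ω x₀))).const_smul
      c₀).const_add (Q₁ ω x₀)
  refine hs.congr_of_eventuallyEq ?_
  filter_upwards [Metric.ball_mem_nhds x₀ K.eps_pos] with x hx
  have hxq : x ∈ quad :=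
    ⟨lt_trans (by positivity) (ball_subset_quad hx).1, lt_trans (by positivity) (ball_subset_quad hx).2⟩
  rw [h.Q₁_sub hxq hx₀ (K.integrableOn_sub_mul hx h.continuous.measurable fun y _ => h.abs_le y)]
  have hρ0 : 0 < min x₀.1 x₀.2 / 2 := by positivity
  have ic := (integrable_G₁_mul_cutoffAt (x₀ := x₀) hρ0 (ne_of_gt hxq.1)).integrableOn (s := quad)
  have ic₀ := (integrable_G₁_mul_cutoffAt (x₀ := x₀) hρ0 h1.ne').integrableOn (s := quad)
  have ir := K.integrableOn_sub_mul hx hm fun y _ => hL y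
  have key : ∫ y in quad, (G₁ x y - G₁ x₀ y) * ω y =
      (∫ y in quad, (G₁ x y - G₁ x₀ y) * reduced ω x₀ y) +
        ω x₀ * ((∫ y in quad, G₁ x y * cutoffAt x₀ (min x₀.1 x₀.2 / 2) y) -
          ∫ y in quad, G₁ x₀ y * cutoffAt x₀ (min x₀.1 x₀.2 / 2) y) := by
    rw [← integral_sub ic ic₀, ← integral_const_mul (ω x₀),
      ← integral_add (g := fun y => ω x₀ * (G₁ x y * cutoffAt x₀ (min x₀.1 x₀.2 / 2) y -
        G₁ x₀ y * cutoffAt x₀ (min x₀.1 x₀.2 / 2) y)) ir ((ic.sub ic₀).const_mul (ω x₀))]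
    refine integral_congr_ae (Eventually.of_forall fun y => ?_)
    simp only [reduced]
    ring
  rw [key]
  rfl

end IsVorticity

/-! ### Quantitative estimates of the derivatives of `Q₁`. -/

lemma min_one_le_rpow {t a : ℝ} (ht : 0 < t) (ha0 : 0 ≤ a) (ha1 : a ≤ 1) : min 1 t ≤ t ^ a := by
  rcases le_total t 1 with h | h
  · rw [min_eq_right h]
    calc t = t ^ (1 : ℝ) := (Real.rpow_one t).symm
      _ ≤ t ^ a := Real.rpow_le_rpow_of_exponent_ge ht h ha1
  · rw [min_eq_left h]
    exact Real.one_le_rpow h ha0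

lemma div_max_le_rpow {r s a : ℝ} (hr : 0 < r) (hs : 0 < s) (ha0 : 0 ≤ a) (ha1 : a ≤ 1) :
    s / max r s ≤ (s / r) ^ a := by
  refine le_trans (le_min ?_ ?_) (min_one_le_rpow (by positivity) ha0 ha1)
  · exact (div_le_one (lt_max_of_lt_left hr)).2 (le_max_right _ _)
  · gcongr; exact le_max_left _ _

lemma div_rpow_mul_eq {r s t a b : ℝ} (hr : 0 < r) (hs : 0 < s) (ht : 0 < t) :
    (s / r) ^ a * (t / r) ^ b / r ^ 2 = s ^ a * t ^ b * r ^ (-2 - a - b) := by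
  rw [Real.div_rpow hs.le hr.le, Real.div_rpow ht.le hr.le, Real.rpow_sub hr, Real.rpow_sub hr,
    Real.rpow_neg hr.le, Real.rpow_two]
  field_simp

/-- The exponent 0 on x₂ and the generous constant 40 give this bound the same shape as the one for
`g₂`, so that one integral estimate serves both. -/
lemma mul_abs_g₁_le {x y : ℝ × ℝ} (hx : x ∈ quad) (hy : y ∈ quad) (hxy : y ≠ x) {a : ℝ}
    (ha0 : 0 ≤ a) (ha1 : a ≤ 1) :
    |x.1 * g₁ x y| ≤ 40 * (x.1 ^ a * x.2 ^ (0 : ℝ) * ‖y - x‖ ^ (-2 - a - 0)) := by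
  have h1 : 0 < x.1 := hx.1
  have hr : 0 < ‖y - x‖ := norm_pos_iff.2 (sub_ne_zero.2 hxy)
  have hm : 0 < max ‖y - x‖ x.1 := lt_max_of_lt_left hr
  rw [← div_rpow_mul_eq hr h1 hx.2, abs_mul, abs_of_pos h1, Real.rpow_zero, mul_one]
  calc x.1 * |g₁ x y| ≤ x.1 * (10 / (‖y - x‖ ^ 2 * max ‖y - x‖ x.1)) := by
        gcongr; exact abs_g₁_le (isQuad_of_mem hx) (isQuad_of_mem hy) hxy
    _ = 10 * ((x.1 / max ‖y - x‖ x.1) / ‖y - x‖ ^ 2) := by field_simp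
    _ ≤ 40 * ((x.1 / ‖y - x‖) ^ a / ‖y - x‖ ^ 2) := by
        gcongr
        · norm_num
        · exact div_max_le_rpow hr h1 ha0 ha1

/-- The plain bound and the one improved by oddness in the second variable together give the factor
min(1, x₂/r), which is interpolated independently of the factor in x₁. -/
lemma mul_abs_g₂_le {x y : ℝ × ℝ} (hx : x ∈ quad) (hy : y ∈ quad) (hxy : y ≠ x) {a b : ℝ}
    (ha0 : 0 ≤ a) (ha1 : a ≤ 1) (hb0 : 0 ≤ b) (hb1 : b ≤ 1) :
    |x.1 * g₂ x y| ≤ 40 * (x.1 ^ a * x.2 ^ b * ‖y - x‖ ^ (-2 - a - b)) := by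
  have h1 : 0 < x.1 := hx.1
  have h2 : 0 < x.2 := hx.2
  have hr : 0 < ‖y - x‖ := norm_pos_iff.2 (sub_ne_zero.2 hxy)
  have hm : 0 < max ‖y - x‖ x.1 := lt_max_of_lt_left hr
  rw [← div_rpow_mul_eq hr h1 hx.2, abs_mul, abs_of_pos h1]
  have e1 : x.1 * |g₂ x y| ≤ 40 * (x.1 / max ‖y - x‖ x.1 * 1 / ‖y - x‖ ^ 2) := by
    calc x.1 * |g₂ x y| ≤ x.1 * (10 / (‖y - x‖ ^ 2 * max ‖y - x‖ x.1)) := by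
          gcongr; exact abs_g₂_le (isQuad_of_mem hx) (isQuad_of_mem hy) hxy
      _ = 10 * (x.1 / max ‖y - x‖ x.1 * 1 / ‖y - x‖ ^ 2) := by field_simp
      _ ≤ _ := by gcongr; norm_num
  have e2 : x.1 * |g₂ x y| ≤ 40 * (x.1 / max ‖y - x‖ x.1 * (x.2 / ‖y - x‖) / ‖y - x‖ ^ 2) := by
    calc x.1 * |g₂ x y| ≤ x.1 * (40 * x.2 / (‖y - x‖ ^ 3 * max ‖y - x‖ x.1)) := by
          gcongr; exact abs_g₂_le' (isQuad_of_mem hx) (isQuad_of_mem hy) hxy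
      _ = _ := by field_simp
  have e3 : x.1 * |g₂ x y| ≤
      40 * (x.1 / max ‖y - x‖ x.1 * min 1 (x.2 / ‖y - x‖) / ‖y - x‖ ^ 2) := by
    rcases min_cases 1 (x.2 / ‖y - x‖) with h | h <;> rw [h.1]
    exacts [e1, e2]
  refine e3.trans ?_
  gcongr
  · exact div_max_le_rpow hr h1 ha0 ha1
  · exact min_one_le_rpow (by positivity) hb0 hb1

/-- The estimate of the singular integral for a density that is Hölder continuous near `x` and
bounded. -/
lemma abs_setIntegral_le {x : ℝ × ℝ} (hx : x ∈ quad) {d p a b H N : ℝ} (hd : 0 < d)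
    (hp0 : 0 < p) (hp1 : p < 1) (hab : 0 < a + b) (hN : 0 ≤ N)
    (hH : 0 ≤ H) {f k : ℝ × ℝ → ℝ}
    (hk : ∀ y ∈ quad, y ≠ x → |k y| ≤ 10 * (x.1 / (‖y - x‖ ^ 2 * max ‖y - x‖ x.1)))
    (hk' : ∀ y ∈ quad, y ≠ x → |k y| ≤ 40 * (x.1 ^ a * x.2 ^ b * ‖y - x‖ ^ (-2 - a - b)))
    (hf : ∀ y ∈ quad, ‖y - x‖ < d → |f y| ≤ H * ‖y - x‖ ^ p) (hf' : ∀ y ∈ quad, |f y| ≤ N) :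
    |∫ y in quad, f y * k y| ≤ 80 * H * x.1 ^ p * (1 / p + 1 / (1 - p)) +
      320 * N / (a + b) * (x.1 ^ a * x.2 ^ b * d ^ (-(a + b))) := by
  have h1 : 0 < x.1 := hx.1
  have h2 : 0 < x.2 := hx.2
  have i1 : Integrable ((Metric.ball x x.1).indicator fun y => ‖y - x‖ ^ (p - 2)) :=
    (integrable_indicator_iff measurableSet_ball).2 (integrableOn_rpow_ball (by linarith) h1 x)
  have i2 : Integrable ((Metric.ball x x.1)ᶜ.indicator fun y => ‖y - x‖ ^ (p - 3)) :=
    (integrable_indicator_iff measurableSet_ball.compl).2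
      (integrableOn_rpow_compl_ball (by linarith) h1 x)
  have i3 : Integrable ((Metric.ball x d)ᶜ.indicator fun y => ‖y - x‖ ^ (-2 - a - b)) :=
    (integrable_indicator_iff measurableSet_ball.compl).2
      (integrableOn_rpow_compl_ball (by linarith) hd x)
  -- The three summands cover r < x₁ and r ≥ x₁ within r < d, and r ≥ d. Overlaps are harmless as
  -- all are nonnegative. The first needs p > 0, the second p < 1, the third a + b > 0.
  have hmaj := ((i1.const_mul (10 * H)).add (i2.const_mul (10 * H * x.1))).add
    (i3.const_mul (40 * N * (x.1 ^ a * x.2 ^ b)))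
  have n1 : ∀ y, 0 ≤ (Metric.ball x x.1).indicator (fun y => ‖y - x‖ ^ (p - 2)) y :=
    fun y => indicator_nonneg (fun y _ => by positivity) y
  have n2 : ∀ y, 0 ≤ (Metric.ball x x.1)ᶜ.indicator (fun y => ‖y - x‖ ^ (p - 3)) y :=
    fun y => indicator_nonneg (fun y _ => by positivity) y
  have n3 : ∀ y, 0 ≤ (Metric.ball x d)ᶜ.indicator (fun y => ‖y - x‖ ^ (-2 - a - b)) y :=
    fun y => indicator_nonneg (fun y _ => by positivity) y
  calc |∫ y in quad, f y * k y| ≤ ∫ y in quad, |f y * k y| := abs_integral_le_integral_abs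
    _ ≤ ∫ y in quad, (10 * H * (Metric.ball x x.1).indicator (fun y => ‖y - x‖ ^ (p - 2)) y +
          10 * H * x.1 * (Metric.ball x x.1)ᶜ.indicator (fun y => ‖y - x‖ ^ (p - 3)) y +
          40 * N * (x.1 ^ a * x.2 ^ b) *
            (Metric.ball x d)ᶜ.indicator (fun y => ‖y - x‖ ^ (-2 - a - b)) y) := by
        refine integral_mono_of_nonneg (Eventually.of_forall fun y => abs_nonneg _)
          hmaj.integrableOn ?_
        filter_upwards [ae_ne x _, self_mem_ae_restrict measurableSet_quad] with y hyx hy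
        have hr : 0 < ‖y - x‖ := norm_pos_iff.2 (sub_ne_zero.2 hyx)
        have t1 := mul_nonneg (by positivity : 0 ≤ 10 * H) (n1 y)
        have t2 := mul_nonneg (by positivity : 0 ≤ 10 * H * x.1) (n2 y)
        have t3 := mul_nonneg (by positivity : 0 ≤ 40 * N * (x.1 ^ a * x.2 ^ b)) (n3 y)
        simp only [abs_mul]
        by_cases hyd : ‖y - x‖ < d
        · have hm : 0 < max ‖y - x‖ x.1 := lt_max_of_lt_left hr
          have e : |f y| * |k y| ≤
              H * ‖y - x‖ ^ p * (10 * (x.1 / (‖y - x‖ ^ 2 * max ‖y - x‖ x.1))) :=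
            mul_le_mul (hf y hy hyd) (hk y hy hyx) (abs_nonneg _) (by positivity)
          by_cases hy1 : ‖y - x‖ < x.1
          · rw [indicator_of_mem (mem_ball_iff_norm.2 hy1)] at t1 ⊢
            have : H * ‖y - x‖ ^ p * (10 * (x.1 / (‖y - x‖ ^ 2 * max ‖y - x‖ x.1))) =
                10 * H * ‖y - x‖ ^ (p - 2) := by
              rw [max_eq_right hy1.le, Real.rpow_sub hr, Real.rpow_two]
              field_simp
            linarith
          · rw [indicator_of_mem (s := (Metric.ball x x.1)ᶜ)
              (by rwa [mem_compl_iff, mem_ball_iff_norm])] at t2 ⊢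
            rw [not_lt] at hy1
            have : H * ‖y - x‖ ^ p * (10 * (x.1 / (‖y - x‖ ^ 2 * max ‖y - x‖ x.1))) =
                10 * H * x.1 * ‖y - x‖ ^ (p - 3) := by
              rw [max_eq_left hy1, Real.rpow_sub hr,
                show (3 : ℝ) = ((3 : ℕ) : ℝ) by norm_num, Real.rpow_natCast]
              field_simp
            linarith
        · rw [indicator_of_mem (s := (Metric.ball x d)ᶜ)
            (by rwa [mem_compl_iff, mem_ball_iff_norm])]
          have e : |f y| * |k y| ≤ N * (40 * (x.1 ^ a * x.2 ^ b * ‖y - x‖ ^ (-2 - a - b))) :=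
            mul_le_mul (hf' y hy) (hk' y hy hyx) (abs_nonneg _) hN
          linarith
    _ ≤ ∫ y, (10 * H * (Metric.ball x x.1).indicator (fun y => ‖y - x‖ ^ (p - 2)) y +
          10 * H * x.1 * (Metric.ball x x.1)ᶜ.indicator (fun y => ‖y - x‖ ^ (p - 3)) y +
          40 * N * (x.1 ^ a * x.2 ^ b) *
            (Metric.ball x d)ᶜ.indicator (fun y => ‖y - x‖ ^ (-2 - a - b)) y) := by
        refine setIntegral_le_integral hmaj (Eventually.of_forall fun y => ?_)
        have t1 := mul_nonneg (by positivity : 0 ≤ 10 * H) (n1 y)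
        have t2 := mul_nonneg (by positivity : 0 ≤ 10 * H * x.1) (n2 y)
        have t3 := mul_nonneg (by positivity : 0 ≤ 40 * N * (x.1 ^ a * x.2 ^ b)) (n3 y)
        exact add_nonneg (add_nonneg t1 t2) t3
    _ = 10 * H * (8 * (x.1 ^ (p - 2 + 2) / (p - 2 + 2))) +
          10 * H * x.1 * (8 * (x.1 ^ (p - 3 + 2) / (-(p - 3) - 2))) +
          40 * N * (x.1 ^ a * x.2 ^ b) *
            (8 * (d ^ (-2 - a - b + 2) / (-(-2 - a - b) - 2))) := by
        rw [integral_add (f := fun y =>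
            10 * H * (Metric.ball x x.1).indicator (fun y => ‖y - x‖ ^ (p - 2)) y +
            10 * H * x.1 * (Metric.ball x x.1)ᶜ.indicator (fun y => ‖y - x‖ ^ (p - 3)) y)
          ((i1.const_mul (10 * H)).add (i2.const_mul (10 * H * x.1)))
          (i3.const_mul (40 * N * (x.1 ^ a * x.2 ^ b))), integral_add (i1.const_mul (10 * H))
          (i2.const_mul (10 * H * x.1)), integral_const_mul, integral_const_mul,
          integral_const_mul, integral_indicator measurableSet_ball,
          integral_indicator measurableSet_ball.compl,
          integral_indicator measurableSet_ball.compl,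
          integral_rpow_ball (by linarith) h1, integral_rpow_compl_ball (by linarith) h1,
          integral_rpow_compl_ball (by linarith) hd]
    _ = _ := by
        have e1 : p - 2 + 2 = p := by ring
        have e2 : p - 3 + 2 = p - 1 := by ring
        have e3 : -(p - 3) - 2 = 1 - p := by ring
        have e4 : -2 - a - b + 2 = -(a + b) := by ring
        have e5 : -(-2 - a - b) - 2 = a + b := by ring
        rw [e1, e2, e3, e4, e5, Real.rpow_sub_one h1.ne']
        have : 1 - p ≠ 0 := by linarith
        field_simp
        ring

/-- Where the cut-off may differ from 1, min(x₁, x₂) < 4r. There the smallness of ω(x) near the axes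
gives |ω(x)| ≤ H(4r)^p ≤ 4H r^p, which joins the Hölder bound to make 5. -/
lemma abs_reduced_holder {ω : ℝ × ℝ → ℝ} {x : ℝ × ℝ} (hx : x ∈ quad) {H p d : ℝ} (hH : 0 ≤ H)
    (hp0 : 0 < p) (hp1 : p < 1)
    (hh : ∀ y ∈ quad, ‖y - x‖ < d → |ω y - ω x| ≤ H * ‖y - x‖ ^ p)
    (hx1 : |ω x| ≤ H * x.1 ^ p) (hx2 : |ω x| ≤ H * x.2 ^ p) {y : ℝ × ℝ} (hy : y ∈ quad)
    (hyd : ‖y - x‖ < d) : |reduced ω x y| ≤ 5 * H * ‖y - x‖ ^ p := by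
  have h1 : 0 < x.1 := hx.1
  have h2 : 0 < x.2 := hx.2
  have hρ0 : 0 < min x.1 x.2 / 2 := by positivity
  have hbase := hh y hy hyd
  have hpos : 0 ≤ H * ‖y - x‖ ^ p := by positivity
  by_cases hnear : ‖y - x‖ ≤ min x.1 x.2 / 2 / 2
  · rw [reduced, cutoffAt_eq_one hρ0 hnear, mul_one]
    linarith
  · rw [not_le] at hnear
    have hωx : |ω x| ≤ 4 * (H * ‖y - x‖ ^ p) := by
      calc |ω x| ≤ H * (min x.1 x.2) ^ p := by
            rcases min_cases x.1 x.2 with h | h <;> rw [h.1]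
            exacts [hx1, hx2]
        _ ≤ H * (4 * ‖y - x‖) ^ p := by gcongr; linarith
        _ = 4 ^ p * (H * ‖y - x‖ ^ p) := by
            rw [Real.mul_rpow (by norm_num) (norm_nonneg _)]; ring
        _ ≤ 4 * (H * ‖y - x‖ ^ p) := by
            gcongr
            calc (4 : ℝ) ^ p ≤ 4 ^ (1 : ℝ) := Real.rpow_le_rpow_of_exponent_le (by norm_num) hp1.le
              _ = 4 := Real.rpow_one 4
    have c0 := cutoffAt_nonneg x (min x.1 x.2 / 2) y
    have c1 := cutoffAt_le_one x (min x.1 x.2 / 2) y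
    have e : reduced ω x y = (ω y - ω x) + ω x * (1 - cutoffAt x (min x.1 x.2 / 2) y) := by
      rw [reduced]; ring
    rw [e]
    refine (abs_add_le _ _).trans ?_
    have : |ω x * (1 - cutoffAt x (min x.1 x.2 / 2) y)| ≤ |ω x| * 1 := by
      rw [abs_mul, abs_of_nonneg (by linarith : 0 ≤ 1 - cutoffAt x (min x.1 x.2 / 2) y)]
      gcongr; linarith
    linarith

lemma partial₁_eq {f : ℝ × ℝ → ℝ} {f' : ℝ × ℝ →L[ℝ] ℝ} {x : ℝ × ℝ} (h : HasFDerivAt f f' x) :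
    partial₁ f x = f' (1, 0) :=
  (h.comp_hasDerivAt x.1 ((hasDerivAt_id x.1).prodMk (hasDerivAt_const x.1 x.2))).deriv

lemma partial₂_eq {f : ℝ × ℝ → ℝ} {f' : ℝ × ℝ →L[ℝ] ℝ} {x : ℝ × ℝ} (h : HasFDerivAt f f' x) :
    partial₂ f x = f' (0, 1) :=
  (h.comp_hasDerivAt x.2 ((hasDerivAt_const x.2 x.1).prodMk (hasDerivAt_id x.2))).deriv

lemma c₀_pos : 0 < c₀ := by unfold c₀; positivity

lemma IsVorticity.differentiableAt_Q₁ {ω : ℝ × ℝ → ℝ} (h : IsVorticity ω) {x : ℝ × ℝ}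
    (hx : x ∈ quad) : DifferentiableAt ℝ (Q₁ ω) x := by
  obtain ⟨B, -, hB⟩ := exists_cutoffAt_bound
  have h1 : 0 < x.1 := hx.1
  have h2 : 0 < x.2 := hx.2
  have m1 := min_le_left x.1 x.2
  have m2 := min_le_right x.1 x.2
  obtain ⟨F', hF, -⟩ := hB x (min x.1 x.2 / 2) (by positivity) (by linarith) (by linarith)
  exact (h.hasFDerivAt_Q₁ hx hF).2.differentiableAt

/-- Estimates of the derivatives of `Q₁` for vorticities with a Hölder bound near `x`. -/
theorem exists_deriv_Q₁_bound {p : ℝ} (hp0 : 0 < p) (hp1 : p < 1) : ∃ C : ℝ, 0 < C ∧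
    ∀ (ω : ℝ × ℝ → ℝ), IsVorticity ω → ∀ x ∈ quad, ∀ d H : ℝ, 0 < d → 0 ≤ H →
      (∀ y ∈ quad, ‖y - x‖ < d → |ω y - ω x| ≤ H * ‖y - x‖ ^ p) →
      |ω x| ≤ H * x.1 ^ p → |ω x| ≤ H * x.2 ^ p → ∀ a b : ℝ, 0 ≤ a → a ≤ 1 → 0 ≤ b → b ≤ 1 →
      (0 < a → |x.1 * partial₁ (Q₁ ω) x| ≤
        C * H * x.1 ^ p + 640 / a * supNorm ω * (x.1 ^ a * d ^ (-a))) ∧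
      (0 < a + b → |x.1 * partial₂ (Q₁ ω) x| ≤
        C * H * x.1 ^ p + 640 / (a + b) * supNorm ω * (x.1 ^ a * x.2 ^ b * d ^ (-(a + b)))) := by
  obtain ⟨B, hB0, hB⟩ := exists_cutoffAt_bound
  have hq : 0 < 1 / p + 1 / (1 - p) := by
    have : 0 < 1 - p := by linarith
    positivity
  -- 400 = 80·5 with the 5 from `abs_reduced_holder`, and B bounds the bump. The 640 in the
  -- statement is 320·2, as the reduced density is at most 2‖ω‖_∞. The prefactor 2/π ≤ 1 is dropped.
  refine ⟨400 * (1 / p + 1 / (1 - p)) + B, by positivity, ?_⟩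
  intro ω h x hx d H hd hH hh hx1 hx2 a b ha0 ha1 hb0 hb1
  have h1 : 0 < x.1 := hx.1
  have h2 : 0 < x.2 := hx.2
  have m1 := min_le_left x.1 x.2
  have m2 := min_le_right x.1 x.2
  obtain ⟨F', hF, hF1, hF2⟩ := hB x (min x.1 x.2 / 2) (by positivity) (by linarith) (by linarith)
  obtain ⟨hint, hder⟩ := h.hasFDerivAt_Q₁ hx hF
  have hc : c₀ ≤ 1 := by
    rw [c₀, div_le_one Real.pi_pos]; exact Real.two_le_pi
  have hN := h.supNorm_nonneg
  have hfin : ∀ {I f T : ℝ}, |I| ≤ 80 * (5 * H) * x.1 ^ p * (1 / p + 1 / (1 - p)) + T →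
      |x.1 * f| ≤ B → |c₀ * (I + ω x * (x.1 * f))| ≤
        (400 * (1 / p + 1 / (1 - p)) + B) * H * x.1 ^ p + T := by
    intro I f T hI hf
    rw [abs_mul, abs_of_pos c₀_pos]
    calc c₀ * |I + ω x * (x.1 * f)| ≤ 1 * |I + ω x * (x.1 * f)| := by gcongr
      _ ≤ |I| + |ω x| * |x.1 * f| := by rw [one_mul, ← abs_mul]; exact abs_add_le _ _
      _ ≤ (80 * (5 * H) * x.1 ^ p * (1 / p + 1 / (1 - p)) + T) + H * x.1 ^ p * B := by gcongr
      _ = _ := by ring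
  have hred : ∀ y ∈ quad, ‖y - x‖ < d → |reduced ω x y| ≤ 5 * H * ‖y - x‖ ^ p :=
    fun y hy hyd => abs_reduced_holder hx hH hp0 hp1 hh hx1 hx2 hy hyd
  constructor
  · intro ha
    rw [partial₁_eq hder]
    have e : x.1 * (c₀ • ((∫ y in quad, reduced ω x y • DG₁ x y) + ω x • F')) (1, 0) =
        c₀ * ((∫ y in quad, reduced ω x y * (x.1 * g₁ x y)) + ω x * (x.1 * F' (1, 0))) := by
      have : (∫ y in quad, reduced ω x y • DG₁ x y) (1, 0) = ∫ y in quad, reduced ω x y * g₁ x y := by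
        rw [ContinuousLinearMap.integral_apply hint]
        simp [DG₁]
      simp only [_root_.smul_apply, _root_.add_apply, smul_eq_mul, this]
      simp only [mul_left_comm _ x.1, integral_const_mul]
      ring
    rw [e]
    refine hfin ?_ hF1
    refine (abs_setIntegral_le hx hd hp0 hp1 (by linarith) (by positivity)
      (by positivity) (fun y hy hyx => ?_) (fun y hy hyx => mul_abs_g₁_le hx hy hyx ha0 ha1) hred
      (fun y _ => h.abs_reduced_le x y)).trans (le_of_eq ?_)
    · rw [abs_mul, abs_of_pos h1]
      refine (mul_le_mul_of_nonneg_left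
        (abs_g₁_le (isQuad_of_mem hx) (isQuad_of_mem hy) hyx) h1.le).trans (le_of_eq ?_)
      ring
    · rw [add_zero, Real.rpow_zero]; ring
  · intro hab
    rw [partial₂_eq hder]
    have e : x.1 * (c₀ • ((∫ y in quad, reduced ω x y • DG₁ x y) + ω x • F')) (0, 1) =
        c₀ * ((∫ y in quad, reduced ω x y * (x.1 * g₂ x y)) + ω x * (x.1 * F' (0, 1))) := by
      have : (∫ y in quad, reduced ω x y • DG₁ x y) (0, 1) = ∫ y in quad, reduced ω x y * g₂ x y := by
        rw [ContinuousLinearMap.integral_apply hint]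
        simp [DG₁]
      simp only [_root_.smul_apply, _root_.add_apply, smul_eq_mul, this]
      simp only [mul_left_comm _ x.1, integral_const_mul]
      ring
    rw [e]
    refine hfin ?_ hF2
    refine (abs_setIntegral_le hx hd hp0 hp1 hab (by positivity)
      (by positivity) (fun y hy hyx => ?_)
      (fun y hy hyx => mul_abs_g₂_le hx hy hyx ha0 ha1 hb0 hb1) hred
      (fun y _ => h.abs_reduced_le x y)).trans (le_of_eq ?_)
    · rw [abs_mul, abs_of_pos h1]
      refine (mul_le_mul_of_nonneg_left
        (abs_g₂_le (isQuad_of_mem hx) (isQuad_of_mem hy) hyx) h1.le).trans (le_of_eq ?_)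
      ring
    · ring

/-! ### Reduction of `Q₂` to `Q₁` by exchanging the coordinates. -/

section swap

variable {ω : ℝ × ℝ → ℝ}

lemma IsVorticity.swap (h : IsVorticity ω) : IsVorticity (ω ∘ Prod.swap) where
  contDiff := h.contDiff.comp (contDiff_snd.prodMk contDiff_fst)
  periodic₁ a b := h.periodic₂ b a
  periodic₂ a b := h.periodic₁ b a
  odd₁ a b := h.odd₂ b a
  odd₂ a b := h.odd₁ b a

lemma supNorm_swap (ω : ℝ × ℝ → ℝ) : supNorm (ω ∘ Prod.swap) = supNorm ω :=
  Prod.swap_surjective.iSup_comp fun y => |ω y|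

lemma G₂_eq_swap (x y : ℝ × ℝ) : G₂ x y = G₁ x.swap y.swap := by
  simp only [G₁, G₁₁, G₁₂, G₂, G₂₁, G₂₂, sqNorm, tilde, bar, Prod.fst_sub, Prod.snd_sub,
    Prod.fst_add, Prod.snd_add, Prod.fst_swap, Prod.snd_swap, sub_neg_eq_add]
  ring

lemma swap_preimage_square (R : ℝ) : Prod.swap ⁻¹' square R = square R :=
  preimage_swap_prod _ _

lemma swap_preimage_sdiff (R : ℝ) :
    Prod.swap ⁻¹' (square R \ square 1) = square R \ square 1 := by
  rw [preimage_sdiff, swap_preimage_square, swap_preimage_square]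

lemma measurePreserving_swap_plane :
    MeasurePreserving (Prod.swap : ℝ × ℝ → ℝ × ℝ) volume volume :=
  Measure.measurePreserving_swap

lemma measurableEmbedding_swap_plane : MeasurableEmbedding (Prod.swap : ℝ × ℝ → ℝ × ℝ) :=
  MeasurableEquiv.prodComm.measurableEmbedding

lemma setIntegral_G₂ (x : ℝ × ℝ) {S : Set (ℝ × ℝ)} (hS : Prod.swap ⁻¹' S = S) :
    ∫ y in S, G₂ x y * ω y = ∫ y in S, G₁ x.swap y * (ω ∘ Prod.swap) y := by
  rw [← measurePreserving_swap_plane.setIntegral_preimage_emb measurableEmbedding_swap_plane, hS]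
  simp [G₂_eq_swap]

lemma outer_G₂ (x : ℝ × ℝ) : outer G₂ ω x = outer G₁ (ω ∘ Prod.swap) x.swap := by
  ext R
  rw [outer, outer, setIntegral_G₂ x (swap_preimage_sdiff R)]

lemma Q₂_eq_swap : Q₂ ω = Q₁ (ω ∘ Prod.swap) ∘ Prod.swap := by
  ext x
  rw [Function.comp_apply, Q₁, Q₂, potential, potential, outer_G₂,
    setIntegral_G₂ x (swap_preimage_square 1)]

lemma IsVorticity.potentialExists_G₂ (h : IsVorticity ω) {x : ℝ × ℝ} (hx : x ∈ quad) :
    PotentialExists G₂ ω x := by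
  obtain ⟨⟨h1, h2⟩, -⟩ := h.swap.potential_G₁ (x := x.swap) ⟨hx.2, hx.1⟩
  refine ⟨fun R => ?_, by rwa [outer_G₂]⟩
  have := (measurePreserving_swap_plane.integrableOn_comp_preimage
    measurableEmbedding_swap_plane).2 (h1 R)
  rw [swap_preimage_square] at this
  refine this.congr (Eventually.of_forall fun y => ?_)
  simp [G₂_eq_swap]

lemma IsVorticity.differentiableAt_Q₂ (h : IsVorticity ω) {x : ℝ × ℝ} (hx : x ∈ quad) :
    DifferentiableAt ℝ (Q₂ ω) x := by
  rw [Q₂_eq_swap]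
  exact (h.swap.differentiableAt_Q₁ (x := x.swap) ⟨hx.2, hx.1⟩).comp x
    (differentiableAt_snd.prodMk differentiableAt_fst)

lemma partial₁_Q₂ (x : ℝ × ℝ) :
    partial₁ (Q₂ ω) x = partial₂ (Q₁ (ω ∘ Prod.swap)) x.swap := by
  rw [Q₂_eq_swap]; rfl

lemma partial₂_Q₂ (x : ℝ × ℝ) :
    partial₂ (Q₂ ω) x = partial₁ (Q₁ (ω ∘ Prod.swap)) x.swap := by
  rw [Q₂_eq_swap]; rfl

end swap

/-! ### From the weighted gradient to Hölder bounds in the box. -/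

/-- A function on an interval with `|f'(s)| ≤ M s ^ (p - 1)` is `p`-Hölder. -/
lemma holder_of_deriv_le {f : ℝ → ℝ} (hf : Differentiable ℝ f) {A M p : ℝ} (hp0 : 0 < p)
    (hp1 : p ≤ 1) (hM : 0 ≤ M) (hd : ∀ s ∈ Ioo 0 A, |deriv f s| ≤ M * s ^ (p - 1)) {s t : ℝ}
    (hs : s ∈ Ico 0 A) (ht : t ∈ Ico 0 A) : |f s - f t| ≤ M / p * |s - t| ^ p := by
  have hpow : ∀ s ∈ Ioo (0 : ℝ) A, HasDerivAt (fun s => M / p * s ^ p) (M * s ^ (p - 1)) s := by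
    intro s hs
    refine ((Real.hasDerivAt_rpow_const (Or.inl hs.1.ne')).const_mul (M / p)).congr_deriv ?_
    field_simp
  have hc : Continuous fun s : ℝ => M / p * s ^ p :=
    continuous_const.mul (Real.continuous_rpow_const hp0.le)
  -- Comparison with the primitive (M/p) s^p of the derivative bound, applied below to f and -f.
  -- Continuity suffices at the endpoint 0, where the bound on the derivative may blow up.
  have mono : ∀ g : ℝ → ℝ, Differentiable ℝ g → (∀ s ∈ Ioo 0 A, |deriv g s| ≤ M * s ^ (p - 1)) →
      MonotoneOn (fun s => M / p * s ^ p - g s) (Ico 0 A) := by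
    intro g hg hgd
    refine monotoneOn_of_deriv_nonneg (convex_Ico 0 A) (hc.sub hg.continuous).continuousOn ?_ ?_
    · rw [interior_Ico]
      exact fun s hs => ((hpow s hs).sub (hg s).hasDerivAt).differentiableAt.differentiableWithinAt
    · rw [interior_Ico]
      intro s hs
      have := ((hpow s hs).sub (hg s).hasDerivAt).deriv
      change deriv (fun s => M / p * s ^ p - g s) s = _ at this
      rw [this]
      have := (abs_le.1 (hgd s hs)).2
      linarith
  have m1 := mono f hf hd
  have m2 := mono (fun s => -f s) hf.neg fun s hs => by
    rw [deriv.fun_neg, abs_neg]; exact hd s hs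
  have main : ∀ {s t : ℝ}, s ∈ Ico 0 A → t ∈ Ico 0 A → t ≤ s →
      |f s - f t| ≤ M / p * |s - t| ^ p := by
    intro s t hs ht hts
    have e1 := m1 ht hs hts
    have e2 := m2 ht hs hts
    simp only at e1 e2
    -- Subadditivity of s ↦ s^p turns the increment of the comparison function into a Hölder
    -- modulus.
    have e3 : s ^ p ≤ (s - t) ^ p + t ^ p := by
      have := Real.rpow_add_le_add_rpow (sub_nonneg.2 hts) ht.1 hp0.le hp1
      rwa [sub_add_cancel] at this
    have e4 := mul_le_mul_of_nonneg_left e3 (by positivity : 0 ≤ M / p)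
    rw [abs_of_nonneg (sub_nonneg.2 hts), abs_le]
    constructor <;> linarith
  rcases le_total t s with h | h
  · exact main hs ht h
  · rw [abs_sub_comm (f s), abs_sub_comm s]; exact main ht hs h

section box

variable {ω : ℝ × ℝ → ℝ} {α : ℝ}

lemma IsVorticity.hasFDerivAt (h : IsVorticity ω) (y : ℝ × ℝ) :
    HasFDerivAt ω (fderiv ℝ ω y) y :=
  (h.contDiff.differentiable (by norm_num) y).hasFDerivAt

/-- Needed for the real-valued `sSup` in `weightedGrad` to be an upper bound. -/
lemma IsVorticity.weightedGrad_bdd (h : IsVorticity ω) (hα : 0 ≤ α) {S : Set (ℝ × ℝ)}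
    (hS : S ⊆ Icc 0 1 ×ˢ Icc 0 1) :
    BddAbove ((fun y : ℝ × ℝ => max |y.1 ^ α * partial₁ ω y| |y.2 ^ α * partial₂ ω y|) '' S) := by
  have hc := h.contDiff.continuous_fderiv (by norm_num)
  have h1 : partial₁ ω = fun y => fderiv ℝ ω y (1, 0) :=
    funext fun y => partial₁_eq (h.hasFDerivAt y)
  have h2 : partial₂ ω = fun y => fderiv ℝ ω y (0, 1) :=
    funext fun y => partial₂_eq (h.hasFDerivAt y)
  have hp : Continuous fun s : ℝ => s ^ α := Real.continuous_rpow_const hα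
  refine BddAbove.mono (image_mono hS) ((isCompact_Icc.prod isCompact_Icc).bddAbove_image ?_)
  rw [h1, h2]
  refine Continuous.continuousOn ?_
  exact ((hp.comp continuous_fst).mul (hc.clm_apply continuous_const)).abs.max
    ((hp.comp continuous_snd).mul (hc.clm_apply continuous_const)).abs

lemma weightedGrad_nonneg (α : ℝ) (ω : ℝ × ℝ → ℝ) (S : Set (ℝ × ℝ)) : 0 ≤ weightedGrad α ω S := by
  refine Real.sSup_nonneg ?_
  rintro _ ⟨y, -, rfl⟩
  exact le_max_of_le_left (abs_nonneg _)

lemma IsVorticity.zero₁ (h : IsVorticity ω) (b : ℝ) : ω (0, b) = 0 := by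
  have := h.odd₁ 0 b
  rw [neg_zero] at this
  linarith

lemma IsVorticity.zero₂ (h : IsVorticity ω) (a : ℝ) : ω (a, 0) = 0 := by
  have := h.odd₂ a 0
  rw [neg_zero] at this
  linarith

lemma abs_le_of_weighted {s u M : ℝ} (hs : 0 < s) (h : |s ^ α * u| ≤ M) :
    |u| ≤ M * s ^ (1 - α - 1) := by
  have hp : 0 < s ^ α := Real.rpow_pos_of_pos hs α
  rw [abs_mul, abs_of_pos hp] at h
  rw [show 1 - α - 1 = -α by ring, Real.rpow_neg hs.le, ← div_eq_mul_inv, le_div_iff₀ hp]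
  linarith

/-- The Hölder bounds for the vorticity that follow from the weighted bound for its gradient. -/
lemma IsVorticity.holder_box (h : IsVorticity ω) (hα0 : 0 < α) (hα1 : α < 1) {A B : ℝ}
    (hS : Ioo 0 A ×ˢ Ioo 0 B ⊆ (Icc 0 1 ×ˢ Icc 0 1 : Set (ℝ × ℝ))) {x : ℝ × ℝ}
    (hx : x ∈ Ioo 0 A ×ˢ Ioo 0 B) :
    (∀ y ∈ Ioo 0 A ×ˢ Ioo 0 B, |ω y - ω x| ≤
      2 / (1 - α) * weightedGrad α ω (Ioo 0 A ×ˢ Ioo 0 B) * ‖y - x‖ ^ (1 - α)) ∧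
    |ω x| ≤ 2 / (1 - α) * weightedGrad α ω (Ioo 0 A ×ˢ Ioo 0 B) * x.1 ^ (1 - α) ∧
    |ω x| ≤ 2 / (1 - α) * weightedGrad α ω (Ioo 0 A ×ˢ Ioo 0 B) * x.2 ^ (1 - α) := by
  have hM := weightedGrad_nonneg α ω (Ioo 0 A ×ˢ Ioo 0 B)
  have hb := fun y (hy : y ∈ Ioo 0 A ×ˢ Ioo 0 B) =>
    le_csSup (h.weightedGrad_bdd hα0.le hS) (mem_image_of_mem _ hy)
  change ∀ y ∈ _, _ ≤ weightedGrad α ω (Ioo 0 A ×ˢ Ioo 0 B) at hb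
  generalize weightedGrad α ω (Ioo 0 A ×ˢ Ioo 0 B) = M at *
  have hd := h.contDiff.differentiable (by norm_num)
  have hp0 : 0 < 1 - α := by linarith
  have hp1 : 1 - α ≤ 1 := by linarith
  have H1 : ∀ b ∈ Ioo 0 B, ∀ s ∈ Ico 0 A, ∀ t ∈ Ico 0 A,
      |ω (s, b) - ω (t, b)| ≤ M / (1 - α) * |s - t| ^ (1 - α) := by
    intro b hb' s hs t ht
    refine holder_of_deriv_le (f := fun s => ω (s, b))
      (hd.comp (differentiable_id.prodMk (differentiable_const b))) hp0 hp1 hM ?_ hs ht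
    intro s hs
    exact abs_le_of_weighted hs.1 ((le_max_left _ _).trans (hb (s, b) ⟨hs, hb'⟩))
  have H2 : ∀ a ∈ Ioo 0 A, ∀ s ∈ Ico 0 B, ∀ t ∈ Ico 0 B,
      |ω (a, s) - ω (a, t)| ≤ M / (1 - α) * |s - t| ^ (1 - α) := by
    intro a ha s hs t ht
    refine holder_of_deriv_le (f := fun s => ω (a, s))
      (hd.comp ((differentiable_const a).prodMk differentiable_id)) hp0 hp1 hM ?_ hs ht
    intro s hs
    exact abs_le_of_weighted hs.1 ((le_max_right _ _).trans (hb (a, s) ⟨ha, hs⟩))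
  have hA : 0 < A := hx.1.1.trans hx.1.2
  have hB : 0 < B := hx.2.1.trans hx.2.2
  have hle : M / (1 - α) ≤ 2 / (1 - α) * M := by
    rw [div_mul_eq_mul_div]; gcongr; linarith
  refine ⟨fun y hy => ?_, ?_, ?_⟩
  · have e1 := H1 y.2 hy.2 y.1 (Ioo_subset_Ico_self hy.1) x.1 (Ioo_subset_Ico_self hx.1)
    have e2 := H2 x.1 hx.1 y.2 (Ioo_subset_Ico_self hy.2) x.2 (Ioo_subset_Ico_self hx.2)
    have n1 : |y.1 - x.1| ^ (1 - α) ≤ ‖y - x‖ ^ (1 - α) := by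
      gcongr; exact norm_fst_le (y - x)
    have n2 : |y.2 - x.2| ^ (1 - α) ≤ ‖y - x‖ ^ (1 - α) := by
      gcongr; exact norm_snd_le (y - x)
    -- The path through (x₁, y₂) stays in the box and moves along one axis at a time; its two legs
    -- account for the factor 2.
    calc |ω y - ω x| ≤ |ω (y.1, y.2) - ω (x.1, y.2)| + |ω (x.1, y.2) - ω (x.1, x.2)| :=
          abs_sub_le _ _ _
      _ ≤ M / (1 - α) * ‖y - x‖ ^ (1 - α) + M / (1 - α) * ‖y - x‖ ^ (1 - α) :=
          add_le_add (e1.trans (by gcongr)) (e2.trans (by gcongr))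
      _ = _ := by ring
  -- Compare with the axis, where ω vanishes by oddness.
  · have e1 := H1 x.2 hx.2 x.1 (Ioo_subset_Ico_self hx.1) 0 ⟨le_rfl, hA⟩
    rw [h.zero₁, sub_zero, sub_zero, abs_of_pos hx.1.1] at e1
    exact e1.trans (mul_le_mul_of_nonneg_right hle (Real.rpow_nonneg hx.1.1.le _))
  · have e2 := H2 x.1 hx.1 x.2 (Ioo_subset_Ico_self hx.2) 0 ⟨le_rfl, hB⟩
    rw [h.zero₂, sub_zero, sub_zero, abs_of_pos hx.2.1] at e2
    exact e2.trans (mul_le_mul_of_nonneg_right hle (Real.rpow_nonneg hx.2.1.le _))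

variable {δ₁ δ₂ δ₃ : ℝ}

lemma boxD_subset_quad : boxD δ₁ δ₂ ⊆ quad := fun _ hx => ⟨hx.1.1, hx.2.1⟩

lemma AdmissibleBox.boxD_subset (hδ : AdmissibleBox δ₁ δ₂ δ₃) :
    boxD δ₁ δ₂ ⊆ boxDhat δ₁ δ₂ δ₃ := by
  have := hδ.pos
  have := hδ.lt
  have := hδ.le
  exact prod_mono (Ioo_subset_Ioo_right (by linarith)) le_rfl

/-- A move shorter than the distance to the top stays below the top, and to the right it reaches
less than δ₁ + δ₂ ≤ δ₁ + δ₃. This is the purpose of widening D to D̂. -/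
lemma AdmissibleBox.ball_subset (hδ : AdmissibleBox δ₁ δ₂ δ₃) {x : ℝ × ℝ} (hx : x ∈ boxD δ₁ δ₂)
    {y : ℝ × ℝ} (hy : y ∈ quad) (hyx : ‖y - x‖ < δ₂ - x.2) : y ∈ boxDhat δ₁ δ₂ δ₃ := by
  have e1 := (norm_fst_le (y - x)).trans_lt hyx
  have e2 := (norm_snd_le (y - x)).trans_lt hyx
  rw [Real.norm_eq_abs, abs_lt] at e1 e2
  simp only [Prod.fst_sub, Prod.snd_sub] at e1 e2
  have h1 := hx.1.2
  have h2 := hx.2.1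
  have h3 := hδ.le
  exact ⟨⟨hy.1, by linarith⟩, ⟨hy.2, by linarith⟩⟩

/-- Estimates of the derivatives of `Q₁` and `Q₂` in the box. -/
theorem exists_deriv_bound_box (hα0 : 0 < α) (hα1 : α < 1) : ∃ C : ℝ, 0 < C ∧
    ∀ δ₁ δ₂ δ₃ : ℝ, AdmissibleBox δ₁ δ₂ δ₃ → ∀ ω : ℝ × ℝ → ℝ, IsVorticity ω →
      ∀ x ∈ boxD δ₁ δ₂, ∀ a b : ℝ, 0 ≤ a → a ≤ 1 → 0 ≤ b → b ≤ 1 → 0 < a + b →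
      (0 < a → |x.1 * partial₁ (Q₁ ω) x| ≤
        C * weightedGrad α ω (boxDhat δ₁ δ₂ δ₃) * x.1 ^ (1 - α) +
          640 / a * supNorm ω * (x.1 ^ a * (δ₂ - x.2) ^ (-a))) ∧
      (0 < a → |x.2 * partial₂ (Q₂ ω) x| ≤
        C * weightedGrad α ω (boxDhat δ₁ δ₂ δ₃) * x.2 ^ (1 - α) +
          640 / a * supNorm ω * (x.2 ^ a * (δ₂ - x.2) ^ (-a))) ∧
      |x.1 * partial₂ (Q₁ ω) x| ≤
        C * weightedGrad α ω (boxDhat δ₁ δ₂ δ₃) * x.1 ^ (1 - α) +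
          640 / (a + b) * supNorm ω * (x.1 ^ a * x.2 ^ b * (δ₂ - x.2) ^ (-(a + b))) ∧
      |x.2 * partial₁ (Q₂ ω) x| ≤
        C * weightedGrad α ω (boxDhat δ₁ δ₂ δ₃) * x.2 ^ (1 - α) +
          640 / (a + b) * supNorm ω * (x.2 ^ a * x.1 ^ b * (δ₂ - x.2) ^ (-(a + b))) := by
  have hp0 : 0 < 1 - α := by linarith
  obtain ⟨C, hC, hbound⟩ := exists_deriv_Q₁_bound hp0 (by linarith : 1 - α < 1)
  refine ⟨C * (2 / (1 - α)), by positivity, ?_⟩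
  intro δ₁ δ₂ δ₃ hδ ω h x hx a b ha0 ha1 hb0 hb1 hab
  have hxq : x ∈ quad := boxD_subset_quad hx
  have hM := weightedGrad_nonneg α ω (boxDhat δ₁ δ₂ δ₃)
  obtain ⟨hh, h1, h2⟩ := h.holder_box hα0 hα1 (A := δ₁ + δ₃) (B := δ₂) hδ.subset (hδ.boxD_subset hx)
  change ∀ y ∈ boxDhat δ₁ δ₂ δ₃, _ ≤ 2 / (1 - α) * weightedGrad α ω (boxDhat δ₁ δ₂ δ₃) * _ at hh
  change _ ≤ 2 / (1 - α) * weightedGrad α ω (boxDhat δ₁ δ₂ δ₃) * _ at h1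
  change _ ≤ 2 / (1 - α) * weightedGrad α ω (boxDhat δ₁ δ₂ δ₃) * _ at h2
  have hd : 0 < δ₂ - x.2 := sub_pos.2 hx.2.2
  obtain ⟨r1, r2⟩ := hbound ω h x hxq (δ₂ - x.2) _ hd (by positivity)
    (fun y hy hyx => hh y (hδ.ball_subset hx hy hyx)) h1 h2 a b ha0 ha1 hb0 hb1
  -- Sup norm balls are invariant under the exchange of coordinates, so the same radius d(x) serves
  -- for Q₂, while the two bounds for |ω(x)| trade places.
  obtain ⟨s1, s2⟩ := hbound (ω ∘ Prod.swap) h.swap x.swap ⟨hxq.2, hxq.1⟩ (δ₂ - x.2) _ hd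
    (by positivity) (fun y hy hyx => by
      have e : ‖y.swap - x‖ = ‖y - x.swap‖ := by
        simp [Prod.norm_def, max_comm]
      have := hh y.swap (hδ.ball_subset hx ⟨hy.2, hy.1⟩ (e ▸ hyx))
      rwa [e] at this) h2 h1 a b ha0 ha1 hb0 hb1
  rw [← partial₂_Q₂, supNorm_swap, Prod.fst_swap] at s1
  rw [← partial₁_Q₂, supNorm_swap, Prod.fst_swap, Prod.snd_swap] at s2
  simp only [← mul_assoc] at r1 r2 s1 s2 ⊢
  exact ⟨r1, s1, r2 hab, s2 hab⟩

end box

end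
end EulerBox

/-! ### The theorem: choice of the interpolation exponents. -/

theorem mainTheorem4 (α : ℝ) (hα : α ∈ Set.Ioo (0 : ℝ) (1 / 4)) :
    -- the quantities that are estimated are well defined
    (∀ δ₁ δ₂ δ₃ : ℝ, EulerBox.AdmissibleBox δ₁ δ₂ δ₃ →
      ∀ ω : ℝ × ℝ → ℝ, EulerBox.IsVorticity ω → ∀ x ∈ EulerBox.boxD δ₁ δ₂,
        EulerBox.PotentialExists EulerBox.G₁ ω x ∧ EulerBox.PotentialExists EulerBox.G₂ ω x ∧
        DifferentiableAt ℝ (EulerBox.Q₁ ω) x ∧ DifferentiableAt ℝ (EulerBox.Q₂ ω) x) ∧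
    ∃ C : ℝ, 0 < C ∧
      -- the estimate of `c`
      (∀ γ₁ ∈ Set.Ioo (0 : ℝ) 1, ∀ γ₂ ∈ Set.Ioo (0 : ℝ) 1, γ₁ + γ₂ ≤ 1 →
        ∃ C' : ℝ, 0 < C' ∧ ∀ δ₁ δ₂ δ₃ : ℝ, EulerBox.AdmissibleBox δ₁ δ₂ δ₃ →
          ∀ ω : ℝ × ℝ → ℝ, EulerBox.IsVorticity ω → ∀ x ∈ EulerBox.boxD δ₁ δ₂,
            |EulerBox.coeffC ω x| ≤
              C * EulerBox.weightedGrad α ω (EulerBox.boxDhat δ₁ δ₂ δ₃) * x.2 ^ (1 - α) +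
              C' * EulerBox.supNorm ω *
                (x.2 ^ (1 - γ₁ - γ₂) * x.1 ^ γ₂ * (δ₂ - x.2) ^ (-1 + γ₁))) ∧
      -- the estimates of `b`, `x₁ ∂_{x₁} Q₁` and `x₂ ∂_{x₂} Q₂`
      (∀ γ ∈ Set.Ioo (0 : ℝ) 1,
        ∃ C' : ℝ, 0 < C' ∧ ∀ δ₁ δ₂ δ₃ : ℝ, EulerBox.AdmissibleBox δ₁ δ₂ δ₃ →
          ∀ ω : ℝ × ℝ → ℝ, EulerBox.IsVorticity ω → ∀ x ∈ EulerBox.boxD δ₁ δ₂,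
            |EulerBox.coeffB ω x| ≤
              C * EulerBox.weightedGrad α ω (EulerBox.boxDhat δ₁ δ₂ δ₃) * x.1 ^ (1 - α) *
                (1 + |Real.log (δ₂ - x.2)|) +
              C' * EulerBox.supNorm ω * (x.1 ^ (1 - γ) * (δ₂ - x.2) ^ (-1 + γ)) ∧
            |x.1 * EulerBox.partial₁ (EulerBox.Q₁ ω) x| ≤
              C * EulerBox.weightedGrad α ω (EulerBox.boxDhat δ₁ δ₂ δ₃) * x.1 ^ (1 - α) *
                (1 + |Real.log (δ₂ - x.2)|) +
              C' * EulerBox.supNorm ω * (x.1 ^ (1 - γ) * (δ₂ - x.2) ^ (-1 + γ)) ∧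
            |x.2 * EulerBox.partial₂ (EulerBox.Q₂ ω) x| ≤
              C * EulerBox.weightedGrad α ω (EulerBox.boxDhat δ₁ δ₂ δ₃) * x.2 ^ (1 - α) *
                (1 + |Real.log (δ₂ - x.2)|) +
              C' * EulerBox.supNorm ω * (x.2 ^ (1 - γ) * (δ₂ - x.2) ^ (-1 + γ))) := by
  refine ⟨fun δ₁ δ₂ δ₃ _ ω h x hx => ?_, ?_⟩
  · have hxq := EulerBox.boxD_subset_quad hx
    exact ⟨(h.potential_G₁ hxq).1, h.potentialExists_G₂ hxq, h.differentiableAt_Q₁ hxq,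
      h.differentiableAt_Q₂ hxq⟩
  obtain ⟨C, hC, hb⟩ := EulerBox.exists_deriv_bound_box hα.1 (by linarith [hα.2] : α < 1)
  refine ⟨C, hC, fun γ₁ h₁ γ₂ h₂ hγ => ?_, fun γ hγ => ?_⟩
  · have hs : 0 < 1 - γ₁ - γ₂ + γ₂ := by linarith [h₁.2]
    refine ⟨640 / (1 - γ₁ - γ₂ + γ₂), by positivity, fun δ₁ δ₂ δ₃ hδ ω h x hx => ?_⟩
    -- The first exponent vanishes when γ₁ + γ₂ = 1; the mixed derivatives require only that the
    -- sum, here 1 - γ₁, be positive.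
    obtain ⟨-, -, -, hc⟩ := hb δ₁ δ₂ δ₃ hδ ω h x hx (1 - γ₁ - γ₂) γ₂ (by linarith)
      (by linarith [h₁.1, h₂.1]) h₂.1.le h₂.2.le hs
    rw [EulerBox.coeffC, neg_mul, abs_neg]
    rwa [show -(1 - γ₁ - γ₂ + γ₂) = -1 + γ₁ by ring] at hc
  · have hs : 0 < 1 - γ := by linarith [hγ.2]
    refine ⟨640 / (1 - γ), by positivity, fun δ₁ δ₂ δ₃ hδ ω h x hx => ?_⟩
    obtain ⟨e1, e2, e3, -⟩ := hb δ₁ δ₂ δ₃ hδ ω h x hx (1 - γ) 0 hs.le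
      (by linarith [hγ.1]) le_rfl zero_le_one (by linarith)
    have hM := EulerBox.weightedGrad_nonneg α ω (EulerBox.boxDhat δ₁ δ₂ δ₃)
    have hx1 : 0 < x.1 := hx.1.1
    have hx2 : 0 < x.2 := hx.2.1
    -- The estimates hold without the logarithmic factor, which is at least 1 and is inserted only
    -- here.
    have hlog : ∀ {T : ℝ}, 0 ≤ T → T ≤ T * (1 + |Real.log (δ₂ - x.2)|) := fun hT =>
      le_mul_of_one_le_right hT (by linarith [abs_nonneg (Real.log (δ₂ - x.2))])
    have t1 := hlog (by positivity :
      0 ≤ C * EulerBox.weightedGrad α ω (EulerBox.boxDhat δ₁ δ₂ δ₃) * x.1 ^ (1 - α))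
    have t2 := hlog (by positivity :
      0 ≤ C * EulerBox.weightedGrad α ω (EulerBox.boxDhat δ₁ δ₂ δ₃) * x.2 ^ (1 - α))
    have hexp : -(1 - γ) = -1 + γ := by ring
    rw [add_zero, Real.rpow_zero, mul_one, hexp] at e3
    rw [hexp] at e1 e2
    exact ⟨e3.trans (by gcongr), (e1 hs).trans (by gcongr), (e2 hs).trans (by gcongr)⟩
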